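/- **Theorem 3.4.** Let $(M,g)$ be a smooth four-dimensional Lorentzian manifold (signature $(+,-,-,-)$) with a spin structure (so that $M$ is oriented and time-oriented), let $a,b\in C^\infty(M)$ and let $\varphi\in\mathfrak X(M)$ be a smooth vector field. Let $S(M)$ be the real rank-four spinor bundle, with Clifford multiplication $v\cdot v\cdot s=-g(v,v)s$ and with a spin-invariant fibrewise symplectic form $\langle-,-\rangle$ satisfying $\langle v\cdot s,t\rangle=-\langle s,v\cdot t\rangle$. Let $\operatorname{vol}=e_0\cdot e_1\cdot e_2\cdot e_3$ for oriented orthonormal frames, let $\nabla$ be the Levi-Civita connection and its lift to $S(M)$, and put $$D_X\varepsilon=\nabla_X\varepsilon-X\cdot(a+b\operatorname{vol})\cdot\varepsilon+(\varphi\wedge X)\cdot\operatorname{vol}\cdot\varepsilon-2g(\varphi,X)\operatorname{vol}\cdot\varepsilon .$$ Define $$\mathfrak k_{\bar 0}=\{X\in\mathfrak X(M): \mathcal L_Xg=0,\ \mathcal L_Xa=\mathcal L_Xb=0,\ \mathcal L_X\varphi=0\},\qquad \mathfrak k_{\bar 1}=\{\varepsilon\in\Gamma(S(M)): D_X\varepsilon=0\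 \text{for all } X\in\mathfrak X(M)\}.$$ Let $\kappa$ be the symmetric bilinear map with $g(\kappa(\varepsilon,\varepsilon),Z)=\langle\varepsilon,Z\cdot\varepsilon\rangle$ (the Dirac current), and for $X\in\mathfrak k_{\bar0}$ let $\mathcal L_X\varepsilon=\nabla_X\varepsilon+\sigma(A_X)\varepsilon$ be the spinorial Lie derivative, where $A_X=-\nabla X\in\mathfrak{so}(TM)$ and $\sigma$ is the spin representation, normalised by $[\sigma(A),v\,\cdot\,]=A(v)\,\cdot$. Then for all $X,Y\in\mathfrak k_{\bar 0}$ and $\varepsilon\in\mathfrak k_{\bar 1}$ one has $[X,Y]\in\mathfrak k_{\bar 0}$, $\kappa(\varepsilon,\varepsilon)\in\mathfrak k_{\bar 0}$ (that is, the Dirac current of a Killing spinor preserves $g$, $a$, $b$ and $\varphi$) and $\mathcal L_X\varepsilon\in\mathfrak k_{\bar 1}$. Moreover $\mathfrak k=\mathfrak k_{\bar 0}\oplus\mathfrak k_{\bar 1}$ is a real Lie superalgebra with the bracket $$[X+\varepsilon,\,Y+\varepsilon']=\big([X,Y]+\kappa(\varepsilon,\varepsilon')\big)+\big(\mathcal L_X\varepsilon'-\mathcal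 L_Y\varepsilon\big),\qquad X,Y\in\mathfrak k_{\bar 0},\ \varepsilon,\varepsilon'\in\mathfrak k_{\bar 1}.$$ -/

import Mathlib

open scoped Manifold ContDiff Matrix
open Bundle VectorField

noncomputable section

namespace KillingSuper

/-! ## The Clifford algebra of Minkowski space and its real spinor module -/

/-- The diagonal of the mostly minus Minkowski metric, `η = diag(+1, -1, -1, -1)`. -/
def eta : Fin 4 → ℝ := ![1, -1, -1, -1]

/-- The quadratic form of the Clifford relation `v ^ 2 = - η(v, v)`. -/
def cliffordForm : QuadraticForm ℝ (Fin 4 → ℝ) :=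
  QuadraticMap.weightedSumSquares ℝ (fun μ => -eta μ)

/-- The real spinor module, of dimension four. -/
abbrev Spinor : Type := Fin 4 → ℝ

/-- Real gamma matrices: `Γ_μ Γ_ν + Γ_ν Γ_μ = - 2 η_{μν}`. -/
def gam : Fin 4 → Matrix (Fin 4) (Fin 4) ℝ :=
  ![!![0, 1, 0, 0; -1, 0, 0, 0; 0, 0, 0, 1; 0, 0, -1, 0],
    !![0, 1, 0, 0; 1, 0, 0, 0; 0, 0, 0, 1; 0, 0, 1, 0],
    !![0, 0, 1, 0; 0, 0, 0, -1; 1, 0, 0, 0; 0, -1, 0, 0],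
    !![1, 0, 0, 0; 0, -1, 0, 0; 0, 0, -1, 0; 0, 0, 0, 1]]

/-- Clifford multiplication by a vector `v = v^μ e_μ` of Minkowski space. -/
def slash : (Fin 4 → ℝ) →ₗ[ℝ] Matrix (Fin 4) (Fin 4) ℝ :=
  ∑ μ, (LinearMap.proj μ : (Fin 4 → ℝ) →ₗ[ℝ] ℝ).smulRight (gam μ)

theorem slash_mul_slash (v : Fin 4 → ℝ) :
    slash v * slash v = algebraMap ℝ (Matrix (Fin 4) (Fin 4) ℝ) (cliffordForm v) := by
  have h : slash v = v 0 • gam 0 + v 1 • gam 1 + v 2 • gam 2 + v 3 • gam 3 := by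
    simp [slash, Fin.sum_univ_four]
  rw [h, Matrix.algebraMap_eq_diagonal]
  ext i j
  fin_cases i <;> fin_cases j <;>
    simp [gam, eta, cliffordForm, QuadraticMap.weightedSumSquares_apply, Matrix.mul_apply,
      Fin.sum_univ_four] <;> ring

/-- The action of the Clifford algebra on the spinor module. -/
def spinRep : CliffordAlgebra cliffordForm →ₐ[ℝ] Matrix (Fin 4) (Fin 4) ℝ :=
  CliffordAlgebra.lift cliffordForm ⟨slash, slash_mul_slash⟩

/-- The volume element `vol = e_0 ∧ e_1 ∧ e_2 ∧ e_3`, acting on spinors. -/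
def volMat : Matrix (Fin 4) (Fin 4) ℝ := gam 0 * gam 1 * gam 2 * gam 3

/-- The bivector `v ∧ w`, acting on spinors. -/
def wedgeMat (v w : Fin 4 → ℝ) : Matrix (Fin 4) (Fin 4) ℝ :=
  (1 / 2 : ℝ) • (slash v * slash w - slash w * slash v)

/-- The spin representation `σ(A) = - 1/4 A^{μν} Γ_{μν}` of an `η`-skew endomorphism `A`,
given by the entries `A_{μν} = η(e_μ, A e_ν)`; here `Γ_{μν} = 1/2 [Γ_μ, Γ_ν]`. -/
def spinSigma (A : Fin 4 → Fin 4 → ℝ) : Matrix (Fin 4) (Fin 4) ℝ :=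
  -(1 / 4 : ℝ) • ∑ μ, ∑ ν,
    (eta μ * eta ν * A μ ν) • ((1 / 2 : ℝ) • (gam μ * gam ν - gam ν * gam μ))

/-- A symplectic form on the spinor module for which Clifford multiplication by vectors is skew:
`⟨v · s, t⟩ = - ⟨s, v · t⟩`. -/
structure SpinorPairing where
  form : LinearMap.BilinForm ℝ Spinor
  isAlt : form.IsAlt
  nondegenerate : form.Nondegenerate
  skew : ∀ (v : Fin 4 → ℝ) (s t : Spinor), form (slash v *ᵥ s) t = -form s (slash v *ᵥ t)

/-- The action of an element of the spin group on spinors. -/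
def spinAction (h : spinGroup cliffordForm) : Spinor →L[ℝ] Spinor :=
  LinearMap.toContinuousLinearMap
    (Matrix.mulVecLin (spinRep (h : CliffordAlgebra cliffordForm)))

/-! ## Lorentzian spin four-manifolds -/

section Manifold

variable {M : Type*} [TopologicalSpace M] [ChartedSpace (EuclideanSpace ℝ (Fin 4)) M]

/-- Vector fields on `M`, with no regularity imposed. -/
abbrev VField (M : Type*) [TopologicalSpace M] [ChartedSpace (EuclideanSpace ℝ (Fin 4)) M] :
    Type _ :=
  Π x : M, TangentSpace (𝓡 4) x

variable [IsManifold (𝓡 4) ∞ M]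

/-- Smooth vector fields. -/
def SmoothField (X : VField M) : Prop :=
  ContMDiff (𝓡 4) (𝓡 4).tangent ∞ (fun x => (⟨x, X x⟩ : TangentBundle (𝓡 4) M))

variable (M) in
/-- A smooth Lorentzian metric of signature `(+, -, -, -)`. -/
structure LorentzianMetric where
  inner (x : M) : TangentSpace (𝓡 4) x →L[ℝ] TangentSpace (𝓡 4) x →L[ℝ] ℝ
  symm (x : M) (v w : TangentSpace (𝓡 4) x) : inner x v w = inner x w v
  contMDiff : ContMDiff (𝓡 4)
    ((𝓡 4).prod 𝓘(ℝ, EuclideanSpace ℝ (Fin 4) →L[ℝ] EuclideanSpace ℝ (Fin 4) →L[ℝ] ℝ)) ∞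
    (fun x => TotalSpace.mk' (EuclideanSpace ℝ (Fin 4) →L[ℝ] EuclideanSpace ℝ (Fin 4) →L[ℝ] ℝ)
      x (inner x))
  lorentzian (x : M) : ∃ b : Module.Basis (Fin 4) ℝ (TangentSpace (𝓡 4) x),
    ∀ μ ν, inner x (b μ) (b ν) = if μ = ν then eta μ else 0

namespace LorentzianMetric

variable (g : LorentzianMetric M)

/-- The function `g(X, Y)`. -/
def pair (X Y : VField M) (x : M) : ℝ := g.inner x (X x) (Y x)

/-- `g(∇_Y X, Z)` for the Levi-Civita connection `∇` of `g`, given by the Koszul formula. -/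
def nablaPair (Y X Z : VField M) (x : M) : ℝ :=
  (1 / 2 : ℝ) *
    (mvfderiv (𝓡 4) (g.pair X Z) x (Y x) + mvfderiv (𝓡 4) (g.pair Y Z) x (X x)
      - mvfderiv (𝓡 4) (g.pair Y X) x (Z x)
      + g.pair (mlieBracket (𝓡 4) Y X) Z x - g.pair (mlieBracket (𝓡 4) Y Z) X x
      - g.pair (mlieBracket (𝓡 4) X Z) Y x)

/-- The Lie derivative of the metric, `(L_X g)(Y, Z)`. -/
def lieDeriv (X Y Z : VField M) (x : M) : ℝ :=
  mvfderiv (𝓡 4) (g.pair Y Z) x (X x) - g.pair (mlieBracket (𝓡 4) X Y) Z x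
    - g.pair Y (mlieBracket (𝓡 4) X Z) x

end LorentzianMetric

/-- A spin structure on `(M, g)`, presented by an open cover with smooth `g`-orthonormal frames and
a smooth Čech cocycle with values in the spin group which lifts the change of frames through the
vector representation `v ↦ h v h⁻¹`. In this signature `spinGroup cliffordForm` (even products `h`
of non-null vectors with `star h * h = 1`) is the identity component `SL(2, ℂ)` of the spin group,
so the frames orient and time-orient `M`. -/
structure SpinStructure (ι : Type*) (g : LorentzianMetric M) where
  baseSet : ι → Set M
  isOpen_baseSet : ∀ i, IsOpen (baseSet i)
  indexAt : M → ι
  mem_baseSet_at : ∀ x, x ∈ baseSet (indexAt x)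
  frame : ι → Fin 4 → VField M
  contMDiffOn_frame : ∀ i μ, ContMDiffOn (𝓡 4) (𝓡 4).tangent ∞
    (fun x => (⟨x, frame i μ x⟩ : TangentBundle (𝓡 4) M)) (baseSet i)
  orthonormal_frame : ∀ i, ∀ x ∈ baseSet i, ∀ μ ν,
    g.inner x (frame i μ x) (frame i ν x) = if μ = ν then eta μ else 0
  transition : ι → ι → M → spinGroup cliffordForm
  contMDiffOn_transition : ∀ i j, ContMDiffOn (𝓡 4) 𝓘(ℝ, Spinor →L[ℝ] Spinor) ∞
    (fun x => spinAction (transition i j x)) (baseSet i ∩ baseSet j)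
  transition_self : ∀ i, ∀ x ∈ baseSet i, transition i i x = 1
  transition_comp : ∀ i j k, ∀ x ∈ baseSet i ∩ baseSet j ∩ baseSet k,
    transition j k x * transition i j x = transition i k x
  transition_frame : ∀ i j, ∀ x ∈ baseSet i ∩ baseSet j, ∀ v w : Fin 4 → ℝ,
    ∑ μ, v μ • frame i μ x = ∑ μ, w μ • frame j μ x →
      (transition i j x : CliffordAlgebra cliffordForm) * CliffordAlgebra.ι cliffordForm v =
        CliffordAlgebra.ι cliffordForm w * (transition i j x : CliffordAlgebra cliffordForm)

namespace SpinStructure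

variable {ι : Type*} {g : LorentzianMetric M} (S : SpinStructure ι g)

/-- The spinor bundle `S(M)`, associated to the spin structure by the spinor module. -/
def spinorBundle : VectorBundleCore ℝ M Spinor ι where
  baseSet := S.baseSet
  isOpen_baseSet := S.isOpen_baseSet
  indexAt := S.indexAt
  mem_baseSet_at := S.mem_baseSet_at
  coordChange i j x := spinAction (S.transition i j x)
  coordChange_self i x hx v := by
    simp [S.transition_self i x hx, spinAction]
  continuousOn_coordChange i j := (S.contMDiffOn_transition i j).continuousOn
  coordChange_comp i j k x hx v := by
    simp [← S.transition_comp i j k x hx, spinAction]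

instance : S.spinorBundle.IsContMDiff (𝓡 4) ∞ := ⟨S.contMDiffOn_transition⟩

/-- Sections of the spinor bundle, with no regularity imposed. -/
abbrev SpinorField : Type _ := Π x : M, S.spinorBundle.Fiber x

/-- Smooth sections of the spinor bundle. -/
def SmoothSpinor (ε : S.SpinorField) : Prop :=
  ContMDiff (𝓡 4) ((𝓡 4).prod 𝓘(ℝ, Spinor)) ∞
    (fun x => TotalSpace.mk' Spinor x (ε x))

/-- The fibre of the spinor bundle over `x` is the spinor module, read in the frame of index
`indexAt x`. -/
def fiberEquiv (x : M) : S.spinorBundle.Fiber x ≃ₗ[ℝ] Spinor := LinearEquiv.refl ℝ Spinor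

/-- The components of a spinor field in the frame of index `i`. -/
def localRep (i : ι) (ε : S.SpinorField) (x : M) : Spinor :=
  spinAction (S.transition (S.indexAt x) i x) (S.fiberEquiv x (ε x))

/-- The components `v^μ` of a tangent vector at `x` in the frame of index `indexAt x`. -/
def comp (x : M) (v : TangentSpace (𝓡 4) x) (μ : Fin 4) : ℝ :=
  eta μ * g.inner x v (S.frame (S.indexAt x) μ x)

/-- An endomorphism of the spinor module acting on the fibre over `x`, in the frame of index
`indexAt x`. -/
def act (x : M) (m : Matrix (Fin 4) (Fin 4) ℝ) :
    S.spinorBundle.Fiber x →ₗ[ℝ] S.spinorBundle.Fiber x :=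
  (S.fiberEquiv x).symm.toLinearMap ∘ₗ Matrix.mulVecLin m ∘ₗ (S.fiberEquiv x).toLinearMap

/-- The Levi-Civita connection on spinor fields. In the frame `(e_μ)` around `x` it is
`∇_Y ε = Y(ε) + σ(ω(Y)) ε`, where `ω(Y) e_ν = ∇_Y e_ν`. -/
def nabla (Y : VField M) (ε : S.SpinorField) : S.SpinorField := fun x =>
  (S.fiberEquiv x).symm
    (mvfderiv (𝓡 4) (S.localRep (S.indexAt x) ε) x (Y x)) +
  S.act x (spinSigma fun μ ν =>
    g.nablaPair Y (S.frame (S.indexAt x) ν) (S.frame (S.indexAt x) μ) x) (ε x)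

/-- The spinorial Lie derivative of Lichnerowicz and Kosmann, `L_X ε = ∇_X ε + σ(A_X) ε` with
`A_X = - ∇ X`. -/
def kosmann (X : VField M) (ε : S.SpinorField) : S.SpinorField := fun x =>
  S.nabla X ε x +
  S.act x (spinSigma fun μ ν =>
    -g.nablaPair (S.frame (S.indexAt x) ν) X (S.frame (S.indexAt x) μ) x) (ε x)

/-- The Dirac current `κ` of a spinor field, `κ^μ = ⟨ε, Γ^μ ε⟩`; equivalently
`g(κ, v) = ⟨ε, v · ε⟩`. -/
def diracCurrent (C : SpinorPairing) (ε : S.SpinorField) : VField M := fun x =>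
  ∑ μ, (eta μ * C.form (S.fiberEquiv x (ε x)) (gam μ *ᵥ S.fiberEquiv x (ε x))) •
    S.frame (S.indexAt x) μ x

/-- The symmetric bilinear map `κ(ε₁, ε₂)` obtained from the Dirac current by polarisation. -/
def kappa (C : SpinorPairing) (ε₁ ε₂ : S.SpinorField) : VField M :=
  (1 / 2 : ℝ) •
    (S.diracCurrent C (ε₁ + ε₂) - S.diracCurrent C ε₁ - S.diracCurrent C ε₂)

/-- The connection
`D_X ε = ∇_X ε - X · (a + b vol) · ε + (φ ∧ X) · vol · ε - 2 g(φ, X) vol · ε`. -/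
def gravitino (a b : M → ℝ) (φ : VField M) (X : VField M) (ε : S.SpinorField) :
    S.SpinorField := fun x =>
  S.nabla X ε x
    - S.act x (slash (S.comp x (X x)) * (a x • (1 : Matrix (Fin 4) (Fin 4) ℝ) + b x • volMat)) (ε x)
    + S.act x (wedgeMat (S.comp x (φ x)) (S.comp x (X x)) * volMat) (ε x)
    - (2 * g.pair φ X x) • S.act x volMat (ε x)

end SpinStructure

/-! ## The Killing superalgebra -/

theorem SmoothField.mdifferentiableAt {X : VField M} (hX : SmoothField X) (x : M) :
    MDifferentiableAt (𝓡 4) (𝓡 4).tangent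
      (fun y => (⟨y, X y⟩ : TangentBundle (𝓡 4) M)) x :=
  (hX x).mdifferentiableAt (by simp)

/-- The symmetries of `(g, a, b, φ)`: smooth vector fields `X` with
`L_X g = L_X a = L_X b = L_X φ = 0`. -/
def symmetries (g : LorentzianMetric M) (a b : M → ℝ) (φ : VField M) :
    Submodule ℝ (VField M) where
  carrier := {X | SmoothField X ∧
    (∀ Y Z : VField M, SmoothField Y → SmoothField Z → ∀ x, g.lieDeriv X Y Z x = 0) ∧
    (∀ x, mvfderiv (𝓡 4) a x (X x) = 0) ∧ (∀ x, mvfderiv (𝓡 4) b x (X x) = 0) ∧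
    ∀ x, mlieBracket (𝓡 4) X φ x = 0}
  zero_mem' := by
    refine ⟨contMDiff_zeroSection ℝ (TangentSpace (𝓡 4) : M → Type _), ?_, ?_, ?_, ?_⟩ <;>
      simp [LorentzianMetric.lieDeriv, LorentzianMetric.pair]
  add_mem' := by
    rintro X X' ⟨h0, h1, h2, h3, h4⟩ ⟨h0', h1', h2', h3', h4'⟩
    refine ⟨ContMDiff.add_section h0 h0', ?_, ?_, ?_, ?_⟩
    · intro Y Z hY hZ x
      have e := h1 Y Z hY hZ x
      have e' := h1' Y Z hY hZ x
      simp only [LorentzianMetric.lieDeriv, LorentzianMetric.pair] at e e' ⊢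
      rw [mlieBracket_add_left (h0.mdifferentiableAt x) (h0'.mdifferentiableAt x),
        mlieBracket_add_left (h0.mdifferentiableAt x) (h0'.mdifferentiableAt x)]
      simp only [Pi.add_apply, map_add, _root_.add_apply]
      linarith
    · intro x; simp [h2 x, h2' x]
    · intro x; simp [h3 x, h3' x]
    · intro x
      rw [mlieBracket_add_left (h0.mdifferentiableAt x) (h0'.mdifferentiableAt x), h4 x, h4' x,
        add_zero]
  smul_mem' := by
    rintro c X ⟨h0, h1, h2, h3, h4⟩
    refine ⟨ContMDiff.const_smul_section h0, ?_, ?_, ?_, ?_⟩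
    · intro Y Z hY hZ x
      have e := h1 Y Z hY hZ x
      simp only [LorentzianMetric.lieDeriv, LorentzianMetric.pair] at e ⊢
      rw [mlieBracket_const_smul_left (h0.mdifferentiableAt x),
        mlieBracket_const_smul_left (h0.mdifferentiableAt x)]
      simp only [Pi.smul_apply, map_smul, _root_.smul_apply, smul_eq_mul]
      linear_combination c * e
    · intro x; simp [h2 x]
    · intro x; simp [h3 x]
    · intro x
      rw [mlieBracket_const_smul_left (h0.mdifferentiableAt x), h4 x, smul_zero]

namespace SpinStructure

variable {ι : Type*} {g : LorentzianMetric M} (S : SpinStructure ι g)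

theorem SmoothSpinor.mdifferentiableAt_localRep {S : SpinStructure ι g} {ε : S.SpinorField}
    (hε : S.SmoothSpinor ε) (x : M) :
    MDifferentiableAt (𝓡 4) 𝓘(ℝ, Spinor) (S.localRep (S.indexAt x) ε) x := by
  have h : MDifferentiableAt (𝓡 4) ((𝓡 4).prod 𝓘(ℝ, Spinor))
      (fun y => TotalSpace.mk' Spinor y (ε y)) x := (hε x).mdifferentiableAt (by simp)
  exact (mdifferentiableAt_section (𝓡 4) ε).1 h

theorem nabla_add {ε ε' : S.SpinorField} (h : S.SmoothSpinor ε) (h' : S.SmoothSpinor ε')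
    (Y : VField M) : S.nabla Y (ε + ε') = S.nabla Y ε + S.nabla Y ε' := by
  funext x
  have e : S.localRep (S.indexAt x) (ε + ε') =
      S.localRep (S.indexAt x) ε + S.localRep (S.indexAt x) ε' := by
    funext y; simp [localRep]
  simp only [nabla, Pi.add_apply, e]
  rw [mvfderiv_add (h.mdifferentiableAt_localRep x) (h'.mdifferentiableAt_localRep x)]
  simp only [_root_.add_apply, map_add]
  abel

theorem nabla_smul (c : ℝ) {ε : S.SpinorField} (h : S.SmoothSpinor ε)
    (Y : VField M) : S.nabla Y (c • ε) = c • S.nabla Y ε := by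
  funext x
  have e : S.localRep (S.indexAt x) (c • ε) = c • S.localRep (S.indexAt x) ε := by
    funext y; simp [localRep]
  have e' : mvfderiv (𝓡 4) (c • S.localRep (S.indexAt x) ε) x =
      c • mvfderiv (𝓡 4) (S.localRep (S.indexAt x) ε) x := by
    ext v
    simp only [mvfderiv, const_smul_mfderiv (h.mdifferentiableAt_localRep x) c]
    rfl
  simp only [nabla, Pi.smul_apply, e, e', map_smul, _root_.smul_apply, smul_add]

/-- The Killing spinors: smooth spinor fields `ε` with `D_X ε = 0` for all smooth vector
fields `X`. -/
def killingSpinors (a b : M → ℝ) (φ : VField M) : Submodule ℝ S.SpinorField where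
  carrier := {ε | S.SmoothSpinor ε ∧
    ∀ X : VField M, SmoothField X → S.gravitino a b φ X ε = 0}
  zero_mem' := by
    have h0 : S.SmoothSpinor 0 := contMDiff_zeroSection ℝ S.spinorBundle.Fiber
    refine ⟨h0, fun X _ => ?_⟩
    have e := S.nabla_smul 0 h0 X
    rw [zero_smul, zero_smul] at e
    funext x
    simp [gravitino, e]
  add_mem' := by
    rintro ε ε' ⟨h, hD⟩ ⟨h', hD'⟩
    refine ⟨ContMDiff.add_section h h', fun X hX => ?_⟩
    have e : S.gravitino a b φ X (ε + ε') =
        S.gravitino a b φ X ε + S.gravitino a b φ X ε' := by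
      funext x
      simp only [gravitino, S.nabla_add h h', Pi.add_apply, map_add, smul_add]
      abel
    rw [e, hD X hX, hD' X hX, add_zero]
  smul_mem' := by
    rintro c ε ⟨h, hD⟩
    refine ⟨ContMDiff.const_smul_section h, fun X hX => ?_⟩
    have e : S.gravitino a b φ X (c • ε) = c • S.gravitino a b φ X ε := by
      funext x
      simp only [gravitino, S.nabla_smul c h, Pi.smul_apply, map_smul, smul_sub, smul_add]
      rw [smul_comm c (2 * g.pair φ X x)]
    rw [e, hD X hX, smul_zero]

/-- The bracket on pairs (vector field, spinor field): the commutator of vector fields on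
even-even, the Dirac current on odd-odd, and the spinorial Lie derivative on even-odd. -/
def superBracket (C : SpinorPairing) (p q : VField M × S.SpinorField) :
    VField M × S.SpinorField :=
  (mlieBracket (𝓡 4) p.1 q.1 + S.kappa C p.2 q.2, S.kosmann p.1 q.2 - S.kosmann q.1 p.2)

end SpinStructure

end Manifold

/-! ## Lie superalgebras -/

/-- A bilinear bracket `B` makes the module `L`, graded by `L = 𝒜 0 ⊕ 𝒜 1`, a Lie superalgebra. -/
structure IsLieSuperalgebra {L : Type*} [AddCommGroup L] [Module ℝ L]
    (𝒜 : ZMod 2 → Submodule ℝ L) (B : L →ₗ[ℝ] L →ₗ[ℝ] L) : Prop where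
  isInternal : DirectSum.IsInternal 𝒜
  bracket_mem : ∀ i j x y, x ∈ 𝒜 i → y ∈ 𝒜 j → B x y ∈ 𝒜 (i + j)
  skew : ∀ i j x y, x ∈ 𝒜 i → y ∈ 𝒜 j → B x y = -((-1 : ℝ) ^ (i.val * j.val) • B y x)
  jacobi : ∀ i j x y z, x ∈ 𝒜 i → y ∈ 𝒜 j →
    B x (B y z) = B (B x y) z + (-1 : ℝ) ^ (i.val * j.val) • B y (B x z)

/-- The grading of `V₀ × V₁` with even part `V₀` and odd part `V₁`. -/
def superGrading (V₀ V₁ : Type*) [AddCommGroup V₀] [Module ℝ V₀] [AddCommGroup V₁] [Module ℝ V₁] :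
    ZMod 2 → Submodule ℝ (V₀ × V₁) :=
  fun i => if i = 0 then Submodule.prod ⊤ ⊥ else Submodule.prod ⊥ ⊤

end KillingSuper

end

noncomputable section

namespace KillingSuper

/-! ## Algebra of the spinor module -/

/-! Write the Killing spinor equation as `∇_Y ε = K_Y ε`, where `K` is `killMat`, built from `a`,
`b`, `φ` by Clifford multiplication. Everything is then transferred to a local orthonormal frame
`e_μ`. There a spinor field is four functions and a vector field is four components. Differential
statements become identities over the algebra of functions smooth on the frame domain
(`FrameCalculus`), and these are evaluated at a point to reduce them to real 4 × 4 matrix algebra.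

Even-even and even-odd sectors. Put `Λ_X = (g(e_μ, [X, e_ν]))`; it is skew exactly when `X` is
Killing. Torsion-freeness gives `∇_X e_ν - ∇_{e_ν} X = [X, e_ν]`, so the spinorial Lie derivative is
`X + σ(Λ_X)`, with no connection left in it. The Jacobi identity for `X, Y, e_ν` and the fact that
`σ` is a homomorphism make this a representation (`lieSpinor_bracket`). Equivariance of the Dirac
current makes it a derivation of `κ` (`bracket_currentA`). It preserves Killing spinors because a
Killing field preserves the Levi-Civita connection (`lie_christoffel`) and `K` is Lorentz
equivariant (`killMat_equivariant`), so that only the derivatives of `a`, `b`, `φ` along `X` could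
obstruct, and these vanish.

Odd-odd sector. By the Killing equation `∇κ` is algebraic in `ε`, and it is skew
(`isSkew_currentDeriv`), so `κ` is Killing. Invariance of `a`, `b`, `φ` lies one order deeper: the
curvature of `D` annihilates `ε`, and suitable contractions of that equation with `ε` eliminate the
Riemann tensor and leave `κ(a) = κ(b) = 0` and `∇_κ φ = ∇_φ κ` (`killCurvature_integrability`). The
odd-odd-odd Jacobi identity is the polarisation of `L_{κ(ε,ε)} ε = 0`, a cubic identity in one
spinor (`killMat_current_add_spinSigma`).

Gluing. The geometric operators are defined at `x` in the frame chosen at `x`, and that choice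
varies with `x`. Before they can be differentiated they must be rewritten in one fixed frame near
the point. This needs covariance under the spin-valued transition functions (`spinMat_gauge`), which
follows from a Schur lemma together with invariance of the symplectic form. -/

/-- The Minkowski inner product of two vectors given by their components. -/
def mink (v w : Fin 4 → ℝ) : ℝ := ∑ μ, eta μ * v μ * w μ

/-- The endomorphism `A`, given by the entries `A_{μν} = η(e_μ, A e_ν)`, applied to a vector. -/
def lowerApply (A : Fin 4 → Fin 4 → ℝ) (v : Fin 4 → ℝ) : Fin 4 → ℝ :=
  fun μ => eta μ * ∑ ν, A μ ν * v ν

/-- The entries `η(e_μ, A B e_ν)` of a composite of endomorphisms. -/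
def lowerMul (A B : Fin 4 → Fin 4 → ℝ) : Fin 4 → Fin 4 → ℝ :=
  fun μ ν => ∑ ρ, eta ρ * A μ ρ * B ρ ν

/-- Skewness of the entries `A_{μν}` of an endomorphism. -/
def IsSkew {R : Type*} [Neg R] (A : Fin 4 → Fin 4 → R) : Prop := ∀ μ ν, A μ ν = -A ν μ

theorem IsSkew.apply_self {A : Fin 4 → Fin 4 → ℝ} (hA : IsSkew A) (μ : Fin 4) : A μ μ = 0 := by
  have := hA μ μ; linarith

/-! ### Arithmetic of explicit 4 × 4 matrices -/

section ExplicitMatrices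

variable {a00 a01 a02 a03 a10 a11 a12 a13 a20 a21 a22 a23 a30 a31 a32 a33 b00 b01 b02 b03 b10 b11 b12 b13 b20 b21 b22 b23 b30 b31 b32 b33 : ℝ}

theorem mul4 : (!![a00, a01, a02, a03; a10, a11, a12, a13; a20, a21, a22, a23; a30, a31, a32, a33] * !![b00, b01, b02, b03; b10, b11, b12, b13; b20, b21, b22, b23; b30, b31, b32, b33] : Matrix (Fin 4) (Fin 4) ℝ) =
    !![a00 * b00 + a01 * b10 + a02 * b20 + a03 * b30, a00 * b01 + a01 * b11 + a02 * b21 + a03 * b31, a00 * b02 + a01 * b12 + a02 * b22 + a03 * b32, a00 * b03 + a01 * b13 + a02 * b23 + a03 * b33; a10 * b00 + a11 * b10 + a12 * b20 + a13 * b30, a10 * b01 + a11 * b11 + a12 * b21 + a13 * b31, a10 * b02 + a11 * b12 + a12 * b22 + a13 * b32, a10 * b03 + a11 * b13 + a12 * b23 + a13 * b33; a20 * b00 + a21 * b10 + a22 * b20 + a23 * b30, a20 * b01 + a21 * b11 + a22 * b21 + a23 * b31, a20 * b02 + a21 * b12 + a22 * b22 + a23 * b32, a20 * b03 + a21 * b13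 + a22 * b23 + a23 * b33; a30 * b00 + a31 * b10 + a32 * b20 + a33 * b30, a30 * b01 + a31 * b11 + a32 * b21 + a33 * b31, a30 * b02 + a31 * b12 + a32 * b22 + a33 * b32, a30 * b03 + a31 * b13 + a32 * b23 + a33 * b33] := by
  ext i j
  fin_cases i <;> fin_cases j <;> simp [Matrix.mul_apply, Fin.sum_univ_four]

theorem add4 : (!![a00, a01, a02, a03; a10, a11, a12, a13; a20, a21, a22, a23; a30, a31, a32, a33] + !![b00, b01, b02, b03; b10, b11, b12, b13; b20, b21, b22, b23; b30, b31, b32, b33] : Matrix (Fin 4) (Fin 4) ℝ) =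
    !![a00 + b00, a01 + b01, a02 + b02, a03 + b03; a10 + b10, a11 + b11, a12 + b12, a13 + b13; a20 + b20, a21 + b21, a22 + b22, a23 + b23; a30 + b30, a31 + b31, a32 + b32, a33 + b33] := by
  ext i j
  fin_cases i <;> fin_cases j <;> simp [Matrix.mul_apply, Fin.sum_univ_four]

theorem sub4 : (!![a00, a01, a02, a03; a10, a11, a12, a13; a20, a21, a22, a23; a30, a31, a32, a33] - !![b00, b01, b02, b03; b10, b11, b12, b13; b20, b21, b22, b23; b30, b31, b32, b33] : Matrix (Fin 4) (Fin 4) ℝ) =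
    !![a00 - b00, a01 - b01, a02 - b02, a03 - b03; a10 - b10, a11 - b11, a12 - b12, a13 - b13; a20 - b20, a21 - b21, a22 - b22, a23 - b23; a30 - b30, a31 - b31, a32 - b32, a33 - b33] := by
  ext i j
  fin_cases i <;> fin_cases j <;> simp [Matrix.mul_apply, Fin.sum_univ_four]

theorem smul4 (r : ℝ) : (r • !![a00, a01, a02, a03; a10, a11, a12, a13; a20, a21, a22, a23; a30, a31, a32, a33] : Matrix (Fin 4) (Fin 4) ℝ) =
    !![r * a00, r * a01, r * a02, r * a03; r * a10, r * a11, r * a12, r * a13; r * a20, r * a21, r * a22, r * a23; r * a30, r * a31, r * a32, r * a33] := by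
  ext i j
  fin_cases i <;> fin_cases j <;> simp [Matrix.mul_apply, Fin.sum_univ_four]

theorem ext4 (h00 : a00 = b00) (h01 : a01 = b01) (h02 : a02 = b02) (h03 : a03 = b03) (h10 : a10 = b10) (h11 : a11 = b11) (h12 : a12 = b12) (h13 : a13 = b13) (h20 : a20 = b20) (h21 : a21 = b21) (h22 : a22 = b22) (h23 : a23 = b23) (h30 : a30 = b30) (h31 : a31 = b31) (h32 : a32 = b32) (h33 : a33 = b33) : (!![a00, a01, a02, a03; a10, a11, a12, a13; a20, a21, a22, a23; a30, a31, a32, a33] : Matrix (Fin 4) (Fin 4) ℝ) = !![b00, b01, b02, b03; b10, b11, b12, b13; b20, b21, b22, b23; b30, b31, b32, b33] := by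
  subst_vars; rfl

theorem mulVec4 (s : Fin 4 → ℝ) : !![a00, a01, a02, a03; a10, a11, a12, a13; a20, a21, a22, a23; a30, a31, a32, a33] *ᵥ s =
    ![a00 * s 0 + a01 * s 1 + a02 * s 2 + a03 * s 3, a10 * s 0 + a11 * s 1 + a12 * s 2 + a13 * s 3, a20 * s 0 + a21 * s 1 + a22 * s 2 + a23 * s 3, a30 * s 0 + a31 * s 1 + a32 * s 2 + a33 * s 3] := by
  ext i
  fin_cases i <;> simp [Matrix.mulVec, dotProduct, Fin.sum_univ_four]

end ExplicitMatrices

/-! ### The gamma matrices and the spin representation in coordinates -/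

theorem gam_zero : gam 0 = !![0, 1, 0, 0; -1, 0, 0, 0; 0, 0, 0, 1; 0, 0, -1, 0] := rfl

theorem gam_one : gam 1 = !![0, 1, 0, 0; 1, 0, 0, 0; 0, 0, 0, 1; 0, 0, 1, 0] := rfl

theorem gam_two : gam 2 = !![0, 0, 1, 0; 0, 0, 0, -1; 1, 0, 0, 0; 0, -1, 0, 0] := rfl

theorem gam_three : gam 3 = !![1, 0, 0, 0; 0, -1, 0, 0; 0, 0, -1, 0; 0, 0, 0, 1] := rfl

theorem slash_eq_sum (v : Fin 4 → ℝ) : slash v = ∑ μ, v μ • gam μ := by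
  simp [slash]

theorem slash_eq (v : Fin 4 → ℝ) : slash v =
    !![v 3, v 0 + v 1, v 2, 0; -v 0 + v 1, -v 3, 0, -v 2;
      v 2, 0, -v 3, v 0 + v 1; 0, -v 2, -v 0 + v 1, v 3] := by
  simp only [slash_eq_sum, Fin.sum_univ_four, gam_zero, gam_one, gam_two, gam_three, smul4, add4]
  apply ext4 <;> ring

theorem slash_single (μ : Fin 4) : slash (Pi.single μ 1) = gam μ := by
  simp [slash_eq_sum, Pi.single_apply]

theorem volMat_eq : volMat =
    !![0, 0, -1, 0; 0, 0, 0, 1; 1, 0, 0, 0; 0, -1, 0, 0] := by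
  simp only [volMat, gam_zero, gam_one, gam_two, gam_three, mul4]
  apply ext4 <;> ring

/-- Skewness leaves six independent entries; on this form the identities for `σ` below become
sixteen polynomial identities each. -/
theorem spinSigma_eq {A : Fin 4 → Fin 4 → ℝ} (hA : IsSkew A) : spinSigma A = (1 / 2 : ℝ) •
    !![A 0 1, -A 0 3 + A 1 3, A 2 3, -A 0 2 + A 1 2;
      -A 0 3 - A 1 3, -A 0 1, -A 0 2 - A 1 2, A 2 3;
      -A 2 3, -A 0 2 + A 1 2, A 0 1, A 0 3 - A 1 3;
      -A 0 2 - A 1 2, -A 2 3, A 0 3 + A 1 3, -A 0 1] := by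
  simp only [spinSigma, Fin.sum_univ_four, gam_zero, gam_one, gam_two, gam_three, mul4, smul4,
    add4, sub4, hA.apply_self, hA 1 0, hA 2 0, hA 3 0, hA 2 1, hA 3 1, hA 3 2, eta,
    Matrix.cons_val]
  apply ext4 <;> ring

theorem spinSigma_add (A B : Fin 4 → Fin 4 → ℝ) :
    spinSigma (A + B) = spinSigma A + spinSigma B := by
  simp only [spinSigma, Pi.add_apply, mul_add, add_smul, Finset.sum_add_distrib, smul_add]

theorem spinSigma_smul (c : ℝ) (A : Fin 4 → Fin 4 → ℝ) :
    spinSigma (c • A) = c • spinSigma A := by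
  simp only [spinSigma, Pi.smul_apply, smul_eq_mul, Finset.smul_sum, smul_smul]
  refine Finset.sum_congr rfl fun μ _ => Finset.sum_congr rfl fun ν _ => ?_
  congr 1; ring

/-- This fixes the normalisation of `σ`. The equivariance of the Dirac current and the comparison of
frames both rest on it. -/
theorem spinSigma_slash {A : Fin 4 → Fin 4 → ℝ} (hA : IsSkew A) (v : Fin 4 → ℝ) :
    spinSigma A * slash v = slash v * spinSigma A + slash (lowerApply A v) := by
  simp only [spinSigma_eq hA, slash_eq, lowerApply, Fin.sum_univ_four, mul4, smul4, add4,
    hA.apply_self, hA 1 0, hA 2 0, hA 3 0, hA 2 1, hA 3 1, hA 3 2, eta, Matrix.cons_val]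
  apply ext4 <;> ring

theorem IsSkew.lowerMul_sub {A B : Fin 4 → Fin 4 → ℝ} (hA : IsSkew A) (hB : IsSkew B) :
    IsSkew (lowerMul A B - lowerMul B A) := by
  intro μ ν
  simp only [lowerMul, Pi.sub_apply, ← Finset.sum_sub_distrib, ← Finset.sum_neg_distrib]
  refine Finset.sum_congr rfl fun ρ _ => ?_
  rw [hA μ ρ, hB ρ ν, hB μ ρ, hA ρ ν]; ring

theorem spinSigma_commutator {A B : Fin 4 → Fin 4 → ℝ} (hA : IsSkew A) (hB : IsSkew B) :
    spinSigma A * spinSigma B - spinSigma B * spinSigma A =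
      spinSigma (lowerMul A B - lowerMul B A) := by
  simp only [spinSigma_eq hA, spinSigma_eq hB, spinSigma_eq (hA.lowerMul_sub hB), mul4, sub4,
    smul4, lowerMul, eta, Fin.sum_univ_four, hA.apply_self, hB.apply_self, hA 1 0, hA 2 0,
    hA 2 1, hA 3 1, hA 3 2, hB 1 0, hB 2 0, hB 2 1, hB 3 1, hB 3 2, Pi.sub_apply,
    Matrix.cons_val]
  apply ext4 <;> ring

/-- A matrix commuting with all gamma matrices is a scalar. -/
theorem eq_smul_one_of_commute {P : Matrix (Fin 4) (Fin 4) ℝ}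
    (h : ∀ μ, P * gam μ = gam μ * P) : P = P 0 0 • 1 := by
  have e (μ i j) := congrFun (congrFun (h μ) i) j
  have e0 (i j) := e 0 i j
  have e1 (i j) := e 1 i j
  have e2 (i j) := e 2 i j
  have e3 (i j) := e 3 i j
  simp only [Matrix.mul_apply, Fin.sum_univ_four, gam] at e0 e1 e2 e3
  simp only [Fin.forall_fin_succ] at e0 e1 e2 e3
  simp at e0 e1 e2 e3
  ext i j
  fin_cases i <;> fin_cases j <;> simp <;> linarith

/-! ### The invariant symplectic form and the algebraic Dirac current -/

namespace SpinorPairing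

variable (C : SpinorPairing)

theorem form_self (s : Spinor) : C.form s s = 0 := C.isAlt s

theorem form_swap (s t : Spinor) : C.form s t = -C.form t s := by
  have h := C.form_self (s + t)
  simp only [map_add, LinearMap.add_apply, C.form_self] at h
  linarith

/-- The pairing is determined by its skewness up to a factor. -/
theorem form_eq (s t : Spinor) : C.form s t =
    C.form (Pi.single 1 1) (Pi.single 0 1) *
      (s 1 * t 0 - s 0 * t 1 + s 3 * t 2 - s 2 * t 3) := by
  have expand (s : Spinor) : s = ∑ i, s i • (Pi.single i 1 : Spinor) := by
    ext j; simp [Finset.sum_apply, Pi.single_apply]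
  obtain ⟨f, hf⟩ : ∃ f : Fin 4 → Fin 4 → ℝ,
      ∀ i j, C.form (Pi.single i 1) (Pi.single j 1) = f i j := ⟨_, fun _ _ => rfl⟩
  have form_sum (s t : Spinor) : C.form s t = ∑ i, ∑ j, s i * (t j * f i j) := by
    conv_lhs => rw [expand s, expand t]
    simp only [map_sum, LinearMap.sum_apply, map_smul, LinearMap.smul_apply, smul_eq_mul, hf,
      Finset.mul_sum]
    rw [Finset.sum_comm]
    exact Finset.sum_congr rfl fun i _ => Finset.sum_congr rfl fun j _ => by ring
  have swap (i j) : f i j = -f j i := by rw [← hf, ← hf]; exact C.form_swap _ _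
  have diag (i) : f i i = 0 := by rw [← hf]; exact C.form_self _
  have key (μ i j) : ∑ k, gam μ k i * f k j = -∑ k, gam μ k j * f i k := by
    have h := C.skew (Pi.single μ 1) (Pi.single i 1) (Pi.single j 1)
    simpa [slash_single, form_sum, Pi.single_apply] using h
  -- Skewness for selected gamma matrices determines the Gram matrix. `k5` forces `f 0 3 = 0` and
  -- then `k1` gives `f 1 2 = 0`; `k2` and `k3` give opposite signs for `f 1 3` in terms of `f 0 2`,
  -- so both vanish; `k6` gives `f 2 3 = f 0 1`, the one remaining parameter.
  have k1 := key 1 0 2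
  have k2 := key 1 0 3
  have k3 := key 0 0 3
  have k5 := key 3 0 3
  have k6 := key 2 0 3
  simp [gam, Fin.sum_univ_four] at k1 k2 k3 k5 k6
  have h03 : f 0 3 = 0 := by linarith
  have h02 : f 0 2 = 0 := by linarith
  have h12 : f 1 2 = 0 := by linarith
  have h13 : f 1 3 = 0 := by linarith
  rw [form_sum, hf]
  simp only [Fin.sum_univ_four, diag, swap 2 1, swap 3 1, swap 2 0, swap 3 0, swap 3 2, k6,
    swap 0 1, h03, h02, h12, h13]
  ring

theorem form_gam_comm (μ : Fin 4) (s t : Spinor) :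
    C.form s (gam μ *ᵥ t) = C.form t (gam μ *ᵥ s) := by
  rw [← slash_single, form_swap, C.skew, neg_neg]

/-- Infinitesimal spin invariance of the pairing, which here is checked on the explicit form
supplied by `form_eq`. -/
theorem form_spinSigma {A : Fin 4 → Fin 4 → ℝ} (hA : IsSkew A) (s t : Spinor) :
    C.form (spinSigma A *ᵥ s) t = -C.form s (spinSigma A *ᵥ t) := by
  rw [C.form_eq, C.form_eq s, spinSigma_eq hA]
  simp [Matrix.smul_mulVec, Matrix.mulVec_eq_sum, Fin.sum_univ_four]
  ring

/-- The components of the Dirac current of a pair of spinors. -/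
def current (s t : Spinor) : Fin 4 → ℝ := fun μ => eta μ * C.form s (gam μ *ᵥ t)

theorem current_comm (s t : Spinor) : C.current s t = C.current t s := by
  funext μ
  rw [current, current, form_gam_comm]

/-- The current is equivariant under the spin representation. -/
theorem current_spinSigma {A : Fin 4 → Fin 4 → ℝ} (hA : IsSkew A) (s t : Spinor) :
    C.current (spinSigma A *ᵥ s) t + C.current s (spinSigma A *ᵥ t) =
      lowerApply A (C.current s t) := by
  funext μ
  have h := congrArg (· *ᵥ t) (spinSigma_slash hA (Pi.single μ 1))
  simp only [slash_single, Matrix.add_mulVec, ← Matrix.mulVec_mulVec] at h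
  simp only [Pi.add_apply, current, form_spinSigma C hA, lowerApply]
  rw [h, slash_eq_sum]
  simp only [map_add, Matrix.sum_mulVec, Matrix.smul_mulVec, map_sum, map_smul, smul_eq_mul,
    lowerApply, Pi.single_apply, mul_ite, mul_one, mul_zero, Finset.sum_ite_eq',
    Finset.mem_univ, if_true]
  have e : ∑ ν, A μ ν * (eta ν * C.form s (gam ν *ᵥ t)) =
      -∑ ν, eta ν * A ν μ * C.form s (gam ν *ᵥ t) := by
    rw [← Finset.sum_neg_distrib]
    refine Finset.sum_congr rfl fun ν _ => ?_
    rw [hA μ ν]; ring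
  rw [e]; ring

end SpinorPairing

/-! ## The algebra of the Killing spinor equation -/

/-- The endomorphism `X · (a + b vol) - (φ ∧ X) · vol + 2 g(φ, X) vol` of the spinor module: the
Killing spinor equation reads `∇_X ε = killMat a b φ X ε`. -/
def killMat (a b : ℝ) (φ X : Fin 4 → ℝ) : Matrix (Fin 4) (Fin 4) ℝ :=
  slash X * (a • (1 : Matrix (Fin 4) (Fin 4) ℝ) + b • volMat) - wedgeMat φ X * volMat
    + (2 * mink φ X) • volMat

theorem killMat_add_right (a b : ℝ) (φ X Y : Fin 4 → ℝ) :
    killMat a b φ (X + Y) = killMat a b φ X + killMat a b φ Y := by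
  have h : mink φ (X + Y) = mink φ X + mink φ Y := by
    simp [mink, mul_add, Finset.sum_add_distrib]
  simp only [killMat, wedgeMat, map_add, h, add_mul, mul_add, add_smul, smul_add, smul_sub,
    sub_mul]
  abel

theorem killMat_smul_right (a b c : ℝ) (φ X : Fin 4 → ℝ) :
    killMat a b φ (c • X) = c • killMat a b φ X := by
  have h : mink φ (c • X) = c * mink φ X := by
    simp only [mink, Finset.mul_sum, Pi.smul_apply, smul_eq_mul]
    exact Finset.sum_congr rfl fun _ _ => by ring
  simp only [killMat, wedgeMat, map_smul, h, smul_mul_assoc, mul_smul_comm, smul_add, smul_sub,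
    sub_mul, smul_smul, mul_add, mul_left_comm c]
  simp only [mul_comm c]

theorem killMat_eq_sum (a b : ℝ) (φ X : Fin 4 → ℝ) :
    killMat a b φ X = ∑ μ, X μ • killMat a b φ (Pi.single μ 1) := by
  let f : (Fin 4 → ℝ) →ₗ[ℝ] Matrix (Fin 4) (Fin 4) ℝ :=
    ⟨⟨killMat a b φ, killMat_add_right a b φ⟩, fun c => killMat_smul_right a b c φ⟩
  have h : X = ∑ μ, X μ • (Pi.single μ 1 : Fin 4 → ℝ) := by
    ext j; simp [Finset.sum_apply, Pi.single_apply]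
  change f X = ∑ μ, X μ • f (Pi.single μ 1)
  conv_lhs => rw [h]
  simp only [map_sum, map_smul]

theorem one_eq4 : (1 : Matrix (Fin 4) (Fin 4) ℝ) =
    !![1, 0, 0, 0; 0, 1, 0, 0; 0, 0, 1, 0; 0, 0, 0, 1] := by
  ext i j
  fin_cases i <;> fin_cases j <;> rfl

/-- Since `killMat` is linear in its vector argument, the four matrices tabulated from here on
suffice for every later identity. -/
theorem killMat_single_zero (a b : ℝ) (φ : Fin 4 → ℝ) : killMat a b φ (Pi.single 0 1) =
    !![0, a + φ 2, -2 * φ 0 - φ 1, b - φ 3;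
      -a - φ 2, 0, b + φ 3, 2 * φ 0 - φ 1;
      2 * φ 0 + φ 1, -b - φ 3, 0, a - φ 2;
      -b + φ 3, -2 * φ 0 + φ 1, -a + φ 2, 0] := by
  simp only [killMat, wedgeMat, mink, slash_single, slash_eq φ, volMat_eq, one_eq4, gam_zero,
    gam_one, gam_two, gam_three, Fin.sum_univ_four, mul4, add4, sub4, smul4, eta, Matrix.cons_val,
    Pi.single_apply]
  apply ext4 <;> simp <;> ring

theorem killMat_single_one (a b : ℝ) (φ : Fin 4 → ℝ) : killMat a b φ (Pi.single 1 1) =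
    !![0, a + φ 2, φ 0 + 2 * φ 1, b - φ 3;
      a + φ 2, 0, -b - φ 3, φ 0 - 2 * φ 1;
      -φ 0 - 2 * φ 1, -b - φ 3, 0, a - φ 2;
      b - φ 3, -φ 0 + 2 * φ 1, a - φ 2, 0] := by
  simp only [killMat, wedgeMat, mink, slash_single, slash_eq φ, volMat_eq, one_eq4, gam_zero,
    gam_one, gam_two, gam_three, Fin.sum_univ_four, mul4, add4, sub4, smul4, eta, Matrix.cons_val,
    Pi.single_apply]
  apply ext4 <;> simp <;> ring

theorem killMat_single_two (a b : ℝ) (φ : Fin 4 → ℝ) : killMat a b φ (Pi.single 2 1) =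
    !![b - φ 3, -φ 0 - φ 1, a + 2 * φ 2, 0;
      φ 0 - φ 1, b + φ 3, 0, -a - 2 * φ 2;
      a - 2 * φ 2, 0, -b - φ 3, φ 0 + φ 1;
      0, -a + 2 * φ 2, -φ 0 + φ 1, -b + φ 3] := by
  simp only [killMat, wedgeMat, mink, slash_single, slash_eq φ, volMat_eq, one_eq4, gam_zero,
    gam_one, gam_two, gam_three, Fin.sum_univ_four, mul4, add4, sub4, smul4, eta, Matrix.cons_val,
    Pi.single_apply]
  apply ext4 <;> simp <;> ring

theorem killMat_single_three (a b : ℝ) (φ : Fin 4 → ℝ) : killMat a b φ (Pi.single 3 1) =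
    !![a + φ 2, 0, -b + 2 * φ 3, φ 0 + φ 1;
      0, -a - φ 2, -φ 0 + φ 1, -b - 2 * φ 3;
      -b - 2 * φ 3, φ 0 + φ 1, -a + φ 2, 0;
      -φ 0 + φ 1, -b + 2 * φ 3, 0, a - φ 2] := by
  simp only [killMat, wedgeMat, mink, slash_single, slash_eq φ, volMat_eq, one_eq4, gam_zero,
    gam_one, gam_two, gam_three, Fin.sum_univ_four, mul4, add4, sub4, smul4, eta, Matrix.cons_val,
    Pi.single_apply]
  apply ext4 <;> simp <;> ring

theorem gam_mulVec_zero (s : Spinor) : gam 0 *ᵥ s = ![s 1, -s 0, s 3, -s 2] := by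
  rw [gam_zero, mulVec4]; simp

theorem gam_mulVec_one (s : Spinor) : gam 1 *ᵥ s = ![s 1, s 0, s 3, s 2] := by
  rw [gam_one, mulVec4]; simp

theorem gam_mulVec_two (s : Spinor) : gam 2 *ᵥ s = ![s 2, -s 3, s 0, -s 1] := by
  rw [gam_two, mulVec4]; simp

theorem gam_mulVec_three (s : Spinor) : gam 3 *ᵥ s = ![s 0, -s 1, -s 2, s 3] := by
  rw [gam_three, mulVec4]; simp

/-- `σ(A)` commutes with `vol`, the product `η(φ, X)` is invariant, and Clifford multiplication is
equivariant. Hence `A` acts only through `φ` and `X`; the scalars `a`, `b` do not transform, whence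
the zeros in the term for `φ`. -/
theorem killMat_equivariant {A : Fin 4 → Fin 4 → ℝ} (hA : IsSkew A) (a b : ℝ)
    (φ X : Fin 4 → ℝ) :
    spinSigma A * killMat a b φ X = killMat a b φ X * spinSigma A
      + killMat 0 0 (lowerApply A φ) X + killMat a b φ (lowerApply A X) := by
  simp only [killMat_eq_sum _ _ _ X, killMat_eq_sum _ _ _ (lowerApply A X), Fin.sum_univ_four,
    killMat_single_zero, killMat_single_one, killMat_single_two, killMat_single_three,
    spinSigma_eq hA, lowerApply, mul4, smul4, add4,
    hA.apply_self, hA 1 0, hA 2 0, hA 3 0, hA 2 1, hA 3 1, hA 3 2, eta, Matrix.cons_val]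
  apply ext4 <;> ring

namespace SpinorPairing

variable (C : SpinorPairing)

theorem current_self (s : Spinor) : C.current s s =
    C.form (Pi.single 1 1) (Pi.single 0 1) •
      ![s 0 ^ 2 + s 1 ^ 2 + s 2 ^ 2 + s 3 ^ 2, s 0 ^ 2 - s 1 ^ 2 + s 2 ^ 2 - s 3 ^ 2,
        -2 * (s 0 * s 3 + s 1 * s 2), -2 * (s 0 * s 1 - s 2 * s 3)] := by
  ext μ
  fin_cases μ <;>
    simp only [current, C.form_eq s, gam_mulVec_zero, gam_mulVec_one, gam_mulVec_two,
      gam_mulVec_three, eta, Matrix.cons_val, Fin.zero_eta, Fin.mk_one, Fin.reduceFinMk,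
      Pi.smul_apply, smul_eq_mul] <;> ring

/-- The derivative `g(∇_ν κ, e_μ)` of the Dirac current of a Killing spinor. -/
def currentDeriv (a b : ℝ) (φ : Fin 4 → ℝ) (s : Spinor) : Fin 4 → Fin 4 → ℝ :=
  fun μ ν => 2 * C.form s (gam μ *ᵥ (killMat a b φ (Pi.single ν 1) *ᵥ s))

/-- Clifford elements that are self-adjoint for the pairing (scalars, trivectors and `vol`) have
vanishing expectation `⟨s, x s⟩`, so only vectors and bivectors contribute. In `Γ_μ K_ν` the
surviving parts are the bivector `Γ_{μν}` from `a`, its dual from `b`, and the vector dual to `e_μ ∧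
φ ∧ e_ν` from `φ`; each is skew in `μ, ν`. -/
theorem isSkew_currentDeriv (a b : ℝ) (φ : Fin 4 → ℝ) (s : Spinor) :
    IsSkew (C.currentDeriv a b φ s) := by
  intro μ ν
  fin_cases μ <;> fin_cases ν <;>
    simp only [currentDeriv, C.form_eq s, gam_mulVec_zero, gam_mulVec_one, gam_mulVec_two,
      gam_mulVec_three, killMat_single_zero, killMat_single_one, killMat_single_two,
      killMat_single_three, mulVec4, Matrix.cons_val, Fin.zero_eta, Fin.mk_one,
      Fin.reduceFinMk] <;> ring

/-- The Lie derivative of a Killing spinor along its Dirac current vanishes. -/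
theorem killMat_current_add_spinSigma (a b : ℝ) (φ : Fin 4 → ℝ) (s : Spinor) :
    killMat a b φ (C.current s s) *ᵥ s - spinSigma (C.currentDeriv a b φ s) *ᵥ s = 0 := by
  rw [killMat_eq_sum, spinSigma_eq (C.isSkew_currentDeriv a b φ s), C.current_self]
  simp only [currentDeriv, C.form_eq s, gam_mulVec_zero, gam_mulVec_one, gam_mulVec_two,
      gam_mulVec_three, killMat_single_zero, killMat_single_one, killMat_single_two,
      killMat_single_three, mulVec4, Matrix.cons_val, Fin.sum_univ_four, add4, smul4,
      Pi.smul_apply, smul_eq_mul]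
  ext i
  fin_cases i <;> simp only [Matrix.cons_val, Fin.zero_eta, Fin.mk_one,
      Fin.reduceFinMk, Pi.sub_apply, Pi.zero_apply] <;> ring

end SpinorPairing

/-! ### Curvature of the Killing spinor connection and its integrability conditions -/

/-- The curvature of the Killing spinor connection in terms of the Riemann tensor
`R μ ν ρ σ = g(e_ρ, R(e_μ, e_ν) e_σ)` and the covariant derivatives `a' μ`, `b' μ`, `φ' μ` of
`a`, `b`, `φ` along the frame. -/
def killCurvature (R : Fin 4 → Fin 4 → Fin 4 → Fin 4 → ℝ) (a b : ℝ) (φ : Fin 4 → ℝ)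
    (a' b' : Fin 4 → ℝ) (φ' : Fin 4 → Fin 4 → ℝ) (μ ν : Fin 4) : Matrix (Fin 4) (Fin 4) ℝ :=
  killMat (a' μ) (b' μ) (φ' μ) (Pi.single ν 1) - killMat (a' ν) (b' ν) (φ' ν) (Pi.single μ 1)
    + killMat a b φ (Pi.single ν 1) * killMat a b φ (Pi.single μ 1)
    - killMat a b φ (Pi.single μ 1) * killMat a b φ (Pi.single ν 1) - spinSigma (R μ ν)

/-- The algebraic symmetries of the Riemann tensor. -/
structure IsRiemannTensor (R : Fin 4 → Fin 4 → Fin 4 → Fin 4 → ℝ) : Prop where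
  skew_left : ∀ μ ν ρ σ, R μ ν ρ σ = -R ν μ ρ σ
  skew_right : ∀ μ ν, IsSkew (R μ ν)
  bianchi : ∀ μ ν σ ρ, R μ ν ρ σ + R ν σ ρ μ + R σ μ ρ ν = 0

/-- The classical octahedron argument: the four cyclic identities on `μ, ν, σ, ρ` combine, using
skewness in each pair, to the exchange of pairs. -/
theorem IsRiemannTensor.pair_symm {R : Fin 4 → Fin 4 → Fin 4 → Fin 4 → ℝ}
    (h : IsRiemannTensor R) (μ ν ρ σ : Fin 4) : R μ ν ρ σ = R ρ σ μ ν := by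
  have b1 := h.bianchi μ ν σ ρ
  have b2 := h.bianchi ν σ ρ μ
  have b3 := h.bianchi σ ρ μ ν
  have b4 := h.bianchi ρ μ ν σ
  linarith [h.skew_right μ ν ρ σ, h.skew_right ν σ ρ μ, h.skew_left σ μ ρ ν,
    h.skew_right μ σ ρ ν, h.skew_right σ ρ μ ν, h.skew_left σ ρ μ ν, h.skew_left ρ ν μ σ,
    h.skew_right ν ρ μ σ, h.skew_right ρ μ ν σ]

-- Let `E_{μν}` be the curvature applied to `s`. Pairing `s` with Clifford multiples of the `E_{μν}`
-- and summing can be arranged so that the Riemann tensor drops out by its algebraic symmetries,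
-- leaving the derivatives of `a`, `b`, `φ` along the current. The third conclusion reads `∇_κ φ =
-- ∇_φ κ`.
set_option maxHeartbeats 1000000 in
theorem killCurvature_integrability (C : SpinorPairing)
    {R : Fin 4 → Fin 4 → Fin 4 → Fin 4 → ℝ} (hR : IsRiemannTensor R) {a b : ℝ} {φ a' b' : Fin 4 → ℝ}
    {φ' : Fin 4 → Fin 4 → ℝ} {s : Spinor}
    (hE : ∀ μ ν, killCurvature R a b φ a' b' φ' μ ν *ᵥ s = 0) :
    ∑ μ, C.current s s μ * a' μ = 0 ∧ ∑ μ, C.current s s μ * b' μ = 0 ∧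
      ∀ ν, ∑ μ, C.current s s μ * φ' μ ν =
        ∑ μ, φ μ * (eta ν * C.currentDeriv a b φ s ν μ) := by
  -- Together with pair symmetry this leaves twenty independent components of `R`, enough for the
  -- cancellations below to be visible to polynomial arithmetic.
  have hB : R 0 1 2 3 = R 0 2 1 3 - R 0 3 1 2 := by
    linarith [hR.bianchi 1 2 3 0, hR.pair_symm 0 1 2 3, hR.pair_symm 0 2 1 3,
      hR.pair_symm 0 3 1 2, hR.skew_left 2 3 0 1, hR.skew_left 3 1 0 2, hR.skew_left 1 2 0 3]
  -- Six index pairs and four spinor components give twenty-four scalar equations `eμνi`.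
  have h01 := fun i => congrFun (hE 0 1) i
  have h02 := fun i => congrFun (hE 0 2) i
  have h03 := fun i => congrFun (hE 0 3) i
  have h12 := fun i => congrFun (hE 1 2) i
  have h13 := fun i => congrFun (hE 1 3) i
  have h23 := fun i => congrFun (hE 2 3) i
  simp only [killCurvature, killMat_single_zero, killMat_single_one, killMat_single_two,
    killMat_single_three, spinSigma_eq (hR.skew_right _ _), mul4, add4, sub4, smul4, mulVec4,
    hR.pair_symm 0 2 0 1, hR.pair_symm 0 3 0 1, hR.pair_symm 1 2 0 1, hR.pair_symm 1 3 0 1,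
    hR.pair_symm 2 3 0 1, hR.pair_symm 0 3 0 2, hR.pair_symm 1 2 0 2, hR.pair_symm 1 3 0 2,
    hR.pair_symm 2 3 0 2, hR.pair_symm 1 2 0 3, hR.pair_symm 1 3 0 3, hR.pair_symm 2 3 0 3,
    hR.pair_symm 1 3 1 2, hR.pair_symm 2 3 1 2, hR.pair_symm 2 3 1 3, hB]
    at h01 h02 h03 h12 h13 h23
  have e010 := h01 0
  have e011 := h01 1
  have e012 := h01 2
  have e013 := h01 3
  have e020 := h02 0
  have e021 := h02 1
  have e022 := h02 2
  have e023 := h02 3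
  have e030 := h03 0
  have e031 := h03 1
  have e032 := h03 2
  have e033 := h03 3
  have e120 := h12 0
  have e121 := h12 1
  have e122 := h12 2
  have e123 := h12 3
  have e130 := h13 0
  have e131 := h13 1
  have e132 := h13 2
  have e133 := h13 3
  have e230 := h23 0
  have e231 := h23 1
  have e232 := h23 2
  have e233 := h23 3
  simp only [Matrix.cons_val, Pi.zero_apply] at e010 e011 e012 e013 e020 e021 e022 e023
  simp only [Matrix.cons_val, Pi.zero_apply] at e030 e031 e032 e033 e120 e121 e122 e123
  simp only [Matrix.cons_val, Pi.zero_apply] at e130 e131 e132 e133 e230 e231 e232 e233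
  clear h01 h02 h03 h12 h13 h23
  simp only [C.current_self, SpinorPairing.currentDeriv, C.form_eq s, Fin.sum_univ_four]
  set k := C.form (Pi.single 1 1) (Pi.single 0 1)
  refine ⟨?_, ?_, fun ν => ?_⟩
  · simp only [Matrix.cons_val, Pi.smul_apply, smul_eq_mul]
    -- This is `-1/3` times the sum over `μ < ν` of `⟨s, Γ^{μν} E_{μν}⟩`, indices being raised with
    -- `η`.
    linear_combination k * (1 / 3 * s 1 * e010 + 1 / 3 * s 0 * e011 + 1 / 3 * s 3 * e012
      + 1 / 3 * s 2 * e013 + 1 / 3 * s 2 * e020 - 1 / 3 * s 3 * e021 + 1 / 3 * s 0 * e022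
      - 1 / 3 * s 1 * e023 + 1 / 3 * s 0 * e030 - 1 / 3 * s 1 * e031 - 1 / 3 * s 2 * e032
      + 1 / 3 * s 3 * e033 + 1 / 3 * s 2 * e120 + 1 / 3 * s 3 * e121 + 1 / 3 * s 0 * e122
      + 1 / 3 * s 1 * e123 + 1 / 3 * s 0 * e130 + 1 / 3 * s 1 * e131 - 1 / 3 * s 2 * e132
      - 1 / 3 * s 3 * e133 - 1 / 3 * s 3 * e230 + 1 / 3 * s 2 * e231 + 1 / 3 * s 1 * e232
      - 1 / 3 * s 0 * e233)
  · simp only [Matrix.cons_val, Pi.smul_apply, smul_eq_mul]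
    -- The same contraction with `vol` inserted: `⟨s, Γ^{μν} vol E_{μν}⟩`.
    linear_combination k * (1 / 3 * s 3 * e010 - 1 / 3 * s 2 * e011 - 1 / 3 * s 1 * e012
      + 1 / 3 * s 0 * e013 + 1 / 3 * s 0 * e020 + 1 / 3 * s 1 * e021 - 1 / 3 * s 2 * e022
      - 1 / 3 * s 3 * e023 - 1 / 3 * s 2 * e030 - 1 / 3 * s 3 * e031 - 1 / 3 * s 0 * e032
      - 1 / 3 * s 1 * e033 + 1 / 3 * s 0 * e120 - 1 / 3 * s 1 * e121 - 1 / 3 * s 2 * e122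
      + 1 / 3 * s 3 * e123 - 1 / 3 * s 2 * e130 + 1 / 3 * s 3 * e131 - 1 / 3 * s 0 * e132
      + 1 / 3 * s 1 * e133 + 1 / 3 * s 1 * e230 + 1 / 3 * s 0 * e231 + 1 / 3 * s 3 * e232
      + 1 / 3 * s 2 * e233)
  -- For a free index `ν` the contractions are odd: up to sign, `Γ_μ vol` is paired with `E_{νμ}`
  -- with weight `1/3`, and `Γ_{νρσ} vol` with `E_{ρσ}` for `ρ < σ` with weight `1/6`.
  fin_cases ν <;> simp only [gam_mulVec_zero, gam_mulVec_one, gam_mulVec_two,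
      gam_mulVec_three, killMat_single_zero, killMat_single_one, killMat_single_two,
      killMat_single_three, mulVec4, Matrix.cons_val, Fin.zero_eta, Fin.mk_one,
      Fin.reduceFinMk, eta, Pi.smul_apply, smul_eq_mul]
  · linear_combination k * (1 / 3 * s 2 * e010 + 1 / 3 * s 3 * e011 - 1 / 3 * s 0 * e012
      - 1 / 3 * s 1 * e013 - 1 / 3 * s 1 * e020 + 1 / 3 * s 0 * e021 + 1 / 3 * s 3 * e022
      - 1 / 3 * s 2 * e023 + 1 / 3 * s 3 * e030 - 1 / 3 * s 2 * e031 + 1 / 3 * s 1 * e032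
      - 1 / 3 * s 0 * e033 + 1 / 6 * s 1 * e120 + 1 / 6 * s 0 * e121 - 1 / 6 * s 3 * e122
      - 1 / 6 * s 2 * e123 - 1 / 6 * s 3 * e130 - 1 / 6 * s 2 * e131 - 1 / 6 * s 1 * e132
      - 1 / 6 * s 0 * e133 - 1 / 6 * s 0 * e230 + 1 / 6 * s 1 * e231 - 1 / 6 * s 2 * e232
      + 1 / 6 * s 3 * e233)
  · linear_combination k * (1 / 3 * s 2 * e010 - 1 / 3 * s 3 * e011 - 1 / 3 * s 0 * e012
      + 1 / 3 * s 1 * e013 - 1 / 6 * s 1 * e020 - 1 / 6 * s 0 * e021 + 1 / 6 * s 3 * e022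
      + 1 / 6 * s 2 * e023 + 1 / 6 * s 3 * e030 + 1 / 6 * s 2 * e031 + 1 / 6 * s 1 * e032
      + 1 / 6 * s 0 * e033 + 1 / 3 * s 1 * e120 - 1 / 3 * s 0 * e121 - 1 / 3 * s 3 * e122
      + 1 / 3 * s 2 * e123 - 1 / 3 * s 3 * e130 + 1 / 3 * s 2 * e131 - 1 / 3 * s 1 * e132
      + 1 / 3 * s 0 * e133 - 1 / 6 * s 0 * e230 - 1 / 6 * s 1 * e231 - 1 / 6 * s 2 * e232
      - 1 / 6 * s 3 * e233)
  · linear_combination k * (1 / 6 * s 1 * e010 + 1 / 6 * s 0 * e011 - 1 / 6 * s 3 * e012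
      - 1 / 6 * s 2 * e013 + 1 / 3 * s 2 * e020 - 1 / 3 * s 3 * e021 - 1 / 3 * s 0 * e022
      + 1 / 3 * s 1 * e023 + 1 / 6 * s 0 * e030 - 1 / 6 * s 1 * e031 + 1 / 6 * s 2 * e032
      - 1 / 6 * s 3 * e033 + 1 / 3 * s 2 * e120 + 1 / 3 * s 3 * e121 - 1 / 3 * s 0 * e122
      - 1 / 3 * s 1 * e123 + 1 / 6 * s 0 * e130 + 1 / 6 * s 1 * e131 + 1 / 6 * s 2 * e132
      + 1 / 6 * s 3 * e133 - 1 / 3 * s 3 * e230 + 1 / 3 * s 2 * e231 - 1 / 3 * s 1 * e232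
      + 1 / 3 * s 0 * e233)
  · linear_combination k * (-1 / 6 * s 3 * e010 - 1 / 6 * s 2 * e011 - 1 / 6 * s 1 * e012
      - 1 / 6 * s 0 * e013 - 1 / 6 * s 0 * e020 + 1 / 6 * s 1 * e021 - 1 / 6 * s 2 * e022
      + 1 / 6 * s 3 * e023 + 1 / 3 * s 2 * e030 - 1 / 3 * s 3 * e031 - 1 / 3 * s 0 * e032
      + 1 / 3 * s 1 * e033 - 1 / 6 * s 0 * e120 - 1 / 6 * s 1 * e121 - 1 / 6 * s 2 * e122
      - 1 / 6 * s 3 * e123 + 1 / 3 * s 2 * e130 + 1 / 3 * s 3 * e131 - 1 / 3 * s 0 * e132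
      - 1 / 3 * s 1 * e133 - 1 / 3 * s 1 * e230 + 1 / 3 * s 0 * e231 + 1 / 3 * s 3 * e232
      - 1 / 3 * s 2 * e233)

/-! ## Calculus in an orthonormal frame -/

theorem eta_mul_eta (μ : Fin 4) : eta μ * eta μ = 1 := by
  fin_cases μ <;> simp [eta]

/-- The algebraic structure of the vector fields with a global frame `e_μ`, in terms of their
components in an algebra `A` of functions. -/
structure FrameCalculus (A : Type*) [CommRing A] [Algebra ℝ A] where
  der : (Fin 4 → A) →ₗ[A] Derivation ℝ A A
  bracket : (Fin 4 → A) → (Fin 4 → A) → Fin 4 → A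
  bracket_swap : ∀ X Y, bracket X Y = -bracket Y X
  bracket_add : ∀ X Y Z, bracket X (Y + Z) = bracket X Y + bracket X Z
  bracket_smul : ∀ X (f : A) Y, bracket X (f • Y) = der X f • Y + f • bracket X Y
  jacobi : ∀ X Y Z,
    bracket X (bracket Y Z) = bracket (bracket X Y) Z + bracket Y (bracket X Z)
  der_bracket : ∀ X Y f, der (bracket X Y) f = der X (der Y f) - der Y (der X f)

/-! ### Matrices and pairings with coefficients in an algebra of functions -/

section MatrixFamily

variable {A : Type*} [CommRing A] [Algebra ℝ A] {ι : Type*} [Fintype ι]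

/-- Evaluation of a tuple of functions at a point. -/
def evalTuple {κ : Type*} (ev : A →ₐ[ℝ] ℝ) (s : κ → A) : κ → ℝ := fun i => ev (s i)

/-- The linear combination of real matrices with coefficients in an algebra of functions. -/
def combine (T : ι → Matrix (Fin 4) (Fin 4) ℝ) (w : ι → A) : Matrix (Fin 4) (Fin 4) A :=
  fun i j => ∑ k, T k i j • w k

/-- The matrices `T` stay real and constant, so evaluation and derivations both act on the
coefficients alone. Identities can thus be differentiated over `A` and then proved at a point by
real matrix algebra. -/
theorem eval_combine (ev : A →ₐ[ℝ] ℝ) (T : ι → Matrix (Fin 4) (Fin 4) ℝ) (w : ι → A) :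
    (combine T w).map ev = ∑ k, ev (w k) • T k := by
  ext i j
  simp [combine, Matrix.sum_apply, mul_comm]

theorem derivation_combine (D : Derivation ℝ A A) (T : ι → Matrix (Fin 4) (Fin 4) ℝ)
    (w : ι → A) : (combine T w).map D = combine T (fun k => D (w k)) := by
  ext i j
  simp [combine]

theorem derivation_mulVec (D : Derivation ℝ A A) (P : Matrix (Fin 4) (Fin 4) A)
    (s : Fin 4 → A) :
    (fun i => D ((P *ᵥ s) i)) = P.map D *ᵥ s + P *ᵥ (fun i => D (s i)) := by
  funext i
  simp only [Matrix.mulVec, dotProduct, map_sum, Derivation.leibniz, smul_eq_mul, Pi.add_apply,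
    Matrix.map_apply, Finset.sum_add_distrib]
  rw [add_comm]
  congr 1
  exact Finset.sum_congr rfl fun _ _ => mul_comm _ _

theorem eval_mulVec (ev : A →ₐ[ℝ] ℝ) (P : Matrix (Fin 4) (Fin 4) A) (s : Fin 4 → A) :
    (fun i => ev ((P *ᵥ s) i)) = P.map ev *ᵥ (fun i => ev (s i)) := by
  funext i
  simp [Matrix.mulVec, dotProduct]

/-- The spin representation with coefficients in an algebra of functions. -/
def sigmaA (Λ : Fin 4 → Fin 4 → A) : Matrix (Fin 4) (Fin 4) A :=
  combine (fun p : Fin 4 × Fin 4 => spinSigma (Pi.single p.1 (Pi.single p.2 1)))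
    (fun p => Λ p.1 p.2)

theorem spinSigma_eq_sum (B : Fin 4 → Fin 4 → ℝ) : spinSigma B =
    ∑ p : Fin 4 × Fin 4, B p.1 p.2 • spinSigma (Pi.single p.1 (Pi.single p.2 1)) := by
  let f : (Fin 4 → Fin 4 → ℝ) →ₗ[ℝ] Matrix (Fin 4) (Fin 4) ℝ :=
    ⟨⟨spinSigma, spinSigma_add⟩, spinSigma_smul⟩
  have h : B = ∑ p : Fin 4 × Fin 4,
      B p.1 p.2 • (Pi.single p.1 (Pi.single p.2 1) : Fin 4 → Fin 4 → ℝ) := by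
    ext μ ν
    simp only [Finset.sum_apply, Pi.smul_apply, smul_eq_mul, Fintype.sum_prod_type]
    rw [Finset.sum_eq_single μ (by
      intro ρ _ hρ; simp [Pi.single_apply, hρ.symm]) (by simp)]
    simp [Pi.single_apply]
  change f B = ∑ p : Fin 4 × Fin 4, B p.1 p.2 • f (Pi.single p.1 (Pi.single p.2 1))
  conv_lhs => rw [h]
  simp only [map_sum, map_smul]

theorem eval_sigmaA (ev : A →ₐ[ℝ] ℝ) (Λ : Fin 4 → Fin 4 → A) :
    (sigmaA Λ).map ev = spinSigma (fun μ ν => ev (Λ μ ν)) := by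
  rw [sigmaA, eval_combine, spinSigma_eq_sum]

theorem derivation_sigmaA (D : Derivation ℝ A A) (Λ : Fin 4 → Fin 4 → A) :
    (sigmaA Λ).map D = sigmaA (fun μ ν => D (Λ μ ν)) :=
  derivation_combine D _ _

/-- The endomorphism `killMat` with coefficients in an algebra of functions. -/
def killMatA (a b : A) (φ : Fin 4 → A) (μ : Fin 4) : Matrix (Fin 4) (Fin 4) A :=
  combine (Sum.elim ![killMat 1 0 0 (Pi.single μ 1), killMat 0 1 0 (Pi.single μ 1)]
    (fun ν : Fin 4 => killMat 0 0 (Pi.single ν 1) (Pi.single μ 1))) (Sum.elim ![a, b] φ)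

/-- `K` is linear in `(a, b, φ)` jointly. This is what makes `killMatA` a combination of constant
matrices, whose derivative merely replaces `a`, `b`, `φ` by their derivatives. -/
theorem killMat_eq_sum_left (a b : ℝ) (φ X : Fin 4 → ℝ) :
    killMat a b φ X = a • killMat 1 0 0 X + b • killMat 0 1 0 X
      + ∑ ν, φ ν • killMat 0 0 (Pi.single ν 1) X := by
  have h : slash φ = ∑ ν, φ ν • slash (Pi.single ν 1) := by simp [slash_eq_sum φ, slash_single]
  have h' : mink φ X = ∑ ν, φ ν * mink (Pi.single ν 1) X := by
    simp [mink, Pi.single_apply, mul_left_comm, mul_assoc]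
  simp only [killMat, wedgeMat, h, h', zero_smul, add_zero, mul_zero, zero_sub, map_zero,
    zero_mul, sub_zero, one_smul, mul_one, smul_zero, zero_add, Finset.sum_mul, Finset.mul_sum,
    smul_add, smul_neg, Finset.sum_add_distrib, Finset.sum_neg_distrib, smul_mul_assoc,
    mul_smul_comm, ← smul_sub, ← Finset.sum_sub_distrib, Finset.smul_sum, Finset.sum_smul,
    smul_smul, mul_add]
  have h0 : mink 0 X = 0 := by simp [mink]
  simp only [h0, mul_zero, zero_smul, add_zero, mul_comm (1 / 2 : ℝ), mul_left_comm (2 : ℝ)]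
  abel

theorem eval_killMatA (ev : A →ₐ[ℝ] ℝ) (a b : A) (φ : Fin 4 → A) (μ : Fin 4) :
    (killMatA a b φ μ).map ev =
      killMat (ev a) (ev b) (fun ν => ev (φ ν)) (Pi.single μ 1) := by
  rw [killMatA, eval_combine, killMat_eq_sum_left (ev a)]
  simp

theorem derivation_killMatA (D : Derivation ℝ A A) (a b : A) (φ : Fin 4 → A) (μ : Fin 4) :
    (killMatA a b φ μ).map D = killMatA (D a) (D b) (fun ν => D (φ ν)) μ := by
  rw [killMatA, derivation_combine, killMatA]
  congr 1
  funext k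
  rcases k with k | k
  · fin_cases k <;> rfl
  · rfl

/-- The Dirac current with coefficients in an algebra of functions. -/
def currentA (C : SpinorPairing) (s t : Fin 4 → A) : Fin 4 → A :=
  fun μ => ∑ i, ∑ j, (C.current (Pi.single i 1) (Pi.single j 1) μ) • (s i * t j)

theorem SpinorPairing.current_eq_sum (C : SpinorPairing) (s t : Spinor) (μ : Fin 4) :
    C.current s t μ =
      ∑ i, ∑ j, (C.current (Pi.single i 1) (Pi.single j 1) μ) * (s i * t j) := by
  have h (s : Spinor) : s = ∑ i, s i • (Pi.single i 1 : Spinor) := by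
    ext j; simp [Finset.sum_apply, Pi.single_apply]
  conv_lhs => rw [h s, h t]
  simp only [SpinorPairing.current, map_sum, LinearMap.sum_apply, map_smul, LinearMap.smul_apply,
    smul_eq_mul, Finset.mul_sum, Matrix.mulVec_sum, Matrix.mulVec_smul]
  rw [Finset.sum_comm]
  exact Finset.sum_congr rfl fun i _ => Finset.sum_congr rfl fun j _ => by ring

theorem eval_currentA (ev : A →ₐ[ℝ] ℝ) (C : SpinorPairing) (s t : Fin 4 → A) (μ : Fin 4) :
    ev (currentA C s t μ) = C.current (evalTuple ev s) (evalTuple ev t) μ := by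
  rw [SpinorPairing.current_eq_sum]
  simp [currentA, evalTuple]

theorem derivation_currentA (D : Derivation ℝ A A) (C : SpinorPairing) (s t : Fin 4 → A)
    (μ : Fin 4) : D (currentA C s t μ) =
      currentA C (fun i => D (s i)) t μ + currentA C s (fun i => D (t i)) μ := by
  simp only [currentA, map_sum, Derivation.map_smul, Derivation.leibniz, smul_eq_mul, smul_add,
    Finset.sum_add_distrib]
  rw [add_comm]
  congr 1
  exact Finset.sum_congr rfl fun i _ => Finset.sum_congr rfl fun j _ => by rw [mul_comm]

end MatrixFamily

namespace FrameCalculus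

variable {A : Type*} [CommRing A] [Algebra ℝ A] (F : FrameCalculus A)

/-- The components of the frame field `e_μ`. -/
abbrev basis (μ : Fin 4) : Fin 4 → A := Pi.single μ 1

/-- The entries `g(e_μ, [X, e_ν])`. -/
def lie (X : Fin 4 → A) (μ ν : Fin 4) : A := eta μ • F.bracket X (basis ν) μ

/-- `X` is a Killing vector field. -/
def IsKilling (X : Fin 4 → A) : Prop := IsSkew (F.lie X)

/-- The derivative of a tuple of functions along a vector field. -/
def along {ι : Type*} (X : Fin 4 → A) (s : ι → A) : ι → A := fun i => F.der X (s i)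

theorem der_eq_sum (X : Fin 4 → A) (f : A) : F.der X f = ∑ μ, X μ * F.der (basis μ) f := by
  have h : X = ∑ μ, X μ • (basis μ : Fin 4 → A) := by
    ext j; simp [Finset.sum_apply, Pi.single_apply]
  conv_lhs => rw [h]
  simp only [map_sum, map_smul, ← Derivation.coeFnAddMonoidHom_apply, Finset.sum_apply]
  simp

theorem bracket_basis (X : Fin 4 → A) (μ ν : Fin 4) :
    F.bracket X (basis ν) μ = eta μ • F.lie X μ ν := by
  rw [lie, smul_smul, eta_mul_eta, one_smul]

/-- The Leibniz rule applied to `Y = Σ Y^ν e_ν`: the bracket is differentiation of components plus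
the matrix `lie X`, in the same form as a covariant derivative. -/
theorem bracket_apply (X Y : Fin 4 → A) (μ : Fin 4) :
    F.bracket X Y μ = F.der X (Y μ) + eta μ • ∑ ν, F.lie X μ ν * Y ν := by
  have h : Y = ∑ ν, Y ν • (basis ν : Fin 4 → A) := by
    ext j; simp [Finset.sum_apply, Pi.single_apply]
  let f : (Fin 4 → A) →+ (Fin 4 → A) := AddMonoidHom.mk' (F.bracket X) (F.bracket_add X)
  have e : F.bracket X Y = ∑ ν, F.bracket X (Y ν • basis ν) := by
    change f Y = ∑ ν, f (Y ν • basis ν)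
    conv_lhs => rw [h]
    rw [map_sum]
  rw [e, Finset.sum_apply]
  simp only [F.bracket_smul, Pi.add_apply, Pi.smul_apply, smul_eq_mul, Finset.sum_add_distrib,
    bracket_basis, Finset.smul_sum]
  congr 1
  · simp [Pi.single_apply]
  · refine Finset.sum_congr rfl fun ν _ => ?_
    rw [mul_smul_comm, mul_comm]

/-- The Jacobi identity for `X, Y, e_ν`. In matrix form, `Λ_{[X,Y]} = X(Λ_Y) - Y(Λ_X) + [Λ_X, Λ_Y]`,
which is the condition for `X ↦ X + Λ_X` to respect brackets. -/
theorem lie_bracket (ev : A →ₐ[ℝ] ℝ) (X Y : Fin 4 → A) (μ ν : Fin 4) :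
    ev (F.lie (F.bracket X Y) μ ν) = ev (F.der X (F.lie Y μ ν)) - ev (F.der Y (F.lie X μ ν))
      + (lowerMul (fun μ ν => ev (F.lie X μ ν)) (fun μ ν => ev (F.lie Y μ ν))
      - lowerMul (fun μ ν => ev (F.lie Y μ ν)) (fun μ ν => ev (F.lie X μ ν))) μ ν := by
  have key (X Y : Fin 4 → A) : ev (eta μ • F.bracket X (F.bracket Y (basis ν)) μ) =
      ev (F.der X (F.lie Y μ ν)) +
      lowerMul (fun μ ν => ev (F.lie X μ ν)) (fun μ ν => ev (F.lie Y μ ν)) μ ν := by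
    rw [F.bracket_apply X, smul_add, smul_smul, eta_mul_eta, one_smul, map_add, lie,
      Derivation.map_smul, lowerMul]
    congr 1
    simp only [map_sum, map_mul, bracket_basis, map_smul, smul_eq_mul]
    exact Finset.sum_congr rfl fun ρ _ => by ring
  have j := congrFun (F.jacobi X Y (basis ν)) μ
  rw [Pi.add_apply, ← sub_eq_iff_eq_add] at j
  rw [lie, ← j, smul_sub, map_sub, key, key, Pi.sub_apply, Pi.sub_apply]
  ring

theorem lie_basis_swap (μ ν ρ : Fin 4) :
    F.lie (basis μ) ρ ν = -F.lie (basis ν) ρ μ := by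
  rw [lie, F.bracket_swap, Pi.neg_apply, smul_neg, lie]

/-! ### The spinorial Lie derivative -/

/-- The Lie derivative of spinors, `L_X s = X(s) + σ(Λ) s` with `Λ e_ν = [X, e_ν]`. -/
def lieSpinor (X : Fin 4 → A) (s : Fin 4 → A) : Fin 4 → A :=
  F.along X s + sigmaA (F.lie X) *ᵥ s

theorem IsKilling.eval {F : FrameCalculus A} {X : Fin 4 → A} (hX : F.IsKilling X)
    (ev : A →ₐ[ℝ] ℝ) : IsSkew (fun μ ν => ev (F.lie X μ ν)) := fun μ ν => by
  simp only [hX μ ν, map_neg]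

theorem along_mulVec (X : Fin 4 → A) (P : Matrix (Fin 4) (Fin 4) A) (s : Fin 4 → A) :
    F.along X (P *ᵥ s) = P.map (F.der X) *ᵥ s + P *ᵥ F.along X s :=
  derivation_mulVec (F.der X) P s

theorem along_add {ι : Type*} (X : Fin 4 → A) (s t : ι → A) :
    F.along X (s + t) = F.along X s + F.along X t := by
  funext i; simp [along]

theorem along_bracket {ι : Type*} (X Y : Fin 4 → A) (s : ι → A) :
    F.along (F.bracket X Y) s = F.along X (F.along Y s) - F.along Y (F.along X s) := by
  funext i; exact F.der_bracket X Y (s i)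

theorem evalTuple_add {ι : Type*} (ev : A →ₐ[ℝ] ℝ) (s t : ι → A) :
    evalTuple ev (s + t) = evalTuple ev s + evalTuple ev t := by
  funext i; simp [evalTuple]

theorem evalTuple_sub {ι : Type*} (ev : A →ₐ[ℝ] ℝ) (s t : ι → A) :
    evalTuple ev (s - t) = evalTuple ev s - evalTuple ev t := by
  funext i; simp [evalTuple]

theorem evalTuple_mulVec (ev : A →ₐ[ℝ] ℝ) (P : Matrix (Fin 4) (Fin 4) A) (s : Fin 4 → A) :
    evalTuple ev (P *ᵥ s) = P.map ev *ᵥ evalTuple ev s := eval_mulVec ev P s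

theorem eval_lieSpinor (ev : A →ₐ[ℝ] ℝ) (X s : Fin 4 → A) :
    evalTuple ev (F.lieSpinor X s) = evalTuple ev (F.along X s)
      + spinSigma (fun μ ν => ev (F.lie X μ ν)) *ᵥ evalTuple ev s := by
  rw [lieSpinor, evalTuple_add, evalTuple_mulVec, eval_sigmaA]

/-- The cocycle identity `lie_bracket` pushed through `σ`. The Killing conditions enter because `σ`
respects commutators only of skew matrices. -/
theorem lieSpinor_bracket (ev : A →ₐ[ℝ] ℝ) {X Y : Fin 4 → A} (hX : F.IsKilling X)
    (hY : F.IsKilling Y) (s : Fin 4 → A) :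
    evalTuple ev (F.lieSpinor (F.bracket X Y) s) =
      evalTuple ev (F.lieSpinor X (F.lieSpinor Y s))
        - evalTuple ev (F.lieSpinor Y (F.lieSpinor X s)) := by
  have h : (fun μ ν => ev (F.lie (F.bracket X Y) μ ν)) =
      (fun μ ν => ev (F.der X (F.lie Y μ ν))) + (-1 : ℝ) • (fun μ ν => ev (F.der Y (F.lie X μ ν)))
      + (lowerMul (fun μ ν => ev (F.lie X μ ν)) (fun μ ν => ev (F.lie Y μ ν))
      - lowerMul (fun μ ν => ev (F.lie Y μ ν)) (fun μ ν => ev (F.lie X μ ν))) := by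
    funext μ ν
    rw [F.lie_bracket]
    simp only [Pi.add_apply, Pi.smul_apply, smul_eq_mul]
    ring
  rw [eval_lieSpinor, h, spinSigma_add, spinSigma_add, spinSigma_smul,
    ← spinSigma_commutator (hX.eval ev) (hY.eval ev)]
  simp only [lieSpinor, along_add, along_mulVec, derivation_sigmaA, evalTuple_add, evalTuple_sub,
    evalTuple_mulVec, eval_sigmaA, along_bracket, Matrix.add_mulVec, Matrix.sub_mulVec,
    Matrix.smul_mulVec, Matrix.mulVec_add, ← Matrix.mulVec_mulVec]
  module

theorem der_currentA (C : SpinorPairing) (X s t : Fin 4 → A) (μ : Fin 4) :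
    F.der X (currentA C s t μ) =
      currentA C (F.along X s) t μ + currentA C s (F.along X t) μ :=
  derivation_currentA (F.der X) C s t μ

/-- The Lie derivative of the Dirac current. -/
theorem bracket_currentA (C : SpinorPairing) (ev : A →ₐ[ℝ] ℝ) {X : Fin 4 → A}
    (hX : F.IsKilling X) (s t : Fin 4 → A) (μ : Fin 4) :
    ev (F.bracket X (currentA C s t) μ) =
      C.current (evalTuple ev (F.lieSpinor X s)) (evalTuple ev t) μ
        + C.current (evalTuple ev s) (evalTuple ev (F.lieSpinor X t)) μ := by
  have h := congrFun (C.current_spinSigma (hX.eval ev) (evalTuple ev s) (evalTuple ev t)) μ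
  rw [F.bracket_apply, der_currentA, eval_lieSpinor, eval_lieSpinor]
  simp only [map_add, eval_currentA, map_smul, map_sum, map_mul, smul_eq_mul]
  rw [lowerApply] at h
  simp only [SpinorPairing.current, Pi.add_apply, map_add, LinearMap.add_apply,
    Matrix.mulVec_add] at h ⊢
  rw [← h]
  ring

end FrameCalculus

namespace FrameCalculus

variable {A : Type*} [CommRing A] [Algebra ℝ A] (F : FrameCalculus A)

/-! ### The Levi-Civita connection -/

/-- The connection coefficients `g(∇_{e_μ} e_ν, e_ρ)`, as entries `(ρ, ν)`. -/
def christoffel (μ ρ ν : Fin 4) : A :=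
  (1 / 2 : ℝ) • (F.lie (basis μ) ρ ν - F.lie (basis μ) ν ρ - F.lie (basis ν) μ ρ)

/-- Metric compatibility in an orthonormal frame. With `christoffel_torsion` it is all that is used
later about the Levi-Civita coefficients. -/
theorem isSkew_christoffel (μ : Fin 4) : IsSkew (F.christoffel μ) := by
  intro ρ ν
  rw [christoffel, christoffel, F.lie_basis_swap ν ρ, ← smul_neg]
  congr 1; ring

theorem christoffel_torsion (μ ν ρ : Fin 4) :
    F.christoffel μ ρ ν - F.christoffel ν ρ μ = F.lie (basis μ) ρ ν := by
  have h : F.christoffel μ ρ ν - F.christoffel ν ρ μ =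
      (1 / 2 : ℝ) • (F.lie (basis μ) ρ ν + F.lie (basis μ) ρ ν) := by
    rw [christoffel, christoffel, F.lie_basis_swap ν μ, ← smul_sub]
    congr 1; ring
  rw [h, ← two_smul ℝ, smul_smul]; norm_num

/-- The entries of the endomorphism `e_ν ↦ ∇_Y e_ν`. -/
def conn (Y : Fin 4 → A) (ρ ν : Fin 4) : A := ∑ μ, Y μ * F.christoffel μ ρ ν

theorem eval_isSkew_conn (ev : A →ₐ[ℝ] ℝ) (Y : Fin 4 → A) :
    IsSkew (fun μ ν => ev (F.conn Y μ ν)) := by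
  intro μ ν
  simp only [conn, F.isSkew_christoffel _ μ ν, mul_neg, Finset.sum_neg_distrib, map_neg]

/-- The Jacobi identity for `X`, `e_μ`, `e_ν`. -/
theorem der_lie_basis (ev : A →ₐ[ℝ] ℝ) (X : Fin 4 → A) (μ ν ρ : Fin 4) :
    ev (F.der X (F.lie (basis μ) ρ ν)) +
      ∑ σ, eta σ * ev (F.lie X ρ σ) * ev (F.lie (basis μ) σ ν) =
    ev (F.der (basis μ) (F.lie X ρ ν)) - ev (F.der (basis ν) (F.lie X ρ μ))
      + ∑ σ, eta σ * ev (F.lie (basis μ) ρ σ) * ev (F.lie X σ ν)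
      - ∑ σ, eta σ * ev (F.lie (basis ν) ρ σ) * ev (F.lie X σ μ) := by
  have j := congrArg (fun v => ev (eta ρ • v ρ)) (F.jacobi X (basis μ) (basis ν))
  have key (X Y : Fin 4 → A) (ν : Fin 4) : ev (eta ρ • F.bracket X (F.bracket Y (basis ν)) ρ) =
      ev (F.der X (F.lie Y ρ ν)) + ∑ σ, eta σ * ev (F.lie X ρ σ) * ev (F.lie Y σ ν) := by
    rw [F.bracket_apply X, smul_add, smul_smul, eta_mul_eta, one_smul, map_add, lie,
      Derivation.map_smul]
    congr 1
    simp only [map_sum, map_mul, bracket_basis, map_smul, smul_eq_mul]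
    exact Finset.sum_congr rfl fun ρ _ => by ring
  rw [F.bracket_swap (F.bracket X (basis μ))] at j
  simp only [Pi.add_apply, Pi.neg_apply, smul_add, smul_neg, map_add, map_neg, key] at j
  linarith

/-- A Killing vector field preserves the Levi-Civita connection. -/
theorem lie_christoffel (ev : A →ₐ[ℝ] ℝ) {X : Fin 4 → A} (hX : F.IsKilling X) (μ ρ ν : Fin 4) :
    ev (F.der X (F.christoffel μ ρ ν)) +
      ∑ σ, eta σ * ev (F.lie X ρ σ) * ev (F.christoffel μ σ ν) -
      ∑ σ, eta σ * ev (F.christoffel μ ρ σ) * ev (F.lie X σ ν) =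
    ev (F.der (basis μ) (F.lie X ρ ν)) +
      ∑ σ, eta σ * ev (F.lie X σ μ) * ev (F.christoffel σ ρ ν) := by
  -- `T` represents the Lie derivative of the connection. It is skew in its last two indices because
  -- `X` is Killing and the connection is metric, and symmetric in the first and last by
  -- torsion-freeness and the Jacobi identity.
  obtain ⟨T, hT⟩ : ∃ T : Fin 4 → Fin 4 → Fin 4 → ℝ, ∀ μ ρ ν, T μ ρ ν =
    ev (F.der X (F.christoffel μ ρ ν)) +
      ∑ σ, eta σ * ev (F.lie X ρ σ) * ev (F.christoffel μ σ ν) -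
      ∑ σ, eta σ * ev (F.christoffel μ ρ σ) * ev (F.lie X σ ν) -
    (ev (F.der (basis μ) (F.lie X ρ ν)) +
      ∑ σ, eta σ * ev (F.lie X σ μ) * ev (F.christoffel σ ρ ν)) := ⟨_, fun _ _ _ => rfl⟩
  have skew (μ ρ ν) : T μ ρ ν = -T μ ν ρ := by
    have e : ∑ σ, eta σ * ev (F.christoffel μ ρ σ) * ev (F.lie X σ ν) =
        ∑ σ, eta σ * ev (F.lie X ν σ) * ev (F.christoffel μ σ ρ) := by
      refine Finset.sum_congr rfl fun σ _ => ?_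
      rw [hX ν σ, F.isSkew_christoffel μ σ ρ, map_neg, map_neg]; ring
    have e' : ∑ σ, eta σ * ev (F.christoffel μ ν σ) * ev (F.lie X σ ρ) =
        ∑ σ, eta σ * ev (F.lie X ρ σ) * ev (F.christoffel μ σ ν) := by
      refine Finset.sum_congr rfl fun σ _ => ?_
      rw [hX ρ σ, F.isSkew_christoffel μ σ ν, map_neg, map_neg]; ring
    have e'' : ∑ σ, eta σ * ev (F.lie X σ μ) * ev (F.christoffel σ ρ ν) =
        -∑ σ, eta σ * ev (F.lie X σ μ) * ev (F.christoffel σ ν ρ) := by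
      rw [← Finset.sum_neg_distrib]
      refine Finset.sum_congr rfl fun σ _ => ?_
      rw [F.isSkew_christoffel σ ρ ν, map_neg]; ring
    rw [hT, hT, e, e', e'', F.isSkew_christoffel μ ρ ν, hX ρ ν]
    simp only [map_neg]
    ring
  have symm (μ ρ ν) : T μ ρ ν = T ν ρ μ := by
    have j := F.der_lie_basis ev X μ ν ρ
    have t (μ ν ρ) : ev (F.lie (basis μ) ρ ν) =
        ev (F.christoffel μ ρ ν) - ev (F.christoffel ν ρ μ) := by
      rw [← F.christoffel_torsion, map_sub]
    rw [← F.christoffel_torsion μ ν ρ] at j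
    simp only [t, map_sub, mul_sub, sub_mul, Finset.sum_sub_distrib] at j
    have r (μ ν) : ∑ σ, eta σ * ev (F.lie X σ μ) * ev (F.christoffel σ ρ ν) =
        ∑ σ, eta σ * ev (F.christoffel σ ρ ν) * ev (F.lie X σ μ) :=
      Finset.sum_congr rfl fun σ _ => by ring
    rw [hT, hT, r, r]
    linarith
  -- Alternating the two symmetries through the six permutations of the indices uses three sign
  -- changes and returns to the start, so `T = -T`.
  have zero : T μ ρ ν = 0 := by
    linarith [skew μ ρ ν, symm μ ν ρ, skew ρ ν μ, symm ρ μ ν, skew ν μ ρ, symm ν ρ μ]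
  have := hT μ ρ ν
  linarith

end FrameCalculus

namespace FrameCalculus

variable {A : Type*} [CommRing A] [Algebra ℝ A] (F : FrameCalculus A)

/-! ### Killing spinors -/

/-- The Killing spinor equation in the frame. -/
def IsKillingSpinor (a b : A) (φ s : Fin 4 → A) : Prop :=
  ∀ μ, F.along (basis μ) s = killMatA a b φ μ *ᵥ s - sigmaA (F.christoffel μ) *ᵥ s

/-- The Killing spinor equation in the frame, at a point. -/
def IsKillingSpinorAt (ev : A →ₐ[ℝ] ℝ) (a b : A) (φ s : Fin 4 → A) : Prop :=
  ∀ μ, evalTuple ev (F.along (basis μ) s) =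
    killMat (ev a) (ev b) (evalTuple ev φ) (Pi.single μ 1) *ᵥ evalTuple ev s
      - spinSigma (fun ρ ν => ev (F.christoffel μ ρ ν)) *ᵥ evalTuple ev s

theorem IsKillingSpinor.eval {F : FrameCalculus A} {a b : A} {φ s : Fin 4 → A}
    (h : F.IsKillingSpinor a b φ s) (ev : A →ₐ[ℝ] ℝ) : F.IsKillingSpinorAt ev a b φ s := by
  intro μ
  rw [h μ, evalTuple_sub, evalTuple_mulVec, evalTuple_mulVec, eval_sigmaA, eval_killMatA]
  rfl

theorem eval_isSkew_christoffel (ev : A →ₐ[ℝ] ℝ) (μ : Fin 4) :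
    IsSkew (fun ρ ν => ev (F.christoffel μ ρ ν)) := fun ρ ν => by
  simp only [F.isSkew_christoffel μ ρ ν, map_neg]

theorem evalTuple_along_eq_sum {ι : Type*} (ev : A →ₐ[ℝ] ℝ) (Y : Fin 4 → A) (s : ι → A) :
    evalTuple ev (F.along Y s) = ∑ μ, ev (Y μ) • evalTuple ev (F.along (basis μ) s) := by
  funext i
  simp only [evalTuple, along, F.der_eq_sum Y, map_sum, map_mul, Finset.sum_apply, Pi.smul_apply,
    smul_eq_mul]

theorem IsKillingSpinorAt.along {F : FrameCalculus A} {ev : A →ₐ[ℝ] ℝ} {a b : A}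
    {φ s : Fin 4 → A} (h : F.IsKillingSpinorAt ev a b φ s) (Y : Fin 4 → A) :
    evalTuple ev (F.along Y s) =
      killMat (ev a) (ev b) (evalTuple ev φ) (evalTuple ev Y) *ᵥ evalTuple ev s
        - spinSigma (fun ρ ν => ev (F.conn Y ρ ν)) *ᵥ evalTuple ev s := by
  have e : (fun ρ ν => ev (F.conn Y ρ ν)) =
      ∑ μ, ev (Y μ) • fun ρ ν => ev (F.christoffel μ ρ ν) := by
    funext ρ ν
    simp [conn, Finset.sum_apply]
  let f : (Fin 4 → Fin 4 → ℝ) →ₗ[ℝ] Matrix (Fin 4) (Fin 4) ℝ :=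
    ⟨⟨spinSigma, spinSigma_add⟩, spinSigma_smul⟩
  have e' : spinSigma (fun ρ ν => ev (F.conn Y ρ ν)) =
      ∑ μ, ev (Y μ) • spinSigma (fun ρ ν => ev (F.christoffel μ ρ ν)) := by
    change f _ = ∑ μ, ev (Y μ) • f _
    rw [e, map_sum]
    simp only [map_smul]
  rw [evalTuple_along_eq_sum, killMat_eq_sum, e', Matrix.sum_mulVec, Matrix.sum_mulVec,
    ← Finset.sum_sub_distrib]
  refine Finset.sum_congr rfl fun μ _ => ?_
  rw [h μ, smul_sub, Matrix.smul_mulVec, Matrix.smul_mulVec]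
  rfl

theorem evalTuple_bracket (ev : A →ₐ[ℝ] ℝ) (X Y : Fin 4 → A) :
    evalTuple ev (F.bracket X Y) = evalTuple ev (F.along X Y)
      + lowerApply (fun μ ν => ev (F.lie X μ ν)) (evalTuple ev Y) := by
  funext μ
  simp only [evalTuple, F.bracket_apply, Pi.add_apply, lowerApply, along, map_add, map_smul,
    map_sum, map_mul, smul_eq_mul]

theorem evalTuple_bracket_basis (ev : A →ₐ[ℝ] ℝ) (X : Fin 4 → A) (μ : Fin 4) :
    evalTuple ev (F.bracket X (basis μ)) =
      lowerApply (fun μ ν => ev (F.lie X μ ν)) (Pi.single μ 1) := by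
  funext ν
  simp [evalTuple, bracket_basis, lowerApply, Pi.single_apply]

/-- The Lie derivative along a symmetry preserves Killing spinors. -/
theorem IsKillingSpinor.lieSpinor {F : FrameCalculus A} {a b : A} {φ s X : Fin 4 → A}
    (hs : F.IsKillingSpinor a b φ s) (ev : A →ₐ[ℝ] ℝ) (hX : F.IsKilling X)
    (ha : F.der X a = 0) (hb : F.der X b = 0) (hφ : F.bracket X φ = 0) :
    F.IsKillingSpinorAt ev a b φ (F.lieSpinor X s) := by
  intro μ
  have hs' := hs.eval ev
  -- This is `lie_christoffel`: differentiating along `[X, e_μ]` produces exactly the connection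
  -- terms needed to commute `L_X` past `∇_{e_μ}`.
  have hconn : (fun ρ ν => ev (F.conn (F.bracket X (basis μ)) ρ ν)) =
      (fun ρ ν => ev (F.der X (F.christoffel μ ρ ν)))
      + (lowerMul (fun ρ ν => ev (F.lie X ρ ν)) (fun ρ ν => ev (F.christoffel μ ρ ν))
        - lowerMul (fun ρ ν => ev (F.christoffel μ ρ ν)) (fun ρ ν => ev (F.lie X ρ ν)))
      + (-1 : ℝ) • (fun ρ ν => ev (F.der (basis μ) (F.lie X ρ ν))) := by
    funext ρ ν
    have h := F.lie_christoffel ev hX μ ρ ν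
    simp only [Pi.add_apply, Pi.sub_apply, Pi.smul_apply, smul_eq_mul, lowerMul, conn, map_sum,
      map_mul, bracket_basis, map_smul]
    linarith
  have e1 : F.along (basis μ) (F.along X s) = F.along X (F.along (basis μ) s)
      - F.along (F.bracket X (basis μ)) s := by
    rw [F.along_bracket]; abel
  -- `L_X φ = 0` exchanges the component derivative of `φ` for `-Λ_X φ`, which cancels the term that
  -- `killMat_equivariant` produces from `φ`.
  have hφ' : evalTuple ev (F.along X φ) =
      -lowerApply (fun μ ν => ev (F.lie X μ ν)) (evalTuple ev φ) := by
    have h := F.evalTuple_bracket ev X φ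
    rw [hφ] at h
    rw [eq_neg_iff_add_eq_zero, ← h]
    funext i; simp [evalTuple]
  have hkill : killMat 0 0 (evalTuple ev (F.along X φ)) (Pi.single μ 1) =
      -killMat 0 0 (lowerApply (fun μ ν => ev (F.lie X μ ν)) (evalTuple ev φ))
        (Pi.single μ 1) := by
    rw [hφ', killMat_eq_sum_left, killMat_eq_sum_left _ _ (lowerApply _ _)]
    simp
  have heq := killMat_equivariant (hX.eval ev) (ev a) (ev b) (evalTuple ev φ) (Pi.single μ 1)
  have hcomm := spinSigma_commutator (hX.eval ev) (F.eval_isSkew_christoffel ev μ)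
  have hder : evalTuple ev (F.along X (F.along (basis μ) s)) =
      killMat 0 0 (evalTuple ev (F.along X φ)) (Pi.single μ 1) *ᵥ evalTuple ev s
      + killMat (ev a) (ev b) (evalTuple ev φ) (Pi.single μ 1) *ᵥ evalTuple ev (F.along X s)
      - (spinSigma (fun ρ ν => ev (F.der X (F.christoffel μ ρ ν))) *ᵥ evalTuple ev s
      + spinSigma (fun ρ ν => ev (F.christoffel μ ρ ν)) *ᵥ evalTuple ev (F.along X s)) := by
    have e2 : F.along X (killMatA a b φ μ *ᵥ s - sigmaA (F.christoffel μ) *ᵥ s) =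
        F.along X (killMatA a b φ μ *ᵥ s) - F.along X (sigmaA (F.christoffel μ) *ᵥ s) := by
      funext i; simp [FrameCalculus.along]
    rw [hs μ, e2, F.along_mulVec, F.along_mulVec, derivation_killMatA, derivation_sigmaA]
    simp only [evalTuple_add, evalTuple_sub, evalTuple_mulVec, eval_sigmaA, eval_killMatA, ha, hb,
      map_zero]
    rfl
  rw [eval_lieSpinor, FrameCalculus.lieSpinor, F.along_add, F.along_mulVec, derivation_sigmaA, e1]
  simp only [evalTuple_add, evalTuple_sub, evalTuple_mulVec, eval_sigmaA]
  rw [hs'.along (F.bracket X (basis μ)), hs' μ, F.evalTuple_bracket_basis, hconn, hder, hkill]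
  rw [spinSigma_add, spinSigma_add, ← hcomm, spinSigma_smul]
  have heq' := congrArg (· *ᵥ evalTuple ev s) heq
  simp only [Matrix.add_mulVec, Matrix.sub_mulVec, Matrix.neg_mulVec, Matrix.mulVec_add,
    Matrix.mulVec_sub, Matrix.smul_mulVec, ← Matrix.mulVec_mulVec] at heq' ⊢
  rw [heq']
  module

/-! ### Integrability -/

/-- The Riemann tensor at a point. -/
def riemann (ev : A →ₐ[ℝ] ℝ) (μ ν : Fin 4) : Fin 4 → Fin 4 → ℝ :=
  (fun ρ σ => ev (F.der (basis μ) (F.christoffel ν ρ σ)))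
  - (fun ρ σ => ev (F.der (basis ν) (F.christoffel μ ρ σ)))
  + (lowerMul (fun ρ σ => ev (F.christoffel μ ρ σ)) (fun ρ σ => ev (F.christoffel ν ρ σ))
    - lowerMul (fun ρ σ => ev (F.christoffel ν ρ σ)) (fun ρ σ => ev (F.christoffel μ ρ σ)))
  - (fun ρ σ => ev (F.conn (F.bracket (basis μ) (basis ν)) ρ σ))

theorem eval_conn_bracket_basis (ev : A →ₐ[ℝ] ℝ) (μ ν ρ σ : Fin 4) :
    ev (F.conn (F.bracket (basis μ) (basis ν)) ρ σ) =
      ∑ τ, eta τ * ev (F.lie (basis μ) τ ν) * ev (F.christoffel τ ρ σ) := by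
  simp only [conn, bracket_basis, map_sum, map_mul, map_smul, smul_eq_mul]

theorem isRiemannTensor_riemann (ev : A →ₐ[ℝ] ℝ) : IsRiemannTensor (F.riemann ev) where
  skew_left μ ν ρ σ := by
    simp only [riemann, Pi.sub_apply, Pi.add_apply]
    rw [F.eval_conn_bracket_basis, F.eval_conn_bracket_basis]
    simp only [F.lie_basis_swap μ ν, map_neg, mul_neg, neg_mul, Finset.sum_neg_distrib]
    ring
  skew_right μ ν ρ σ := by
    have h := (F.eval_isSkew_christoffel ev μ).lowerMul_sub (F.eval_isSkew_christoffel ev ν) ρ σ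
    have h' := F.eval_isSkew_conn ev (F.bracket (basis μ) (basis ν)) ρ σ
    simp only [Pi.sub_apply] at h h'
    simp only [riemann, Pi.sub_apply, Pi.add_apply, F.isSkew_christoffel _ ρ σ, map_neg, h, h']
    ring
  bianchi μ ν σ ρ := by
    -- The first Bianchi identity is the Jacobi identity of three frame fields, with each bracket
    -- written as a difference of connection coefficients.
    have j := F.der_lie_basis ev (basis μ) ν σ ρ
    have t (μ ν ρ) : ev (F.lie (basis μ) ρ ν) =
        ev (F.christoffel μ ρ ν) - ev (F.christoffel ν ρ μ) := by
      rw [← F.christoffel_torsion, map_sub]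
    have r (μ ν σ : Fin 4) : ∑ τ, eta τ * ev (F.christoffel τ ρ σ) * ev (F.christoffel μ τ ν) =
        ∑ τ, eta τ * ev (F.christoffel μ τ ν) * ev (F.christoffel τ ρ σ) :=
      Finset.sum_congr rfl fun σ _ => by ring
    rw [← F.christoffel_torsion ν σ ρ, ← F.christoffel_torsion μ σ ρ,
      ← F.christoffel_torsion μ ν ρ] at j
    simp only [riemann, Pi.sub_apply, Pi.add_apply, lowerMul, F.eval_conn_bracket_basis]
    simp only [t, map_sub, mul_sub, sub_mul, Finset.sum_sub_distrib, r] at j ⊢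
    linarith

/-- The curvature of the Killing spinor connection annihilates Killing spinors. -/
theorem IsKillingSpinor.killCurvature {F : FrameCalculus A} {a b : A} {φ s : Fin 4 → A}
    (hs : F.IsKillingSpinor a b φ s) (ev : A →ₐ[ℝ] ℝ) (μ ν : Fin 4) :
    killCurvature (F.riemann ev) (ev a) (ev b) (evalTuple ev φ)
      (fun μ => ev (F.der (basis μ) a)) (fun μ => ev (F.der (basis μ) b))
      (fun μ => evalTuple ev (F.along (basis μ) φ)
        + lowerApply (fun ρ ν => ev (F.christoffel μ ρ ν)) (evalTuple ev φ)) μ ν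
      *ᵥ evalTuple ev s = 0 := by
  have hs' := hs.eval ev
  -- Differentiate the Killing equation once more; the commutator of two such derivatives will be
  -- compared with the derivative along `[e_μ, e_ν]`.
  have second (μ ν : Fin 4) : evalTuple ev (F.along (basis μ) (F.along (basis ν) s)) =
      killMat (ev (F.der (basis μ) a)) (ev (F.der (basis μ) b))
        (evalTuple ev (F.along (basis μ) φ)) (Pi.single ν 1) *ᵥ evalTuple ev s
      + killMat (ev a) (ev b) (evalTuple ev φ) (Pi.single ν 1) *ᵥ
        evalTuple ev (F.along (basis μ) s)
      - (spinSigma (fun ρ σ => ev (F.der (basis μ) (F.christoffel ν ρ σ))) *ᵥ evalTuple ev s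
      + spinSigma (fun ρ σ => ev (F.christoffel ν ρ σ)) *ᵥ
        evalTuple ev (F.along (basis μ) s)) := by
    have e2 : F.along (basis μ) (killMatA a b φ ν *ᵥ s - sigmaA (F.christoffel ν) *ᵥ s) =
        F.along (basis μ) (killMatA a b φ ν *ᵥ s)
          - F.along (basis μ) (sigmaA (F.christoffel ν) *ᵥ s) := by
      funext i; simp [FrameCalculus.along]
    conv_lhs => rw [hs ν]
    rw [e2, F.along_mulVec, F.along_mulVec, derivation_killMatA, derivation_sigmaA]
    simp only [evalTuple_add, evalTuple_sub, evalTuple_mulVec, eval_sigmaA, eval_killMatA]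
    rfl
  have hb := congrArg (evalTuple ev) (F.along_bracket (basis μ) (basis ν) s)
  rw [hs'.along, evalTuple_sub, second, second, hs' μ, hs' ν] at hb
  have kadd (a b a' b' : ℝ) (φ φ' X : Fin 4 → ℝ) :
      killMat (a + a') (b + b') (φ + φ') X = killMat a b φ X + killMat a' b' φ' X := by
    rw [killMat_eq_sum_left, killMat_eq_sum_left a, killMat_eq_sum_left a']
    simp only [add_smul, Pi.add_apply, Finset.sum_add_distrib]
    abel
  have kadd' (μ ν : Fin 4) := kadd (ev (F.der (basis μ) a)) (ev (F.der (basis μ) b)) 0 0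
    (evalTuple ev (F.along (basis μ) φ))
    (lowerApply (fun ρ ν => ev (F.christoffel μ ρ ν)) (evalTuple ev φ)) (Pi.single ν 1)
  simp only [add_zero] at kadd'
  -- Equivariance turns the commutators of `σ(ω_μ)` with `K_ν` into the connection terms of `∇_μ φ`
  -- and of `∇_μ e_ν`; the latter assemble to `K_{[e_μ, e_ν]}` by torsion-freeness.
  have heq (μ ν : Fin 4) := congrArg (· *ᵥ evalTuple ev s)
    (killMat_equivariant (F.eval_isSkew_christoffel ev μ) (ev a) (ev b)
    (evalTuple ev φ) (Pi.single ν 1))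
  have hcomm := spinSigma_commutator (F.eval_isSkew_christoffel ev μ)
    (F.eval_isSkew_christoffel ev ν)
  have hbr : evalTuple ev (F.bracket (basis μ) (basis ν)) =
      lowerApply (fun ρ ν => ev (F.christoffel μ ρ ν)) (Pi.single ν 1)
      + (-1 : ℝ) • lowerApply (fun ρ σ => ev (F.christoffel ν ρ σ)) (Pi.single μ 1) := by
    rw [F.evalTuple_bracket_basis]
    funext ρ
    simp only [lowerApply, Pi.add_apply, Pi.smul_apply, smul_eq_mul, Pi.single_apply, mul_ite,
      mul_one, mul_zero, Finset.sum_ite_eq', Finset.mem_univ, if_true,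
      ← F.christoffel_torsion μ ν ρ, map_sub]
    ring
  have hR : spinSigma (F.riemann ev μ ν) =
      spinSigma (fun ρ σ => ev (F.der (basis μ) (F.christoffel ν ρ σ)))
      - spinSigma (fun ρ σ => ev (F.der (basis ν) (F.christoffel μ ρ σ)))
      + (spinSigma (fun ρ σ => ev (F.christoffel μ ρ σ)) *
          spinSigma (fun ρ σ => ev (F.christoffel ν ρ σ))
        - spinSigma (fun ρ σ => ev (F.christoffel ν ρ σ)) *
          spinSigma (fun ρ σ => ev (F.christoffel μ ρ σ)))
      - spinSigma (fun ρ σ => ev (F.conn (F.bracket (basis μ) (basis ν)) ρ σ)) := by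
    have sub (P Q : Fin 4 → Fin 4 → ℝ) : spinSigma (P - Q) = spinSigma P - spinSigma Q := by
      rw [sub_eq_add_neg, ← neg_one_smul ℝ Q, spinSigma_add, spinSigma_smul]; module
    rw [hcomm, ← sub, ← spinSigma_add, ← sub, riemann]
  rw [hbr, killMat_add_right, killMat_smul_right] at hb
  rw [KillingSuper.killCurvature, kadd', kadd', hR]
  have h1 := heq μ ν
  have h2 := heq ν μ
  simp only [Matrix.add_mulVec, Matrix.sub_mulVec, Matrix.mulVec_add,
    Matrix.mulVec_sub, Matrix.smul_mulVec, ← Matrix.mulVec_mulVec] at h1 h2 hb ⊢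
  rw [h1, h2] at hb
  rw [← sub_eq_zero] at hb
  rw [← neg_eq_zero, ← hb]
  module

end FrameCalculus

namespace FrameCalculus

variable {A : Type*} [CommRing A] [Algebra ℝ A] {F : FrameCalculus A}

/-! ### The Dirac current of a Killing spinor -/

/-- Torsion-freeness gives `[κ, e_ν] = ∇_κ e_ν - ∇_{e_ν} κ`. Differentiating `κ` by the Killing
equation, the connection terms recombine into those of `∇_{e_ν} κ`, so that this vector is the
algebraic expression `currentDeriv`. -/
theorem IsKillingSpinor.eval_lie_current {a b : A} {φ s : Fin 4 → A}
    (hs : F.IsKillingSpinor a b φ s) (C : SpinorPairing) (ev : A →ₐ[ℝ] ℝ) :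
    (fun μ ν => ev (F.lie (currentA C s s) μ ν)) =
      (fun μ ν => ev (F.conn (currentA C s s) μ ν))
      + (-1 : ℝ) • C.currentDeriv (ev a) (ev b) (evalTuple ev φ) (evalTuple ev s) := by
  funext μ ν
  have h := congrFun (C.current_spinSigma (F.eval_isSkew_christoffel ev ν)
    (evalTuple ev s) (evalTuple ev s)) μ
  have d : ev (F.der (basis ν) (currentA C s s μ)) =
      2 * C.current (evalTuple ev s) (evalTuple ev (F.along (basis ν) s)) μ := by
    rw [F.der_currentA, map_add, eval_currentA, eval_currentA, C.current_comm _ (evalTuple ev s)]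
    ring
  rw [C.current_comm _ (evalTuple ev s)] at h
  rw [hs.eval ev ν] at d
  rw [lie, F.bracket_swap, Pi.neg_apply, smul_neg, F.bracket_apply, smul_add, smul_smul,
    eta_mul_eta, one_smul, map_neg, map_add, map_smul, d]
  have e : ∑ ρ, ev (F.lie (basis ν) μ ρ) * ev (currentA C s s ρ) =
      ∑ ρ, ev (F.christoffel ν μ ρ) * ev (currentA C s s ρ)
        - ∑ ρ, ev (currentA C s s ρ) * ev (F.christoffel ρ μ ν) := by
    rw [← Finset.sum_sub_distrib]
    refine Finset.sum_congr rfl fun ρ _ => ?_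
    rw [← F.christoffel_torsion ν ρ μ, map_sub]; ring
  simp only [map_sum, map_mul, conn, Pi.add_apply, Pi.smul_apply, smul_eq_mul, e,
    SpinorPairing.currentDeriv]
  simp only [eval_currentA, lowerApply, SpinorPairing.current, Pi.add_apply, Matrix.mulVec_sub,
    map_sub] at h ⊢
  linear_combination eta μ * h + (-2 * C.form (evalTuple ev s)
    (gam μ *ᵥ killMat (ev a) (ev b) (evalTuple ev φ) (Pi.single ν 1) *ᵥ evalTuple ev s)
    + ∑ ρ, ev (F.christoffel ν μ ρ) * (eta ρ * C.form (evalTuple ev s)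
      (gam ρ *ᵥ evalTuple ev s))) * eta_mul_eta μ

/-- The Dirac current of a Killing spinor is a Killing vector field. -/
theorem IsKillingSpinor.eval_isKilling_current {a b : A} {φ s : Fin 4 → A}
    (hs : F.IsKillingSpinor a b φ s) (C : SpinorPairing) (ev : A →ₐ[ℝ] ℝ) :
    IsSkew (fun μ ν => ev (F.lie (currentA C s s) μ ν)) := by
  intro μ ν
  rw [hs.eval_lie_current C ev]
  have h := F.eval_isSkew_conn ev (currentA C s s) μ ν
  have h' := C.isSkew_currentDeriv (ev a) (ev b) (evalTuple ev φ) (evalTuple ev s) μ ν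
  simp only [Pi.add_apply, Pi.smul_apply, smul_eq_mul] at h ⊢
  rw [h, h']; ring

/-- The connection term `∇_κ` occurs with opposite signs in the Killing equation and in
`eval_lie_current`; what remains is the cubic identity for one spinor. -/
theorem IsKillingSpinor.lieSpinor_current {a b : A} {φ s : Fin 4 → A}
    (hs : F.IsKillingSpinor a b φ s) (C : SpinorPairing) (ev : A →ₐ[ℝ] ℝ) :
    evalTuple ev (F.lieSpinor (currentA C s s) s) = 0 := by
  have e : evalTuple ev (currentA C s s) = C.current (evalTuple ev s) (evalTuple ev s) :=
    funext fun μ => eval_currentA ev C s s μ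
  rw [eval_lieSpinor, hs.eval_lie_current C ev, (hs.eval ev).along, spinSigma_add,
    spinSigma_smul, e]
  have h := C.killMat_current_add_spinSigma (ev a) (ev b) (evalTuple ev φ) (evalTuple ev s)
  rw [Matrix.add_mulVec, Matrix.smul_mulVec, ← h]
  module

/-- The first two claims are integrability conditions directly. The third condition, `∇_κ φ = ∇_φ
κ`, becomes `[κ, φ] = 0` once the bracket is expanded with `eval_lie_current`. -/
theorem IsKillingSpinor.current_symmetry {a b : A} {φ s : Fin 4 → A}
    (hs : F.IsKillingSpinor a b φ s) (C : SpinorPairing) (ev : A →ₐ[ℝ] ℝ) :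
    ev (F.der (currentA C s s) a) = 0 ∧ ev (F.der (currentA C s s) b) = 0 ∧
      evalTuple ev (F.bracket (currentA C s s) φ) = 0 := by
  obtain ⟨h1, h2, h3⟩ := killCurvature_integrability C (F.isRiemannTensor_riemann ev)
    (hs.killCurvature ev)
  simp only [F.der_eq_sum (currentA C s s), map_sum, map_mul, eval_currentA]
  refine ⟨h1, h2, ?_⟩
  rw [F.evalTuple_bracket, F.evalTuple_along_eq_sum, hs.eval_lie_current C ev]
  funext ν
  have h := h3 ν
  simp only [Pi.add_apply, mul_add, Finset.sum_add_distrib, lowerApply] at h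
  simp only [Pi.add_apply, lowerApply, Finset.sum_apply, Pi.smul_apply, smul_eq_mul,
    eval_currentA, conn, map_sum, map_mul, add_mul, Finset.sum_add_distrib, Pi.zero_apply]
  have e1 : ∑ ρ, (∑ μ, C.current (evalTuple ev s) (evalTuple ev s) μ *
      ev (F.christoffel μ ν ρ)) * evalTuple ev φ ρ =
      eta ν * ∑ μ, C.current (evalTuple ev s) (evalTuple ev s) μ *
        (eta ν * ∑ ρ, ev (F.christoffel μ ν ρ) * evalTuple ev φ ρ) := by
    simp only [Finset.sum_mul, Finset.mul_sum]
    rw [Finset.sum_comm]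
    refine Finset.sum_congr rfl fun μ _ => Finset.sum_congr rfl fun ρ _ => ?_
    linear_combination (-(C.current (evalTuple ev s) (evalTuple ev s) μ) *
      ev (F.christoffel μ ν ρ) * evalTuple ev φ ρ) * eta_mul_eta ν
  have e2 : ∑ ρ, -1 * C.currentDeriv (ev a) (ev b) (evalTuple ev φ) (evalTuple ev s) ν ρ *
      evalTuple ev φ ρ = -(eta ν * ∑ μ, evalTuple ev φ μ * (eta ν *
        C.currentDeriv (ev a) (ev b) (evalTuple ev φ) (evalTuple ev s) ν μ)) := by
    rw [Finset.mul_sum, ← Finset.sum_neg_distrib]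
    refine Finset.sum_congr rfl fun ρ _ => ?_
    linear_combination (evalTuple ev φ ρ *
      C.currentDeriv (ev a) (ev b) (evalTuple ev φ) (evalTuple ev s) ν ρ) * eta_mul_eta ν
  rw [e1, e2, ← h]
  set P := ∑ μ, C.current (evalTuple ev s) (evalTuple ev s) μ *
    evalTuple ev (F.along (basis μ) φ) ν
  set Q := ∑ μ, C.current (evalTuple ev s) (evalTuple ev s) μ *
        (eta ν * ∑ ρ, ev (F.christoffel μ ν ρ) * evalTuple ev φ ρ)
  linear_combination (-P) * eta_mul_eta ν

end FrameCalculus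

/-! ## Local calculus on a Lorentzian manifold -/

section Manifold

variable {M : Type*} [TopologicalSpace M] [ChartedSpace (EuclideanSpace ℝ (Fin 4)) M]
  [IsManifold (𝓡 4) ∞ M]

/-- Vector fields which are smooth on a set. -/
abbrev SmoothFieldOn (X : VField M) (U : Set M) : Prop :=
  ContMDiffOn (𝓡 4) (𝓡 4).tangent ∞ (fun x => (⟨x, X x⟩ : TangentBundle (𝓡 4) M)) U

/-- Functions which are smooth on a set. -/
abbrev SmoothFnOn (f : M → ℝ) (U : Set M) : Prop := ContMDiffOn (𝓡 4) 𝓘(ℝ, ℝ) ∞ f U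

theorem SmoothField.smoothFieldOn {X : VField M} (hX : SmoothField X) (U : Set M) :
    SmoothFieldOn X U := ContMDiff.contMDiffOn hX

section Local

variable {U : Set M} {X Y Z : VField M} {f h : M → ℝ} {x : M}

theorem SmoothFieldOn.mdifferentiableAt (hX : SmoothFieldOn X U) (hU : IsOpen U) (hx : x ∈ U) :
    MDifferentiableAt (𝓡 4) (𝓡 4).tangent
      (fun y => (⟨y, X y⟩ : TangentBundle (𝓡 4) M)) x :=
  (hX.contMDiffAt (hU.mem_nhds hx)).mdifferentiableAt (by simp)

theorem SmoothFnOn.mdifferentiableAt (hf : SmoothFnOn f U) (hU : IsOpen U) (hx : x ∈ U) :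
    MDifferentiableAt (𝓡 4) 𝓘(ℝ, ℝ) f x :=
  (ContMDiffOn.contMDiffAt hf (hU.mem_nhds hx)).mdifferentiableAt (by simp)

theorem SmoothFieldOn.mlieBracket (hX : SmoothFieldOn X U) (hY : SmoothFieldOn Y U)
    (hU : IsOpen U) : SmoothFieldOn (mlieBracket (𝓡 4) X Y) U := by
  intro x hx
  have : IsManifold (𝓡 4) (minSmoothness ℝ 2) M := by
    rw [minSmoothness_of_isRCLikeNormedField]; infer_instance
  have : IsManifold (𝓡 4) (((⊤ : ℕ∞) : WithTop ℕ∞) + 1) M :=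
    inferInstanceAs (IsManifold (𝓡 4) ((⊤ + 1 : ℕ∞) : WithTop ℕ∞) M)
  have h := ContMDiffAt.mlieBracket_vectorField (m := ⊤) (n := ⊤) (I := 𝓡 4)
    (hX.contMDiffAt (hU.mem_nhds hx)) (hY.contMDiffAt (hU.mem_nhds hx)) (by simp)
  exact h.contMDiffWithinAt

theorem LorentzianMetric.smoothFnOn_pair (g : LorentzianMetric M) (hX : SmoothFieldOn X U)
    (hY : SmoothFieldOn Y U) : SmoothFnOn (g.pair X Y) U := by
  intro x hx
  have : ContMDiffWithinAt (𝓡 4) ((𝓡 4).prod 𝓘(ℝ)) ∞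
      (fun m ↦ TotalSpace.mk' ℝ (E := Bundle.Trivial M ℝ) m (g.inner m (X m) (Y m))) U x := by
    apply ContMDiffWithinAt.clm_bundle_apply₂ (F₁ := EuclideanSpace ℝ (Fin 4))
      (F₂ := EuclideanSpace ℝ (Fin 4))
    · exact g.contMDiff.contMDiffAt.contMDiffWithinAt
    · exact hX x hx
    · exact hY x hx
  simp only [contMDiffWithinAt_totalSpace] at this
  exact this.2

theorem mvfderiv_congr {V : Type*} [NormedAddCommGroup V] [NormedSpace ℝ V] {f h : M → V}
    (e : f =ᶠ[nhds x] h) : mvfderiv (𝓡 4) f x = mvfderiv (𝓡 4) h x := by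
  ext v
  simp only [mvfderiv, e.mfderiv_eq]
  rfl

theorem jacobi_mlieBracket (hX : SmoothFieldOn X U) (hY : SmoothFieldOn Y U)
    (hZ : SmoothFieldOn Z U) (hU : IsOpen U) (hx : x ∈ U) :
    mlieBracket (𝓡 4) X (mlieBracket (𝓡 4) Y Z) x =
      mlieBracket (𝓡 4) (mlieBracket (𝓡 4) X Y) Z x
        + mlieBracket (𝓡 4) Y (mlieBracket (𝓡 4) X Z) x := by
  have : IsManifold (𝓡 4) (minSmoothness ℝ 3) M := by
    rw [minSmoothness_of_isRCLikeNormedField]; infer_instance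
  have hle : minSmoothness ℝ 2 ≤ (∞ : WithTop ℕ∞) := by
    rw [minSmoothness_of_isRCLikeNormedField]; exact ENat.LEInfty.out
  exact leibniz_identity_mlieBracket_apply ((hX.contMDiffAt (hU.mem_nhds hx)).of_le hle)
    ((hY.contMDiffAt (hU.mem_nhds hx)).of_le hle) ((hZ.contMDiffAt (hU.mem_nhds hx)).of_le hle)

theorem mlieBracket_congr_of_eqOn {X' Y' : VField M} (hU : IsOpen U) (hx : x ∈ U)
    (hX : ∀ y ∈ U, X y = X' y) (hY : ∀ y ∈ U, Y y = Y' y) :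
    mlieBracket (𝓡 4) X Y x = mlieBracket (𝓡 4) X' Y' x :=
  Filter.EventuallyEq.mlieBracket_vectorField_eq
    (Filter.eventuallyEq_of_mem (hU.mem_nhds hx) hX)
    (Filter.eventuallyEq_of_mem (hU.mem_nhds hx) hY)

/-- The Lie bracket acts on functions as a commutator of derivations, near a nowhere vanishing
vector field. -/
theorem mvfderiv_mlieBracket_of_ne_zero (hf : SmoothFnOn f U) (hX : SmoothFieldOn X U)
    (hY : SmoothFieldOn Y U) (hZ : SmoothFieldOn Z U) (hU : IsOpen U) (hx : x ∈ U)
    (hXf : SmoothFnOn (fun y => mvfderiv (𝓡 4) f y (X y)) U)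
    (hYf : SmoothFnOn (fun y => mvfderiv (𝓡 4) f y (Y y)) U) (hZx : Z x ≠ 0) :
    mvfderiv (𝓡 4) f x (mlieBracket (𝓡 4) X Y x) =
      mvfderiv (𝓡 4) (fun y => mvfderiv (𝓡 4) f y (Y y)) x (X x)
        - mvfderiv (𝓡 4) (fun y => mvfderiv (𝓡 4) f y (X y)) x (Y x) := by
  have hfZ : SmoothFieldOn (f • Z) U := ContMDiffOn.smul_section hf hZ
  have hf' {y} (hy : y ∈ U) := SmoothFnOn.mdifferentiableAt hf hU hy
  have hZ' {y} (hy : y ∈ U) := SmoothFieldOn.mdifferentiableAt hZ hU hy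
  have second {X Y : VField M} (hX : SmoothFieldOn X U) (hY : SmoothFieldOn Y U)
      (hYf : SmoothFnOn (fun y => mvfderiv (𝓡 4) f y (Y y)) U) :
      mlieBracket (𝓡 4) X (mlieBracket (𝓡 4) Y (f • Z)) x =
        mvfderiv (𝓡 4) (fun y => mvfderiv (𝓡 4) f y (Y y)) x (X x) • Z x
        + mvfderiv (𝓡 4) f x (Y x) • mlieBracket (𝓡 4) X Z x
        + (mvfderiv (𝓡 4) f x (X x) • mlieBracket (𝓡 4) Y Z x
        + f x • mlieBracket (𝓡 4) X (mlieBracket (𝓡 4) Y Z) x) := by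
    have hYZ := SmoothFieldOn.mlieBracket hY hZ hU
    rw [mlieBracket_congr_of_eqOn (X' := X)
      (Y' := (fun y => mvfderiv (𝓡 4) f y (Y y)) • Z + f • mlieBracket (𝓡 4) Y Z) hU hx
      (fun _ _ => rfl) (fun y hy => mlieBracket_smul_right (hf' hy) (hZ' hy))]
    rw [mlieBracket_add_right
      (SmoothFieldOn.mdifferentiableAt (ContMDiffOn.smul_section hYf hZ) hU hx)
      (SmoothFieldOn.mdifferentiableAt (ContMDiffOn.smul_section hf hYZ) hU hx),
      mlieBracket_smul_right (SmoothFnOn.mdifferentiableAt hYf hU hx) (hZ' hx),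
      mlieBracket_smul_right (hf' hx) (SmoothFieldOn.mdifferentiableAt hYZ hU hx)]
  -- Compare the Jacobi identity for `X, Y, fZ` with `f` times that for `X, Y, Z`. The first-order
  -- terms in `f` cancel, and the difference is the desired commutator identity multiplied by `Z x`,
  -- which is nonzero.
  have j := jacobi_mlieBracket hX hY hfZ hU hx
  have j' := jacobi_mlieBracket hX hY hZ hU hx
  rw [second hX hY hYf, second hY hX hXf, mlieBracket_smul_right (hf' hx) (hZ' hx), j'] at j
  have k : (mvfderiv (𝓡 4) f x (mlieBracket (𝓡 4) X Y x) -
      (mvfderiv (𝓡 4) (fun y => mvfderiv (𝓡 4) f y (Y y)) x (X x)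
        - mvfderiv (𝓡 4) (fun y => mvfderiv (𝓡 4) f y (X y)) x (Y x))) • Z x = 0 := by
    rw [← sub_eq_zero] at j
    rw [← neg_eq_zero, ← j]
    module
  rcases smul_eq_zero.1 k with k | k
  · linarith
  · exact absurd k hZx

/-- The derivative of a smooth function along a smooth vector field is smooth, near a vector field
of constant norm `1`. -/
theorem LorentzianMetric.smoothFnOn_mvfderiv (g : LorentzianMetric M) (hf : SmoothFnOn f U)
    (hX : SmoothFieldOn X U) (hZ : SmoothFieldOn Z U) (hU : IsOpen U)
    (h1 : ∀ y ∈ U, g.inner y (Z y) (Z y) = 1) :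
    SmoothFnOn (fun y => mvfderiv (𝓡 4) f y (X y)) U := by
  -- `[X, fZ] - f [X, Z] = X(f) Z`, so pairing with the unit field `Z` recovers `X(f)` from smooth
  -- data.
  have hfZ : SmoothFieldOn (f • Z) U := ContMDiffOn.smul_section hf hZ
  have hb : SmoothFieldOn (mlieBracket (𝓡 4) X (f • Z) - f • mlieBracket (𝓡 4) X Z) U :=
    ContMDiffOn.sub_section (SmoothFieldOn.mlieBracket hX hfZ hU)
      (ContMDiffOn.smul_section hf (SmoothFieldOn.mlieBracket hX hZ hU))
  refine (g.smoothFnOn_pair hb hZ).congr fun y hy => ?_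
  rw [LorentzianMetric.pair, Pi.sub_apply, mlieBracket_smul_right
    (SmoothFnOn.mdifferentiableAt hf hU hy) (SmoothFieldOn.mdifferentiableAt hZ hU hy)]
  simp [h1 y hy]

end Local

end Manifold

/-! ### Smooth functions and vector fields over an orthonormal frame -/

section Manifold

variable {M : Type*} [TopologicalSpace M] [ChartedSpace (EuclideanSpace ℝ (Fin 4)) M]
  [IsManifold (𝓡 4) ∞ M]

/-- The algebra of functions which are smooth on a set. -/
def smoothOn (U : Set M) : Subalgebra ℝ (M → ℝ) where
  carrier := {f | SmoothFnOn f U}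
  mul_mem' hf hh := ContMDiffOn.mul hf hh
  add_mem' hf hh := ContMDiffOn.add hf hh
  algebraMap_mem' _ := contMDiffOn_const

/-- Evaluation at a point. -/
def evalAt (U : Set M) (x : M) : smoothOn U →ₐ[ℝ] ℝ :=
  (Pi.evalAlgHom ℝ (fun _ : M => ℝ) x).comp (smoothOn U).val

theorem evalAt_apply (U : Set M) (x : M) (f : smoothOn U) : evalAt U x f = f.1 x := rfl

/-- A function which is smooth on `U`, extended by zero. -/
def extendZero {U : Set M} (f : M → ℝ) (hf : SmoothFnOn f U) : smoothOn U :=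
  ⟨U.indicator f, ContMDiffOn.congr hf fun _ hy => Set.indicator_of_mem hy f⟩

theorem evalAt_extendZero {U : Set M} {f : M → ℝ} (hf : SmoothFnOn f U) {x : M} (hx : x ∈ U) :
    evalAt U x (extendZero f hf) = f x := Set.indicator_of_mem hx f

theorem evalAt_extendZero_of_notMem {U : Set M} {f : M → ℝ} (hf : SmoothFnOn f U) {x : M}
    (hx : x ∉ U) : evalAt U x (extendZero f hf) = 0 := Set.indicator_of_notMem hx f

/-- Elements of `smoothOn U` are functions on all of `M`, unconstrained off `U`, and equality
includes their values there. Extending components, brackets and derivatives by zero makes the laws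
of the calculus hold off `U` as well. -/
theorem smoothOn_ext {U : Set M} {f h : smoothOn U}
    (e : ∀ x, evalAt U x f = evalAt U x h) : f = h := Subtype.ext (funext e)

theorem mvfderiv_extendZero {U : Set M} (hU : IsOpen U) {f : M → ℝ} (hf : SmoothFnOn f U) {x : M}
    (hx : x ∈ U) : mvfderiv (𝓡 4) (extendZero f hf).1 x = mvfderiv (𝓡 4) f x :=
  mvfderiv_congr (Filter.eventuallyEq_of_mem (hU.mem_nhds hx)
    fun _ hy => Set.indicator_of_mem hy f)

/-- A smooth orthonormal frame on an open set. -/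
structure OrthoFrame (g : LorentzianMetric M) where
  dom : Set M
  isOpen_dom : IsOpen dom
  vec : Fin 4 → VField M
  smooth : ∀ μ, SmoothFieldOn (vec μ) dom
  orthonormal : ∀ x ∈ dom, ∀ μ ν, g.inner x (vec μ x) (vec ν x) = if μ = ν then eta μ else 0

namespace OrthoFrame

variable {g : LorentzianMetric M} (E : OrthoFrame g)

/-- Pairing a linear relation with each frame vector shows independence, as `η` is invertible; four
independent vectors span the four-dimensional tangent space. -/
theorem eq_sum {x : M} (hx : x ∈ E.dom) (v : TangentSpace (𝓡 4) x) :
    v = ∑ μ, (eta μ * g.inner x v (E.vec μ x)) • E.vec μ x := by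
  have ne (μ : Fin 4) : eta μ ≠ 0 := fun h => by simpa [h] using eta_mul_eta μ
  have li : LinearIndependent ℝ (fun μ => E.vec μ x) := by
    rw [Fintype.linearIndependent_iff]
    intro c hc ν
    have h := congrArg (fun w => g.inner x w (E.vec ν x)) hc
    simp only [map_sum, map_smul, _root_.sum_apply, _root_.smul_apply,
      E.orthonormal x hx, smul_eq_mul, mul_ite, mul_zero, Finset.sum_ite_eq', Finset.mem_univ,
      if_true, map_zero, _root_.zero_apply] at h
    exact (mul_eq_zero.1 h).resolve_right (ne ν)
  have hcard : Fintype.card (Fin 4) = Module.finrank ℝ (TangentSpace (𝓡 4) x) := by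
    change _ = Module.finrank ℝ (EuclideanSpace ℝ (Fin 4))
    simp
  have : FiniteDimensional ℝ (TangentSpace (𝓡 4) x) :=
    inferInstanceAs (FiniteDimensional ℝ (EuclideanSpace ℝ (Fin 4)))
  have hs := li.span_eq_top_of_card_eq_finrank' hcard
  have hv : v ∈ Submodule.span ℝ (Set.range fun μ => E.vec μ x) := hs ▸ Submodule.mem_top
  obtain ⟨c, rfl⟩ := (Submodule.mem_span_range_iff_exists_fun ℝ).1 hv
  refine Finset.sum_congr rfl fun ν _ => ?_
  congr 1
  simp only [map_sum, map_smul, _root_.sum_apply, _root_.smul_apply,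
    E.orthonormal x hx, smul_eq_mul, mul_ite, mul_zero, Finset.sum_ite_eq', Finset.mem_univ,
    if_true]
  linear_combination (-c ν) * eta_mul_eta ν

theorem ext_inner {x : M} (hx : x ∈ E.dom) {v w : TangentSpace (𝓡 4) x}
    (h : ∀ μ, g.inner x v (E.vec μ x) = g.inner x w (E.vec μ x)) : v = w := by
  rw [E.eq_sum hx v, E.eq_sum hx w]
  simp only [h]

/-- The vector field with given components. -/
def toField (v : Fin 4 → smoothOn E.dom) : VField M := fun x => ∑ μ, (v μ).1 x • E.vec μ x

theorem smoothFieldOn_toField (v : Fin 4 → smoothOn E.dom) :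
    SmoothFieldOn (E.toField v) E.dom := by
  refine ContMDiffOn.sum_section (t := fun μ => (v μ).1 • E.vec μ) fun μ _ => ?_
  exact ContMDiffOn.smul_section (v μ).2 (E.smooth μ)

theorem smoothFnOn_comp {X : VField M} (hX : SmoothFieldOn X E.dom) (μ : Fin 4) :
    SmoothFnOn (fun x => eta μ * g.inner x (X x) (E.vec μ x)) E.dom :=
  ContMDiffOn.mul (contMDiffOn_const (c := eta μ)) (g.smoothFnOn_pair hX (E.smooth μ))

/-- The components of a vector field. -/
def comps (X : VField M) (hX : SmoothFieldOn X E.dom) : Fin 4 → smoothOn E.dom :=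
  fun μ => extendZero _ (E.smoothFnOn_comp hX μ)

theorem evalAt_comps {X : VField M} (hX : SmoothFieldOn X E.dom) {x : M} (hx : x ∈ E.dom)
    (μ : Fin 4) : evalAt E.dom x (E.comps X hX μ) = eta μ * g.inner x (X x) (E.vec μ x) :=
  evalAt_extendZero _ hx

theorem toField_comps {X : VField M} (hX : SmoothFieldOn X E.dom) {x : M} (hx : x ∈ E.dom) :
    E.toField (E.comps X hX) x = X x := by
  conv_rhs => rw [E.eq_sum hx (X x)]
  refine Finset.sum_congr rfl fun μ _ => ?_
  rw [← E.evalAt_comps hX hx]; rfl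

theorem inner_toField (v : Fin 4 → smoothOn E.dom) {x : M} (hx : x ∈ E.dom) (μ : Fin 4) :
    g.inner x (E.toField v x) (E.vec μ x) = eta μ * evalAt E.dom x (v μ) := by
  simp only [toField, map_sum, map_smul, _root_.sum_apply,
    _root_.smul_apply, E.orthonormal x hx, smul_eq_mul, mul_ite, mul_zero,
    Finset.sum_ite_eq', Finset.mem_univ, if_true, mul_comm (eta μ)]
  rfl

theorem eta_inner_toField (v : Fin 4 → smoothOn E.dom) {x : M} (hx : x ∈ E.dom) (μ : Fin 4) :
    eta μ * g.inner x (E.toField v x) (E.vec μ x) = evalAt E.dom x (v μ) := by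
  rw [E.inner_toField v hx, ← mul_assoc, eta_mul_eta, one_mul]

theorem inner_vec_zero {x : M} (hx : x ∈ E.dom) : g.inner x (E.vec 0 x) (E.vec 0 x) = 1 := by
  rw [E.orthonormal x hx]; simp [eta]

theorem vec_zero_ne {x : M} (hx : x ∈ E.dom) : E.vec 0 x ≠ 0 := fun h => by
  simpa [h] using E.inner_vec_zero hx

theorem smoothFnOn_mvfderiv {f : M → ℝ} {X : VField M} (hf : SmoothFnOn f E.dom)
    (hX : SmoothFieldOn X E.dom) :
    SmoothFnOn (fun y => mvfderiv (𝓡 4) f y (X y)) E.dom :=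
  g.smoothFnOn_mvfderiv hf hX (E.smooth 0) E.isOpen_dom fun _ hy => E.inner_vec_zero hy

theorem mvfderiv_mlieBracket {f : M → ℝ} {X Y : VField M} (hf : SmoothFnOn f E.dom)
    (hX : SmoothFieldOn X E.dom) (hY : SmoothFieldOn Y E.dom) {x : M} (hx : x ∈ E.dom) :
    mvfderiv (𝓡 4) f x (mlieBracket (𝓡 4) X Y x) =
      mvfderiv (𝓡 4) (fun y => mvfderiv (𝓡 4) f y (Y y)) x (X x)
        - mvfderiv (𝓡 4) (fun y => mvfderiv (𝓡 4) f y (X y)) x (Y x) :=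
  mvfderiv_mlieBracket_of_ne_zero hf hX hY (E.smooth 0) E.isOpen_dom hx
    (E.smoothFnOn_mvfderiv hf hX) (E.smoothFnOn_mvfderiv hf hY) (E.vec_zero_ne hx)

/-- The derivative of functions along a vector field. -/
def derivation (v : Fin 4 → smoothOn E.dom) : Derivation ℝ (smoothOn E.dom) (smoothOn E.dom) :=
  Derivation.mk'
    { toFun f := extendZero _ (E.smoothFnOn_mvfderiv f.2 (E.smoothFieldOn_toField v))
      map_add' f h := by
        refine smoothOn_ext fun x => ?_
        by_cases hx : x ∈ E.dom
        · rw [map_add, evalAt_extendZero _ hx, evalAt_extendZero _ hx, evalAt_extendZero _ hx]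
          have := mvfderiv_add (SmoothFnOn.mdifferentiableAt f.2 E.isOpen_dom hx)
            (SmoothFnOn.mdifferentiableAt h.2 E.isOpen_dom hx)
          exact congrArg (fun L => L (E.toField v x)) this
        · rw [map_add, evalAt_extendZero_of_notMem _ hx, evalAt_extendZero_of_notMem _ hx,
            evalAt_extendZero_of_notMem _ hx, add_zero]
      map_smul' c f := by
        refine smoothOn_ext fun x => ?_
        by_cases hx : x ∈ E.dom
        · rw [map_smul, evalAt_extendZero _ hx, evalAt_extendZero _ hx]
          have := mvfderiv_mul (I := 𝓡 4) (f := fun _ : M => c) (g := f.1) (x := x)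
            mdifferentiableAt_const (SmoothFnOn.mdifferentiableAt f.2 E.isOpen_dom hx)
          have e := congrArg (fun L => L (E.toField v x)) this
          simp only [mvfderiv_const, smul_zero, add_zero] at e
          exact e
        · rw [map_smul, evalAt_extendZero_of_notMem _ hx, evalAt_extendZero_of_notMem _ hx,
            smul_zero] }
    (by
      intro f h
      refine smoothOn_ext fun x => ?_
      simp only [LinearMap.coe_mk, AddHom.coe_mk, map_add, smul_eq_mul, map_mul]
      by_cases hx : x ∈ E.dom
      · rw [evalAt_extendZero _ hx, evalAt_extendZero _ hx, evalAt_extendZero _ hx]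
        have := mvfderiv_mul (SmoothFnOn.mdifferentiableAt f.2 E.isOpen_dom hx)
          (SmoothFnOn.mdifferentiableAt h.2 E.isOpen_dom hx)
        exact congrArg (fun L => L (E.toField v x)) this
      · rw [evalAt_extendZero_of_notMem _ hx, evalAt_extendZero_of_notMem _ hx,
          evalAt_extendZero_of_notMem _ hx, mul_zero, mul_zero, add_zero])

theorem evalAt_derivation (v : Fin 4 → smoothOn E.dom) (f : smoothOn E.dom) {x : M}
    (hx : x ∈ E.dom) :
    evalAt E.dom x (E.derivation v f) = mvfderiv (𝓡 4) f.1 x (E.toField v x) :=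
  evalAt_extendZero (E.smoothFnOn_mvfderiv f.2 (E.smoothFieldOn_toField v)) hx

theorem evalAt_derivation_of_notMem (v : Fin 4 → smoothOn E.dom) (f : smoothOn E.dom) {x : M}
    (hx : x ∉ E.dom) : evalAt E.dom x (E.derivation v f) = 0 :=
  evalAt_extendZero_of_notMem (E.smoothFnOn_mvfderiv f.2 (E.smoothFieldOn_toField v)) hx

theorem toField_add (v w : Fin 4 → smoothOn E.dom) :
    E.toField (v + w) = E.toField v + E.toField w := by
  funext x
  simp only [toField, Pi.add_apply, ← Finset.sum_add_distrib, ← add_smul]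
  rfl

theorem toField_smul (f : smoothOn E.dom) (v : Fin 4 → smoothOn E.dom) :
    E.toField (f • v) = f.1 • E.toField v := by
  funext x
  change ∑ μ, (f.1 x * (v μ).1 x) • E.vec μ x = f.1 x • ∑ μ, (v μ).1 x • E.vec μ x
  simp only [Finset.smul_sum, smul_smul]

theorem comps_congr {X Y : VField M} (hX : SmoothFieldOn X E.dom) (hY : SmoothFieldOn Y E.dom)
    (h : ∀ x ∈ E.dom, X x = Y x) : E.comps X hX = E.comps Y hY := by
  funext μ
  refine smoothOn_ext fun x => ?_
  by_cases hx : x ∈ E.dom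
  · rw [E.evalAt_comps hX hx, E.evalAt_comps hY hx, h x hx]
  · exact (evalAt_extendZero_of_notMem _ hx).trans (evalAt_extendZero_of_notMem _ hx).symm

theorem comps_ext {X : VField M} (hX : SmoothFieldOn X E.dom) {v : Fin 4 → smoothOn E.dom}
    (h : ∀ x ∈ E.dom, ∀ μ, eta μ * g.inner x (X x) (E.vec μ x) = evalAt E.dom x (v μ))
    (h0 : ∀ x ∉ E.dom, ∀ μ, evalAt E.dom x (v μ) = 0) : E.comps X hX = v := by
  funext μ
  refine smoothOn_ext fun x => ?_
  by_cases hx : x ∈ E.dom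
  · rw [E.evalAt_comps hX hx, h x hx]
  · rw [h0 x hx]; exact evalAt_extendZero_of_notMem _ hx

theorem evalAt_comps_of_notMem {X : VField M} (hX : SmoothFieldOn X E.dom) {x : M}
    (hx : x ∉ E.dom) (μ : Fin 4) : evalAt E.dom x (E.comps X hX μ) = 0 :=
  evalAt_extendZero_of_notMem _ hx

/-- The components of the Lie bracket of the vector fields with given components. -/
def bracketComps (v w : Fin 4 → smoothOn E.dom) : Fin 4 → smoothOn E.dom :=
  E.comps (mlieBracket (𝓡 4) (E.toField v) (E.toField w))
    (SmoothFieldOn.mlieBracket (E.smoothFieldOn_toField v) (E.smoothFieldOn_toField w)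
      E.isOpen_dom)

theorem evalAt_bracketComps (v w : Fin 4 → smoothOn E.dom) {x : M} (hx : x ∈ E.dom)
    (μ : Fin 4) : evalAt E.dom x (E.bracketComps v w μ) =
      eta μ * g.inner x (mlieBracket (𝓡 4) (E.toField v) (E.toField w) x) (E.vec μ x) :=
  E.evalAt_comps _ hx μ

theorem evalAt_bracketComps_of_notMem (v w : Fin 4 → smoothOn E.dom) {x : M} (hx : x ∉ E.dom)
    (μ : Fin 4) : evalAt E.dom x (E.bracketComps v w μ) = 0 :=
  E.evalAt_comps_of_notMem _ hx μ

theorem toField_bracketComps (v w : Fin 4 → smoothOn E.dom) {x : M} (hx : x ∈ E.dom) :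
    E.toField (E.bracketComps v w) x =
      mlieBracket (𝓡 4) (E.toField v) (E.toField w) x := E.toField_comps _ hx

theorem mdifferentiableAt_toField (v : Fin 4 → smoothOn E.dom) {x : M} (hx : x ∈ E.dom) :
    MDifferentiableAt (𝓡 4) (𝓡 4).tangent
      (fun y => (⟨y, E.toField v y⟩ : TangentBundle (𝓡 4) M)) x :=
  SmoothFieldOn.mdifferentiableAt (E.smoothFieldOn_toField v) E.isOpen_dom hx

/-- The calculus of vector fields in an orthonormal frame. -/
def calculus : FrameCalculus (smoothOn E.dom) where
  der :=
    { toFun := E.derivation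
      map_add' v w := by
        ext f : 1
        refine smoothOn_ext fun x => ?_
        by_cases hx : x ∈ E.dom
        · rw [Derivation.add_apply, map_add, E.evalAt_derivation _ _ hx,
            E.evalAt_derivation _ _ hx, E.evalAt_derivation _ _ hx, toField_add, Pi.add_apply,
            map_add]
        · rw [Derivation.add_apply, map_add, E.evalAt_derivation_of_notMem _ _ hx,
            E.evalAt_derivation_of_notMem _ _ hx, E.evalAt_derivation_of_notMem _ _ hx, add_zero]
      map_smul' h v := by
        ext f : 1
        refine smoothOn_ext fun x => ?_
        simp only [RingHom.id_apply]
        by_cases hx : x ∈ E.dom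
        · rw [Derivation.smul_apply, smul_eq_mul, map_mul, E.evalAt_derivation _ _ hx,
            E.evalAt_derivation _ _ hx, toField_smul, Pi.smul_apply', map_smul]
          rfl
        · rw [Derivation.smul_apply, smul_eq_mul, map_mul, E.evalAt_derivation_of_notMem _ _ hx,
            E.evalAt_derivation_of_notMem _ _ hx, mul_zero] }
  bracket := E.bracketComps
  bracket_swap v w := by
    refine E.comps_ext _ (fun x hx μ => ?_) (fun x hx μ => ?_)
    · rw [Pi.neg_apply, map_neg, bracketComps, E.evalAt_comps _ hx, mlieBracket_swap_apply]
      simp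
    · rw [Pi.neg_apply, map_neg, bracketComps, E.evalAt_comps_of_notMem _ hx, neg_zero]
  bracket_add u v w := by
    refine E.comps_ext _ (fun x hx μ => ?_) (fun x hx μ => ?_)
    · rw [Pi.add_apply, map_add, bracketComps, bracketComps, E.evalAt_comps _ hx,
        E.evalAt_comps _ hx, toField_add, mlieBracket_add_right (E.mdifferentiableAt_toField _ hx)
        (E.mdifferentiableAt_toField _ hx), map_add, _root_.add_apply, mul_add]
    · rw [Pi.add_apply, map_add, bracketComps, bracketComps, E.evalAt_comps_of_notMem _ hx,
        E.evalAt_comps_of_notMem _ hx, zero_add]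
  bracket_smul v f w := by
    refine E.comps_ext _ (fun x hx μ => ?_) (fun x hx μ => ?_)
    · rw [toField_smul, mlieBracket_smul_right
        (SmoothFnOn.mdifferentiableAt f.2 E.isOpen_dom hx) (E.mdifferentiableAt_toField _ hx)]
      simp only [Pi.add_apply, Pi.smul_apply, smul_eq_mul, map_add, map_mul, LinearMap.coe_mk,
        AddHom.coe_mk, E.evalAt_derivation _ _ hx, map_smul, _root_.add_apply,
        _root_.smul_apply]
      rw [bracketComps, E.evalAt_comps _ hx, ← E.eta_inner_toField w hx μ, evalAt_apply]
      ring
    · simp only [Pi.add_apply, Pi.smul_apply, smul_eq_mul, map_add, map_mul, LinearMap.coe_mk,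
        AddHom.coe_mk, E.evalAt_derivation_of_notMem _ _ hx]
      rw [bracketComps, E.evalAt_comps_of_notMem _ hx]
      ring
  jacobi u v w := by
    refine E.comps_ext _ (fun x hx μ => ?_) (fun x hx μ => ?_)
    · rw [Pi.add_apply, map_add, E.evalAt_bracketComps _ _ hx, E.evalAt_bracketComps _ _ hx,
        ← mul_add, ← _root_.add_apply, ← map_add]
      congr 4
      rw [mlieBracket_congr_of_eqOn E.isOpen_dom hx (fun _ _ => rfl)
          (fun y hy => E.toField_bracketComps v w hy),
        mlieBracket_congr_of_eqOn E.isOpen_dom hx (fun y hy => E.toField_bracketComps u v hy)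
          (fun _ _ => rfl),
        mlieBracket_congr_of_eqOn E.isOpen_dom hx (fun _ _ => rfl)
          (fun y hy => E.toField_bracketComps u w hy)]
      exact jacobi_mlieBracket (E.smoothFieldOn_toField u) (E.smoothFieldOn_toField v)
        (E.smoothFieldOn_toField w) E.isOpen_dom hx
    · rw [Pi.add_apply, map_add, E.evalAt_bracketComps_of_notMem _ _ hx,
        E.evalAt_bracketComps_of_notMem _ _ hx, zero_add]
  der_bracket v w f := by
    refine smoothOn_ext fun x => ?_
    simp only [LinearMap.coe_mk, AddHom.coe_mk, map_sub]
    by_cases hx : x ∈ E.dom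
    · have second (v w : Fin 4 → smoothOn E.dom) :
          evalAt E.dom x (E.derivation v (E.derivation w f)) =
          mvfderiv (𝓡 4) (fun y => mvfderiv (𝓡 4) f.1 y (E.toField w y)) x (E.toField v x) := by
        rw [E.evalAt_derivation _ _ hx]
        exact congrArg (fun L => L (E.toField v x)) (mvfderiv_extendZero E.isOpen_dom
          (E.smoothFnOn_mvfderiv f.2 (E.smoothFieldOn_toField w)) hx)
      rw [second, second, E.evalAt_derivation _ _ hx, E.toField_bracketComps _ _ hx,
        E.mvfderiv_mlieBracket f.2 (E.smoothFieldOn_toField v) (E.smoothFieldOn_toField w) hx]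
    · rw [E.evalAt_derivation_of_notMem _ _ hx, E.evalAt_derivation_of_notMem _ _ hx,
        E.evalAt_derivation_of_notMem _ _ hx, sub_zero]

end OrthoFrame

end Manifold

/-! ### The covariant derivative in components and the Koszul formula -/

theorem mink_comm (v w : Fin 4 → ℝ) : mink v w = mink w v :=
  Finset.sum_congr rfl fun _ _ => by ring

theorem mink_add_left (u v w : Fin 4 → ℝ) : mink (u + v) w = mink u w + mink v w := by
  simp [mink, mul_add, add_mul, Finset.sum_add_distrib]

theorem mink_sub_left (u v w : Fin 4 → ℝ) : mink (u - v) w = mink u w - mink v w := by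
  simp [mink, mul_sub, sub_mul, Finset.sum_sub_distrib]

theorem mink_lowerApply {B : Fin 4 → Fin 4 → ℝ} (hB : IsSkew B) (v w : Fin 4 → ℝ) :
    mink (lowerApply B v) w = -mink v (lowerApply B w) := by
  have e (v w : Fin 4 → ℝ) : mink (lowerApply B v) w = ∑ μ, ∑ ν, B μ ν * v ν * w μ := by
    refine Finset.sum_congr rfl fun μ _ => ?_
    rw [lowerApply, ← mul_assoc, eta_mul_eta, one_mul, Finset.sum_mul]
  rw [mink_comm v, e, e, Finset.sum_comm, ← Finset.sum_neg_distrib]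
  refine Finset.sum_congr rfl fun μ _ => ?_
  rw [← Finset.sum_neg_distrib]
  refine Finset.sum_congr rfl fun ν _ => ?_
  rw [hB ν μ]; ring

namespace FrameCalculus

variable {A : Type*} [CommRing A] [Algebra ℝ A] (F : FrameCalculus A)

/-- The inner product of two vector fields. -/
def pairA (X Y : Fin 4 → A) : A := ∑ μ, eta μ • (X μ * Y μ)

theorem eval_pairA (ev : A →ₐ[ℝ] ℝ) (X Y : Fin 4 → A) :
    ev (pairA X Y) = mink (evalTuple ev X) (evalTuple ev Y) := by
  simp [pairA, mink, evalTuple, mul_assoc]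

/-- The covariant derivative `∇_Y X` at a point. -/
def nablaVec (ev : A →ₐ[ℝ] ℝ) (Y X : Fin 4 → A) : Fin 4 → ℝ :=
  evalTuple ev (F.along Y X) + lowerApply (fun μ ν => ev (F.conn Y μ ν)) (evalTuple ev X)

theorem nablaVec_torsion (ev : A →ₐ[ℝ] ℝ) (X Y : Fin 4 → A) :
    evalTuple ev (F.bracket X Y) = F.nablaVec ev X Y - F.nablaVec ev Y X := by
  funext μ
  have hl (ν : Fin 4) : ev (F.lie X μ ν) = -(eta μ * ev (F.der (basis ν) (X μ)))
      - ∑ ρ, ev (F.lie (basis ν) μ ρ) * ev (X ρ) := by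
    rw [lie, F.bracket_swap, Pi.neg_apply, smul_neg, F.bracket_apply, smul_add, smul_smul,
      eta_mul_eta, one_smul]
    simp only [map_neg, map_add, map_smul, map_sum, map_mul, smul_eq_mul]
    ring
  have t (ν ρ) : ev (F.lie (basis ν) μ ρ) =
      ev (F.christoffel ν μ ρ) - ev (F.christoffel ρ μ ν) := by
    rw [← F.christoffel_torsion, map_sub]
  rw [F.evalTuple_bracket]
  simp only [Pi.add_apply, Pi.sub_apply, nablaVec, lowerApply, hl, conn, map_sum, map_mul, t,
    sub_mul, Finset.sum_sub_distrib, neg_mul, Finset.sum_neg_distrib, Finset.sum_mul]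
  have e1 : evalTuple ev (F.along Y X) μ =
      ∑ ν, evalTuple ev Y ν * ev (F.der (basis ν) (X μ)) := by
    simp only [evalTuple, along, F.der_eq_sum Y, map_sum, map_mul]
  have e2 : ∑ ν, ∑ ρ, ev (F.christoffel ν μ ρ) * ev (X ρ) * evalTuple ev Y ν =
      ∑ ν, ∑ ρ, ev (Y ρ) * ev (F.christoffel ρ μ ν) * evalTuple ev X ν := by
    rw [Finset.sum_comm]
    exact Finset.sum_congr rfl fun ρ _ => Finset.sum_congr rfl fun ν _ => by
      simp only [evalTuple]; ring
  have e3 : ∑ ν, ∑ ρ, ev (F.christoffel ρ μ ν) * ev (X ρ) * evalTuple ev Y ν =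
      ∑ ν, ∑ ρ, ev (X ρ) * ev (F.christoffel ρ μ ν) * evalTuple ev Y ν :=
    Finset.sum_congr rfl fun ρ _ => Finset.sum_congr rfl fun ν _ => by ring
  have e4 : ∑ ν, eta μ * ev (F.der (basis ν) (X μ)) * evalTuple ev Y ν =
      eta μ * ∑ ν, evalTuple ev Y ν * ev (F.der (basis ν) (X μ)) := by
    rw [Finset.mul_sum]
    exact Finset.sum_congr rfl fun ν _ => by ring
  rw [e1, e2, e3, e4]
  linear_combination (-∑ ν, evalTuple ev Y ν * ev (F.der (basis ν) (X μ))) * eta_mul_eta μ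

theorem nablaVec_metric (ev : A →ₐ[ℝ] ℝ) (X Y Z : Fin 4 → A) :
    ev (F.der X (pairA Y Z)) =
      mink (F.nablaVec ev X Y) (evalTuple ev Z) + mink (F.nablaVec ev X Z) (evalTuple ev Y) := by
  rw [nablaVec, nablaVec, mink_add_left, mink_add_left, mink_lowerApply (F.eval_isSkew_conn ev X),
    mink_comm (evalTuple ev Y)]
  simp only [pairA, map_sum, Derivation.map_smul, Derivation.leibniz, map_smul, map_add, map_mul,
    smul_eq_mul, mul_add, Finset.sum_add_distrib, mink]
  simp only [evalTuple, along, mul_assoc]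
  rw [add_comm]
  simp only [mul_comm (ev (F.der X _)), mul_left_comm (ev (F.der X _))]
  ring

/-- Metric compatibility and vanishing torsion make the Koszul expression collapse. This identifies
the geometric `nablaPair` with the connection given by the frame coefficients. -/
theorem koszul (ev : A →ₐ[ℝ] ℝ) (X Y Z : Fin 4 → A) :
    (1 / 2 : ℝ) * (ev (F.der Y (pairA X Z)) + ev (F.der X (pairA Y Z)) - ev (F.der Z (pairA Y X))
      + mink (evalTuple ev (F.bracket Y X)) (evalTuple ev Z)
      - mink (evalTuple ev (F.bracket Y Z)) (evalTuple ev X)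
      - mink (evalTuple ev (F.bracket X Z)) (evalTuple ev Y)) =
    mink (F.nablaVec ev Y X) (evalTuple ev Z) := by
  simp only [nablaVec_metric, nablaVec_torsion, mink_sub_left]
  ring

end FrameCalculus

/-! ### Geometric brackets and covariant derivatives in frame components -/

section Manifold

variable {M : Type*} [TopologicalSpace M] [ChartedSpace (EuclideanSpace ℝ (Fin 4)) M]
  [IsManifold (𝓡 4) ∞ M]

namespace OrthoFrame

open FrameCalculus

variable {g : LorentzianMetric M} (E : OrthoFrame g) {X Y Z : VField M}

theorem evalTuple_comps (hX : SmoothFieldOn X E.dom) {x : M} (hx : x ∈ E.dom) :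
    evalTuple (evalAt E.dom x) (E.comps X hX) =
      fun μ => eta μ * g.inner x (X x) (E.vec μ x) :=
  funext fun μ => E.evalAt_comps hX hx μ

theorem inner_eq_mink {x : M} (hx : x ∈ E.dom) (v w : TangentSpace (𝓡 4) x) :
    g.inner x v w = mink (fun μ => eta μ * g.inner x v (E.vec μ x))
      (fun μ => eta μ * g.inner x w (E.vec μ x)) := by
  conv_lhs => rw [E.eq_sum hx v]
  simp only [map_sum, map_smul, _root_.sum_apply, _root_.smul_apply,
    smul_eq_mul, mink]
  refine Finset.sum_congr rfl fun μ _ => ?_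
  rw [g.symm x (E.vec μ x) w]
  linear_combination (-(eta μ * g.inner x v (E.vec μ x) * g.inner x w (E.vec μ x))) *
    eta_mul_eta μ

theorem pair_eq_mink (hX : SmoothFieldOn X E.dom) (hY : SmoothFieldOn Y E.dom) {x : M}
    (hx : x ∈ E.dom) : g.pair X Y x = mink (evalTuple (evalAt E.dom x) (E.comps X hX))
      (evalTuple (evalAt E.dom x) (E.comps Y hY)) := by
  rw [E.evalTuple_comps hX hx, E.evalTuple_comps hY hx]
  exact E.inner_eq_mink hx _ _

theorem evalAt_der {x : M} (hx : x ∈ E.dom) (hX : SmoothFieldOn X E.dom) (f : smoothOn E.dom) :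
    evalAt E.dom x (E.calculus.der (E.comps X hX) f) = mvfderiv (𝓡 4) f.1 x (X x) := by
  have := E.evalAt_derivation (E.comps X hX) f hx
  rw [E.toField_comps hX hx] at this
  exact this

theorem mvfderiv_pair (hX : SmoothFieldOn X E.dom) (hY : SmoothFieldOn Y E.dom)
    (hZ : SmoothFieldOn Z E.dom) {x : M} (hx : x ∈ E.dom) :
    mvfderiv (𝓡 4) (g.pair X Z) x (Y x) =
      evalAt E.dom x (E.calculus.der (E.comps Y hY) (pairA (E.comps X hX) (E.comps Z hZ))) := by
  rw [E.evalAt_der hx]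
  congr 1
  refine mvfderiv_congr (Filter.eventuallyEq_of_mem (E.isOpen_dom.mem_nhds hx) fun y hy => ?_)
  rw [E.pair_eq_mink hX hZ hy, ← eval_pairA]
  rfl

theorem comps_mlieBracket (hX : SmoothFieldOn X E.dom) (hY : SmoothFieldOn Y E.dom) :
    E.comps (mlieBracket (𝓡 4) X Y) (SmoothFieldOn.mlieBracket hX hY E.isOpen_dom) =
      E.calculus.bracket (E.comps X hX) (E.comps Y hY) :=
  E.comps_congr _ (SmoothFieldOn.mlieBracket (E.smoothFieldOn_toField _)
    (E.smoothFieldOn_toField _) E.isOpen_dom) fun _ hx => mlieBracket_congr_of_eqOn E.isOpen_dom hx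
    (fun _ hy => (E.toField_comps hX hy).symm) (fun _ hy => (E.toField_comps hY hy).symm)

/-- The Koszul formula in an orthonormal frame. -/
theorem nablaPair_eq (hX : SmoothFieldOn X E.dom) (hY : SmoothFieldOn Y E.dom)
    (hZ : SmoothFieldOn Z E.dom) {x : M} (hx : x ∈ E.dom) :
    g.nablaPair Y X Z x =
      mink (E.calculus.nablaVec (evalAt E.dom x) (E.comps Y hY) (E.comps X hX))
        (evalTuple (evalAt E.dom x) (E.comps Z hZ)) := by
  rw [← koszul, LorentzianMetric.nablaPair, E.mvfderiv_pair hX hY hZ hx,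
    E.mvfderiv_pair hY hX hZ hx, E.mvfderiv_pair hY hZ hX hx,
    E.pair_eq_mink (SmoothFieldOn.mlieBracket hY hX E.isOpen_dom) hZ hx,
    E.pair_eq_mink (SmoothFieldOn.mlieBracket hY hZ E.isOpen_dom) hX hx,
    E.pair_eq_mink (SmoothFieldOn.mlieBracket hX hZ E.isOpen_dom) hY hx]
  rw [E.comps_mlieBracket hY hX, E.comps_mlieBracket hY hZ, E.comps_mlieBracket hX hZ]

theorem evalAt_comps_vec (μ : Fin 4) {x : M} (hx : x ∈ E.dom) :
    evalTuple (evalAt E.dom x) (E.comps (E.vec μ) (E.smooth μ)) = Pi.single μ 1 := by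
  rw [E.evalTuple_comps _ hx]
  funext ν
  rw [E.orthonormal x hx, Pi.single_apply]
  by_cases h : μ = ν
  · subst h; simp [eta_mul_eta]
  · simp [h, Ne.symm h]

theorem toField_basis (μ : Fin 4) : E.toField (basis μ) = E.vec μ := by
  funext x
  rw [toField, Finset.sum_eq_single μ]
  · rw [basis, Pi.single_eq_same]
    change (1 : ℝ) • _ = _
    rw [one_smul]
  · intro ν _ h
    rw [basis, Pi.single_eq_of_ne h]
    change (0 : ℝ) • _ = _
    rw [zero_smul]
  · simp

theorem evalAt_lie (hX : SmoothFieldOn X E.dom) {x : M} (hx : x ∈ E.dom) (μ ν : Fin 4) :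
    evalAt E.dom x (E.calculus.lie (E.comps X hX) μ ν) =
      g.inner x (mlieBracket (𝓡 4) X (E.vec ν) x) (E.vec μ x) := by
  rw [lie, map_smul, smul_eq_mul]
  change eta μ * evalAt E.dom x (E.bracketComps (E.comps X hX) (basis ν) μ) = _
  rw [E.evalAt_bracketComps _ _ hx, toField_basis, ← mul_assoc, eta_mul_eta, one_mul,
    mlieBracket_congr_of_eqOn E.isOpen_dom hx (fun _ hy => E.toField_comps hX hy)
      (fun _ _ => rfl)]

/-- The components of `e_ν` in its own frame are constant near `x`, so only the connection matrix
contributes to `∇_Y e_ν`. -/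
theorem evalAt_conn (hY : SmoothFieldOn Y E.dom) {x : M} (hx : x ∈ E.dom) (μ ν : Fin 4) :
    evalAt E.dom x (E.calculus.conn (E.comps Y hY) μ ν) =
      g.nablaPair Y (E.vec ν) (E.vec μ) x := by
  rw [E.nablaPair_eq (E.smooth ν) hY (E.smooth μ) hx, E.evalAt_comps_vec μ hx, nablaVec,
    E.evalAt_comps_vec ν hx, mink_add_left]
  have e : evalTuple (evalAt E.dom x) (E.calculus.along (E.comps Y hY)
      (E.comps (E.vec ν) (E.smooth ν))) = 0 := by
    funext ρ
    rw [evalTuple, along, E.evalAt_der hx]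
    have : mvfderiv (𝓡 4) (E.comps (E.vec ν) (E.smooth ν) ρ).1 x =
        mvfderiv (𝓡 4) (fun _ => (Pi.single ν 1 : Fin 4 → ℝ) ρ) x :=
      mvfderiv_congr (Filter.eventuallyEq_of_mem (E.isOpen_dom.mem_nhds hx)
        fun y hy => congrFun (E.evalAt_comps_vec ν hy) ρ)
    rw [this, mvfderiv_const]; rfl
  rw [e]
  simp [mink, lowerApply, Pi.single_apply, ← mul_assoc, eta_mul_eta]

end OrthoFrame

end Manifold

/-! ## Gauge covariance -/

namespace SpinorPairing

variable (C : SpinorPairing)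

theorem form_single_ne_zero : C.form (Pi.single 1 1) (Pi.single 0 1) ≠ 0 := by
  intro h
  have h0 : ∀ s t, C.form s t = 0 := fun s t => by rw [C.form_eq, h, zero_mul]
  have := C.nondegenerate.1 (Pi.single 0 1) (fun t => h0 _ t)
  simpa using congrFun this 0

/-- `star` negates vectors and reverses products, exactly as taking adjoints does for a pairing with
skew Clifford multiplication. As `star h * h = 1` in the spin group, the pairing is spin invariant.
-/
theorem form_spinRep_star (x : CliffordAlgebra cliffordForm) :
    ∀ s t : Spinor, C.form (spinRep (star x) *ᵥ s) t = C.form s (spinRep x *ᵥ t) := by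
  induction x using CliffordAlgebra.induction with
  | algebraMap r =>
    intro s t
    rw [CliffordAlgebra.star_algebraMap, AlgHom.commutes, Algebra.algebraMap_eq_smul_one]
    simp [Matrix.smul_mulVec]
  | ι v =>
    intro s t
    rw [CliffordAlgebra.star_ι, map_neg, spinRep, CliffordAlgebra.lift_ι_apply,
      Matrix.neg_mulVec, map_neg, LinearMap.neg_apply, C.skew, neg_neg]
  | mul x y hx hy =>
    intro s t
    rw [star_mul, map_mul, map_mul, ← Matrix.mulVec_mulVec, ← Matrix.mulVec_mulVec, hy, hx]
  | add x y hx hy =>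
    intro s t
    rw [star_add, map_add, map_add, Matrix.add_mulVec, Matrix.add_mulVec, map_add, map_add,
      LinearMap.add_apply, hx, hy]

end SpinorPairing

theorem spinRep_ι (v : Fin 4 → ℝ) : spinRep (CliffordAlgebra.ι cliffordForm v) = slash v := by
  rw [spinRep, CliffordAlgebra.lift_ι_apply]

/-- The matrix of an element of the spin group. -/
def spinMat (h : spinGroup cliffordForm) : Matrix (Fin 4) (Fin 4) ℝ :=
  spinRep (h : CliffordAlgebra cliffordForm)

theorem spinAction_apply (h : spinGroup cliffordForm) (s : Spinor) :
    spinAction h s = spinMat h *ᵥ s := rfl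

theorem spinMat_inv_mul (h : spinGroup cliffordForm) :
    spinRep (star (h : CliffordAlgebra cliffordForm)) * spinMat h = 1 := by
  rw [spinMat, ← map_mul, spinGroup.star_mul_self_of_mem h.2, map_one]

theorem spinMat_mul_inv (h : spinGroup cliffordForm) :
    spinMat h * spinRep (star (h : CliffordAlgebra cliffordForm)) = 1 := by
  rw [spinMat, ← map_mul, spinGroup.mul_star_self_of_mem h.2, map_one]

theorem SpinorPairing.form_spinMat (C : SpinorPairing) (h : spinGroup cliffordForm)
    (s t : Spinor) : C.form (spinMat h *ᵥ s) (spinMat h *ᵥ t) = C.form s t := by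
  rw [spinMat, ← C.form_spinRep_star, Matrix.mulVec_mulVec, ← spinMat, spinMat_inv_mul,
    Matrix.one_mulVec]

/-- Uniqueness of the lift of a connection matrix to spinors. Here `h'` plays the derivative of `h`,
`hL'` and `hC` differentiate the vector-covering relation and the invariance of the form, and `hT`
is the gauge transformation law on vectors. The error `P` differs from a scalar only by the
invertible factor `h`; the form excludes a nonzero scalar. -/
theorem spinMat_gauge (C : SpinorPairing) (h : spinGroup cliffordForm)
    {h' : Matrix (Fin 4) (Fin 4) ℝ} {L L' Θ Θ' : Fin 4 → Fin 4 → ℝ}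
    (hΘ : IsSkew Θ) (hΘ' : IsSkew Θ')
    (hL : ∀ ν, spinMat h * gam ν = slash (L ν) * spinMat h)
    (hL' : ∀ ν, h' * gam ν = slash (L' ν) * spinMat h + slash (L ν) * h')
    (hC : ∀ s t, C.form (h' *ᵥ s) (spinMat h *ᵥ t) + C.form (spinMat h *ᵥ s) (h' *ᵥ t) = 0)
    (hT : ∀ ν, L' ν + lowerApply Θ' (L ν) = ∑ ρ, (eta ρ * Θ ρ ν) • L ρ) :
    h' + spinSigma Θ' * spinMat h = spinMat h * spinSigma Θ := by
  obtain ⟨P, hP⟩ : ∃ P, P = h' + spinSigma Θ' * spinMat h - spinMat h * spinSigma Θ := ⟨_, rfl⟩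
  obtain ⟨k, hk⟩ : ∃ k, k = spinRep (star (h : CliffordAlgebra cliffordForm)) := ⟨_, rfl⟩
  have k1 := spinMat_inv_mul h
  have k2 := spinMat_mul_inv h
  rw [← hk] at k1 k2
  -- The transformation law on vectors gives `P` the same intertwining relation as `h`, so `h⁻¹ P`
  -- commutes with all gamma matrices.
  have hPg (ν : Fin 4) : P * gam ν = slash (L ν) * P := by
    have e1 := congrArg (· * spinMat h) (spinSigma_slash hΘ' (L ν))
    have e2 := congrArg (spinMat h * ·) (spinSigma_slash hΘ (Pi.single ν 1))
    have e3 : slash (lowerApply Θ (Pi.single ν 1)) = ∑ ρ, (eta ρ * Θ ρ ν) • gam ρ := by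
      rw [slash_eq_sum]
      simp [lowerApply, Pi.single_apply]
    have e4 : spinMat h * ∑ ρ, (eta ρ * Θ ρ ν) • gam ρ =
        slash (L' ν + lowerApply Θ' (L ν)) * spinMat h := by
      rw [hT, map_sum, Finset.mul_sum, Finset.sum_mul]
      refine Finset.sum_congr rfl fun ρ _ => ?_
      rw [mul_smul_comm, hL, map_smul, smul_mul_assoc]
    simp only [slash_single] at e2
    rw [e3] at e2
    simp only [add_mul, mul_add, map_add, ← mul_assoc, e4] at e1 e2
    rw [hL] at e2
    rw [hP, sub_mul, add_mul, hL', mul_assoc (spinSigma Θ'), hL, ← mul_assoc (spinSigma Θ'), e1,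
      e2]
    simp only [mul_sub, mul_add, ← mul_assoc]
    abel
  have hcomm (ν : Fin 4) : k * P * gam ν = gam ν * (k * P) := by
    have e : k * slash (L ν) = gam ν * k := by
      calc k * slash (L ν) = k * (slash (L ν) * spinMat h) * k := by
            rw [mul_assoc, mul_assoc, k2, mul_one]
        _ = gam ν * k := by rw [← hL, ← mul_assoc, k1, one_mul]
    rw [mul_assoc, hPg, ← mul_assoc, e, mul_assoc]
  have hs := eq_smul_one_of_commute hcomm
  obtain ⟨c, hc⟩ : ∃ c, c = (k * P) 0 0 := ⟨_, rfl⟩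
  rw [← hc] at hs
  have hPc : P = c • spinMat h := by
    calc P = spinMat h * (k * P) := by rw [← mul_assoc, k2, one_mul]
      _ = c • spinMat h := by rw [hs, mul_smul_comm, mul_one]
  have hh' : h' = c • spinMat h - spinSigma Θ' * spinMat h + spinMat h * spinSigma Θ := by
    rw [← hPc, hP]; abel
  -- The `σ` terms preserve the pairing infinitesimally, so substituting `h'` into `hC` leaves `2 c
  -- ⟨s, t⟩ = 0` for a pair of spinors with nonzero pairing.
  have hc0 : c = 0 := by
    have e := hC (Pi.single 1 1) (Pi.single 0 1)
    rw [hh'] at e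
    simp only [Matrix.add_mulVec, Matrix.sub_mulVec, Matrix.smul_mulVec, ← Matrix.mulVec_mulVec,
      map_add, map_sub, map_smul, LinearMap.add_apply, LinearMap.sub_apply, LinearMap.smul_apply,
      C.form_spinMat, C.form_spinSigma hΘ, C.form_spinSigma hΘ', smul_eq_mul] at e
    have : 2 * c * C.form (Pi.single 1 1) (Pi.single 0 1) = 0 := by linarith
    rcases mul_eq_zero.1 this with h0 | h0
    · linarith
    · exact absurd h0 C.form_single_ne_zero
  rw [hh', hc0]
  simp

/-! ### Derivations of matrix products and of the pairing -/

section

variable {A : Type*} [CommRing A] [Algebra ℝ A]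

theorem derivation_mul (D : Derivation ℝ A A) (P Q : Matrix (Fin 4) (Fin 4) A) :
    (P * Q).map D = P.map D * Q + P * Q.map D := by
  ext i j
  simp only [Matrix.map_apply, Matrix.mul_apply, map_sum, Derivation.leibniz, smul_eq_mul,
    Matrix.add_apply, Finset.sum_add_distrib]
  rw [add_comm]
  congr 1
  exact Finset.sum_congr rfl fun _ _ => mul_comm _ _

/-- The spinor pairing with coefficients in an algebra of functions. -/
def formA (C : SpinorPairing) (s t : Fin 4 → A) : A :=
  ∑ i, ∑ j, C.form (Pi.single i 1) (Pi.single j 1) • (s i * t j)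

theorem eval_formA (ev : A →ₐ[ℝ] ℝ) (C : SpinorPairing) (s t : Fin 4 → A) :
    ev (formA C s t) = C.form (evalTuple ev s) (evalTuple ev t) := by
  have h (s : Spinor) : s = ∑ i, s i • (Pi.single i 1 : Spinor) := by
    ext j; simp [Finset.sum_apply, Pi.single_apply]
  conv_rhs => rw [h (evalTuple ev s), h (evalTuple ev t)]
  simp only [formA, map_sum, LinearMap.sum_apply, map_smul, LinearMap.smul_apply, smul_eq_mul,
    Finset.mul_sum, map_mul, evalTuple]
  rw [Finset.sum_comm]
  exact Finset.sum_congr rfl fun i _ => Finset.sum_congr rfl fun j _ => by ring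

theorem derivation_formA (D : Derivation ℝ A A) (C : SpinorPairing) (s t : Fin 4 → A) :
    D (formA C s t) = formA C (fun i => D (s i)) t + formA C s (fun i => D (t i)) := by
  simp only [formA, map_sum, Derivation.map_smul, Derivation.leibniz, smul_eq_mul, smul_add,
    Finset.sum_add_distrib]
  rw [add_comm]
  congr 1
  exact Finset.sum_congr rfl fun i _ => Finset.sum_congr rfl fun j _ => by rw [mul_comm]

end

/-! ### Covariance under changes of orthonormal frame lifted to the spin group -/

section Manifold

variable {M : Type*} [TopologicalSpace M] [ChartedSpace (EuclideanSpace ℝ (Fin 4)) M]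
  [IsManifold (𝓡 4) ∞ M]

open FrameCalculus

variable {g : LorentzianMetric M}

/-- A change of orthonormal frame, from `e` to the frame of `E`, lifted to the spin group. -/
structure SpinGauge (E : OrthoFrame g) where
  vec : Fin 4 → VField M
  smooth : ∀ μ, SmoothFieldOn (vec μ) E.dom
  orthonormal : ∀ x ∈ E.dom, ∀ μ ν, g.inner x (vec μ x) (vec ν x) = if μ = ν then eta μ else 0
  lift : M → spinGroup cliffordForm
  smooth_lift : ∀ i j, SmoothFnOn (fun y => spinMat (lift y) i j) E.dom
  lift_slash : ∀ x ∈ E.dom, ∀ ν, spinMat (lift x) * gam ν =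
    slash (fun μ => eta μ * g.inner x (vec ν x) (E.vec μ x)) * spinMat (lift x)

namespace SpinGauge

variable {E : OrthoFrame g} (G : SpinGauge E) {X : VField M}

/-- The initial frame. -/
def source : OrthoFrame g := ⟨E.dom, E.isOpen_dom, G.vec, G.smooth, G.orthonormal⟩

/-- The matrix of the change of frame on spinors. -/
def mat : Matrix (Fin 4) (Fin 4) (smoothOn E.dom) := fun i j => extendZero _ (G.smooth_lift i j)

theorem eval_mat {x : M} (hx : x ∈ E.dom) : G.mat.map (evalAt E.dom x) = spinMat (G.lift x) := by
  ext i j; exact evalAt_extendZero (G.smooth_lift i j) hx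

theorem eval_mat_of_notMem {x : M} (hx : x ∉ E.dom) : G.mat.map (evalAt E.dom x) = 0 := by
  ext i j; exact evalAt_extendZero_of_notMem (G.smooth_lift i j) hx

/-- The components of the initial frame. -/
def coeff (ν : Fin 4) : Fin 4 → smoothOn E.dom := E.comps (G.vec ν) (G.smooth ν)

/-- The lifting relation is put into the function algebra so that it can be differentiated; off the
domain both sides vanish. -/
theorem mat_mul_gam (ν : Fin 4) :
    G.mat * (gam ν).map (algebraMap ℝ (smoothOn E.dom)) = combine gam (G.coeff ν) * G.mat := by
  refine Matrix.ext fun i j => smoothOn_ext (U := E.dom) fun x => ?_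
  have h (P Q : Matrix (Fin 4) (Fin 4) (smoothOn E.dom)) :
      evalAt E.dom x ((P * Q) i j) = (P.map (evalAt E.dom x) * Q.map (evalAt E.dom x)) i j := by
    simp [Matrix.mul_apply]
  rw [h, h]
  by_cases hx : x ∈ E.dom
  · rw [G.eval_mat hx, eval_combine]
    have e : ((gam ν).map (algebraMap ℝ (smoothOn E.dom))).map (evalAt E.dom x) = gam ν := by
      ext i j; simp
    have e' : ∑ k, evalAt E.dom x (G.coeff ν k) • gam k =
        slash (fun μ => eta μ * g.inner x (G.vec ν x) (E.vec μ x)) := by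
      rw [slash_eq_sum]
      exact Finset.sum_congr rfl fun k _ => by rw [coeff, E.evalAt_comps _ hx]
    rw [e, e', G.lift_slash x hx]
  · rw [G.eval_mat_of_notMem hx]; simp

/-- The derivative of the change of frame. -/
def dmat (hX : SmoothFieldOn X E.dom) (x : M) : Matrix (Fin 4) (Fin 4) ℝ :=
  (G.mat.map (E.calculus.der (E.comps X hX))).map (evalAt E.dom x)

theorem dmat_mul_gam (hX : SmoothFieldOn X E.dom) {x : M} (hx : x ∈ E.dom) (ν : Fin 4) :
    G.dmat hX x * gam ν =
      slash (evalTuple (evalAt E.dom x) (E.calculus.along (E.comps X hX) (G.coeff ν))) *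
        spinMat (G.lift x)
      + slash (evalTuple (evalAt E.dom x) (G.coeff ν)) * G.dmat hX x := by
  have h := congrArg (fun P => (P.map (E.calculus.der (E.comps X hX))).map (evalAt E.dom x))
    (G.mat_mul_gam ν)
  simp only [derivation_mul, derivation_combine] at h
  have hm (P Q : Matrix (Fin 4) (Fin 4) (smoothOn E.dom)) :
      (P * Q).map (evalAt E.dom x) = P.map (evalAt E.dom x) * Q.map (evalAt E.dom x) := by
    ext; simp [Matrix.mul_apply]
  have ha (P Q : Matrix (Fin 4) (Fin 4) (smoothOn E.dom)) :
      (P + Q).map (evalAt E.dom x) = P.map (evalAt E.dom x) + Q.map (evalAt E.dom x) := by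
    ext; simp
  have e : ((gam ν).map (algebraMap ℝ (smoothOn E.dom))).map (evalAt E.dom x) = gam ν := by
    ext i j; simp
  have e' : ((gam ν).map (algebraMap ℝ (smoothOn E.dom))).map (E.calculus.der (E.comps X hX)) =
      0 := by
    ext i j : 2
    simp only [Matrix.map_apply, Derivation.map_algebraMap, Matrix.zero_apply]
  rw [e', mul_zero, add_zero, ha, hm, hm, hm, e, eval_combine, eval_combine, G.eval_mat hx] at h
  rw [slash_eq_sum, slash_eq_sum]
  exact h

/-- Differentiate `⟨h s, h t⟩ = ⟨s, t⟩` for constant spinors `s`, `t`. -/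
theorem form_dmat (C : SpinorPairing) (hX : SmoothFieldOn X E.dom) {x : M} (hx : x ∈ E.dom)
    (s t : Spinor) : C.form (G.dmat hX x *ᵥ s) (spinMat (G.lift x) *ᵥ t)
      + C.form (spinMat (G.lift x) *ᵥ s) (G.dmat hX x *ᵥ t) = 0 := by
  let k (s : Spinor) : Fin 4 → smoothOn E.dom := fun i => algebraMap ℝ _ (s i)
  have hk (s : Spinor) (y : M) : evalTuple (evalAt E.dom y) (k s) = s := by
    funext i; simp [k, evalTuple]
  have hd (s : Spinor) : evalTuple (evalAt E.dom x)
      (fun i => E.calculus.der (E.comps X hX) ((G.mat *ᵥ k s) i)) = G.dmat hX x *ᵥ s := by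
    rw [derivation_mulVec]
    have e : (fun i => E.calculus.der (E.comps X hX) (k s i)) = 0 := by
      funext i; exact Derivation.map_algebraMap _ _
    rw [e, Matrix.mulVec_zero, add_zero, evalTuple_mulVec, hk]
    rfl
  have hm (s : Spinor) {y : M} (hy : y ∈ E.dom) :
      evalTuple (evalAt E.dom y) (G.mat *ᵥ k s) = spinMat (G.lift y) *ᵥ s := by
    rw [evalTuple_mulVec, hk, G.eval_mat hy]
  have h := congrArg (evalAt E.dom x)
    (derivation_formA (E.calculus.der (E.comps X hX)) C (G.mat *ᵥ k s) (G.mat *ᵥ k t))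
  rw [map_add, eval_formA, eval_formA, hd, hd, hm s hx, hm t hx, E.evalAt_der hx] at h
  rw [← h]
  have e : mvfderiv (𝓡 4) (formA C (G.mat *ᵥ k s) (G.mat *ᵥ k t)).1 x =
      mvfderiv (𝓡 4) (fun _ => C.form s t) x :=
    mvfderiv_congr (Filter.eventuallyEq_of_mem (E.isOpen_dom.mem_nhds hx) fun y hy => by
      rw [← evalAt_apply, eval_formA, hm s hy, hm t hy, C.form_spinMat])
  rw [e, mvfderiv_const]; rfl

/-- Covariance of `∂_X + σ(Θ)` under a change of frame. -/
theorem covariant (C : SpinorPairing) (hX : SmoothFieldOn X E.dom) {x : M} (hx : x ∈ E.dom)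
    {Θ Θ' : Fin 4 → Fin 4 → ℝ} (hΘ : IsSkew Θ) (hΘ' : IsSkew Θ')
    (hT : ∀ ν, evalTuple (evalAt E.dom x) (E.calculus.along (E.comps X hX) (G.coeff ν))
      + lowerApply Θ' (evalTuple (evalAt E.dom x) (G.coeff ν)) =
      ∑ ρ, (eta ρ * Θ ρ ν) • evalTuple (evalAt E.dom x) (G.coeff ρ))
    {ψ ψ' : M → Spinor} (hψ : ∀ i, SmoothFnOn (fun y => ψ y i) E.dom)
    (h : ∀ y ∈ E.dom, ψ' y = spinMat (G.lift y) *ᵥ ψ y) :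
    (fun i => mvfderiv (𝓡 4) (fun y => ψ' y i) x (X x)) + spinSigma Θ' *ᵥ ψ' x =
      spinMat (G.lift x) *ᵥ ((fun i => mvfderiv (𝓡 4) (fun y => ψ y i) x (X x))
        + spinSigma Θ *ᵥ ψ x) := by
  have hg := spinMat_gauge C (G.lift x) (L := fun ν => evalTuple (evalAt E.dom x) (G.coeff ν))
    hΘ hΘ' (fun ν => by
      rw [G.lift_slash x hx]; simp only [coeff]; rw [E.evalTuple_comps _ hx])
    (G.dmat_mul_gam hX hx) (G.form_dmat C hX hx) hT
  let s : Fin 4 → smoothOn E.dom := fun i => extendZero _ (hψ i)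
  have hs {y : M} (hy : y ∈ E.dom) : evalTuple (evalAt E.dom y) s = ψ y := by
    funext i; exact evalAt_extendZero (hψ i) hy
  have e1 : (fun i => mvfderiv (𝓡 4) (fun y => ψ' y i) x (X x)) =
      evalTuple (evalAt E.dom x) (E.calculus.along (E.comps X hX) (G.mat *ᵥ s)) := by
    funext i
    rw [evalTuple, along, E.evalAt_der hx]
    congr 1
    refine mvfderiv_congr (Filter.eventuallyEq_of_mem (E.isOpen_dom.mem_nhds hx) fun y hy => ?_)
    change ψ' y i = evalTuple (evalAt E.dom y) (G.mat *ᵥ s) i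
    rw [h y hy, evalTuple_mulVec, G.eval_mat hy, hs hy]
  have e2 : (fun i => mvfderiv (𝓡 4) (fun y => ψ y i) x (X x)) =
      evalTuple (evalAt E.dom x) (E.calculus.along (E.comps X hX) s) := by
    funext i
    rw [evalTuple, along, E.evalAt_der hx, mvfderiv_extendZero E.isOpen_dom (hψ i) hx]
  rw [e1, e2, E.calculus.along_mulVec, evalTuple_add, evalTuple_mulVec, evalTuple_mulVec,
    G.eval_mat hx, hs hx, h x hx, Matrix.mulVec_add, Matrix.mulVec_mulVec, Matrix.mulVec_mulVec,
    ← hg, Matrix.add_mulVec, dmat]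
  abel

/-- Covariance of the spinorial Lie derivative. -/
theorem lie_covariant (C : SpinorPairing) (hX : SmoothFieldOn X E.dom) {x : M} (hx : x ∈ E.dom)
    (h₁ : IsSkew fun μ ν => g.inner x (mlieBracket (𝓡 4) X (G.vec ν) x) (G.vec μ x))
    (h₂ : IsSkew fun μ ν => g.inner x (mlieBracket (𝓡 4) X (E.vec ν) x) (E.vec μ x))
    {ψ ψ' : M → Spinor} (hψ : ∀ i, SmoothFnOn (fun y => ψ y i) E.dom)
    (h : ∀ y ∈ E.dom, ψ' y = spinMat (G.lift y) *ᵥ ψ y) :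
    (fun i => mvfderiv (𝓡 4) (fun y => ψ' y i) x (X x)) + spinSigma (fun μ ν =>
        g.inner x (mlieBracket (𝓡 4) X (E.vec ν) x) (E.vec μ x)) *ᵥ ψ' x =
      spinMat (G.lift x) *ᵥ ((fun i => mvfderiv (𝓡 4) (fun y => ψ y i) x (X x))
        + spinSigma (fun μ ν =>
          g.inner x (mlieBracket (𝓡 4) X (G.vec ν) x) (G.vec μ x)) *ᵥ ψ x) := by
  refine G.covariant C hX hx h₁ h₂ (fun ν => ?_) hψ h
  have e : (fun μ ν => g.inner x (mlieBracket (𝓡 4) X (E.vec ν) x) (E.vec μ x)) =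
      fun μ ν => evalAt E.dom x (E.calculus.lie (E.comps X hX) μ ν) := by
    funext μ ν; rw [E.evalAt_lie hX hx]
  rw [e, ← evalTuple_bracket, coeff, ← E.comps_mlieBracket hX (G.smooth ν),
    E.evalTuple_comps _ hx]
  funext μ
  -- Both sides are the `E`-components of the same vector `[X, vec ν]`; expanding it in the source
  -- frame gives the right-hand side.
  conv_lhs => rw [G.source.eq_sum hx (mlieBracket (𝓡 4) X (G.vec ν) x)]
  simp only [coeff, Finset.sum_apply, Pi.smul_apply, E.evalTuple_comps _ hx, map_sum, map_smul,
    _root_.sum_apply, _root_.smul_apply, smul_eq_mul, Finset.mul_sum]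
  exact Finset.sum_congr rfl fun ρ _ => by simp only [source]; ring

/-- Covariance of the Levi-Civita connection on spinors. -/
theorem nabla_covariant (C : SpinorPairing) (hX : SmoothFieldOn X E.dom) {x : M}
    (hx : x ∈ E.dom) {ψ ψ' : M → Spinor} (hψ : ∀ i, SmoothFnOn (fun y => ψ y i) E.dom)
    (h : ∀ y ∈ E.dom, ψ' y = spinMat (G.lift y) *ᵥ ψ y) :
    (fun i => mvfderiv (𝓡 4) (fun y => ψ' y i) x (X x)) + spinSigma (fun μ ν =>
        g.nablaPair X (E.vec ν) (E.vec μ) x) *ᵥ ψ' x =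
      spinMat (G.lift x) *ᵥ ((fun i => mvfderiv (𝓡 4) (fun y => ψ y i) x (X x))
        + spinSigma (fun μ ν => g.nablaPair X (G.vec ν) (G.vec μ) x) *ᵥ ψ x) := by
  have e : (fun μ ν => g.nablaPair X (E.vec ν) (E.vec μ) x) =
      fun μ ν => evalAt E.dom x (E.calculus.conn (E.comps X hX) μ ν) := by
    funext μ ν; rw [E.evalAt_conn hX hx]
  have e' : (fun μ ν => g.nablaPair X (G.vec ν) (G.vec μ) x) =
      fun μ ν => evalAt E.dom x (G.source.calculus.conn (G.source.comps X hX) μ ν) := by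
    funext μ ν; exact (G.source.evalAt_conn hX hx μ ν).symm
  refine G.covariant C hX hx (e' ▸ G.source.calculus.eval_isSkew_conn (evalAt E.dom x) _)
    (e ▸ E.calculus.eval_isSkew_conn (evalAt E.dom x) _) (fun ν => ?_) hψ h
  rw [e]
  -- `n` is the tangent vector `∇_X (vec ν)` at `x`, realised with constant components in `E`. As an
  -- actual vector it can be expanded in either frame, which is the transformation law of the
  -- connection.
  obtain ⟨n, hn⟩ : ∃ n, n = E.toField (fun μ => algebraMap ℝ _
      (E.calculus.nablaVec (evalAt E.dom x) (E.comps X hX) (G.coeff ν) μ)) x := ⟨_, rfl⟩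
  have hn' : (fun μ => eta μ * g.inner x n (E.vec μ x)) =
      E.calculus.nablaVec (evalAt E.dom x) (E.comps X hX) (G.coeff ν) := by
    funext μ
    rw [hn, E.eta_inner_toField _ hx]
    simp
  change E.calculus.nablaVec (evalAt E.dom x) (E.comps X hX) (G.coeff ν) = _
  rw [← hn']
  funext μ
  conv_lhs => rw [G.source.eq_sum hx n]
  simp only [coeff, Finset.sum_apply, Pi.smul_apply, E.evalTuple_comps _ hx, map_sum, map_smul,
    _root_.sum_apply, _root_.smul_apply, smul_eq_mul, Finset.mul_sum]
  refine Finset.sum_congr rfl fun ρ _ => ?_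
  have key : g.inner x n (G.vec ρ x) = g.nablaPair X (G.vec ν) (G.vec ρ) x := by
    rw [E.nablaPair_eq (G.smooth ν) hX (G.smooth ρ) hx, E.inner_eq_mink hx, hn',
      E.evalTuple_comps _ hx]
    rfl
  simp only [source]
  rw [key]
  ring

end SpinGauge

end Manifold

/-! ## Spinor fields in local frames -/

/-- In dimension four `vol` anticommutes with vectors. Since spin group elements are even, `vol`
commutes with them and is defined independently of the frame. -/
theorem spinRep_involute_mul_volMat (x : CliffordAlgebra cliffordForm) :
    spinRep (CliffordAlgebra.involute x) * volMat = volMat * spinRep x := by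
  induction x using CliffordAlgebra.induction with
  | algebraMap r =>
    rw [AlgHom.commutes, AlgHom.commutes, Algebra.commutes]
  | ι v =>
    rw [CliffordAlgebra.involute_ι, map_neg, spinRep_ι, slash_eq_sum, neg_mul, Finset.sum_mul,
      Finset.mul_sum, ← Finset.sum_neg_distrib]
    refine Finset.sum_congr rfl fun μ _ => ?_
    rw [smul_mul_assoc, mul_smul_comm, ← smul_neg]
    congr 1
    rw [volMat_eq]
    fin_cases μ <;> (ext i j; fin_cases i <;> fin_cases j <;>
      simp [gam, Matrix.mul_apply, Fin.sum_univ_four])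
  | mul x y hx hy => rw [map_mul, map_mul, map_mul, mul_assoc, hy, ← mul_assoc, hx, mul_assoc]
  | add x y hx hy => rw [map_add, map_add, map_add, add_mul, mul_add, hx, hy]

theorem spinMat_mul_volMat (h : spinGroup cliffordForm) :
    spinMat h * volMat = volMat * spinMat h := by
  have := spinRep_involute_mul_volMat (h : CliffordAlgebra cliffordForm)
  rwa [spinGroup.involute_eq h.2] at this

/-- The finite form of equivariance: every constituent of `K` is intertwined by `h`, which makes the
Killing spinor equation independent of the frame. -/
theorem spinMat_mul_killMat (h : spinGroup cliffordForm) {a b : ℝ} {φ φ' X X' : Fin 4 → ℝ}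
    (hφ : spinMat h * slash φ = slash φ' * spinMat h)
    (hX : spinMat h * slash X = slash X' * spinMat h) (hm : mink φ X = mink φ' X') :
    spinMat h * killMat a b φ X = killMat a b φ' X' * spinMat h := by
  have hw : spinMat h * wedgeMat φ X = wedgeMat φ' X' * spinMat h := by
    rw [wedgeMat, wedgeMat, mul_smul_comm, smul_mul_assoc, mul_sub, sub_mul, ← mul_assoc, hφ,
      mul_assoc, hX, ← mul_assoc, ← mul_assoc, hX, mul_assoc _ _ (slash φ), hφ, ← mul_assoc]
  simp only [killMat, mul_add, mul_sub, add_mul, sub_mul, mul_smul_comm, smul_mul_assoc, mul_one,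
    ← mul_assoc, hX, hw, hm, spinMat_mul_volMat]
  simp only [mul_assoc, spinMat_mul_volMat]

section Manifold

variable {M : Type*} [TopologicalSpace M] [ChartedSpace (EuclideanSpace ℝ (Fin 4)) M]
  [IsManifold (𝓡 4) ∞ M]

open FrameCalculus

variable {g : LorentzianMetric M}

namespace OrthoFrame

/-- The components of a tangent vector. -/
abbrev coords (E : OrthoFrame g) (x : M) (v : TangentSpace (𝓡 4) x) : Fin 4 → ℝ :=
  fun μ => eta μ * g.inner x v (E.vec μ x)

theorem coords_vec (E : OrthoFrame g) {x : M} (hx : x ∈ E.dom) (μ : Fin 4) :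
    E.coords x (E.vec μ x) = Pi.single μ 1 := by
  rw [← E.evalAt_comps_vec μ hx, E.evalTuple_comps _ hx]

end OrthoFrame

namespace SpinStructure

variable {ι : Type*} (S : SpinStructure ι g)

/-- The frame of index `i`. -/
def orthoFrame (i : ι) : OrthoFrame g where
  dom := S.baseSet i
  isOpen_dom := S.isOpen_baseSet i
  vec := S.frame i
  smooth := S.contMDiffOn_frame i
  orthonormal := S.orthonormal_frame i

/-- The frame of index `j` over the overlap with the frame of index `i`. -/
def overlap (i j : ι) : OrthoFrame g where
  dom := S.baseSet i ∩ S.baseSet j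
  isOpen_dom := (S.isOpen_baseSet i).inter (S.isOpen_baseSet j)
  vec := S.frame j
  smooth μ := (S.contMDiffOn_frame j μ).mono Set.inter_subset_right
  orthonormal x hx := S.orthonormal_frame j x hx.2

theorem transition_slash {i j : ι} {x : M} (hx : x ∈ S.baseSet i ∩ S.baseSet j)
    (v : TangentSpace (𝓡 4) x) :
    spinMat (S.transition i j x) * slash ((S.orthoFrame i).coords x v) =
      slash ((S.orthoFrame j).coords x v) * spinMat (S.transition i j x) := by
  have h := congrArg spinRep (S.transition_frame i j x hx _ _
    (((S.orthoFrame i).eq_sum hx.1 v).symm.trans ((S.orthoFrame j).eq_sum hx.2 v)))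
  rw [map_mul, map_mul, spinRep_ι, spinRep_ι] at h
  exact h

theorem smoothFnOn_transition (i j : ι) (k l : Fin 4) :
    SmoothFnOn (fun y => spinMat (S.transition i j y) k l) (S.baseSet i ∩ S.baseSet j) := by
  have h := (ContinuousLinearMap.proj (R := ℝ) (φ := fun _ : Fin 4 => ℝ) k).contMDiff
    (n := ∞) |>.comp_contMDiffOn ((S.contMDiffOn_transition i j).clm_apply
      (contMDiffOn_const (c := (Pi.single l 1 : Spinor))))
  refine ContMDiffOn.congr h fun y _ => ?_
  simp [spinAction_apply]

/-- The change of frame from index `i` to index `j`. -/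
def gauge (i j : ι) : SpinGauge (S.overlap i j) where
  vec := S.frame i
  smooth μ := (S.contMDiffOn_frame i μ).mono Set.inter_subset_left
  orthonormal x hx := S.orthonormal_frame i x hx.1
  lift := S.transition i j
  smooth_lift := S.smoothFnOn_transition i j
  lift_slash x hx ν := by
    have h := S.transition_slash hx (S.frame i ν x)
    have e := (S.orthoFrame i).coords_vec hx.1 ν
    simp only [orthoFrame] at e
    simp only [orthoFrame, OrthoFrame.coords] at h e
    rw [e, slash_single] at h
    exact h

theorem localRep_transition (ε : S.SpinorField) {i j : ι} {x : M}
    (hx : x ∈ S.baseSet i ∩ S.baseSet j) :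
    S.localRep j ε x = spinMat (S.transition i j x) *ᵥ S.localRep i ε x := by
  have h := S.transition_comp (S.indexAt x) i j x ⟨⟨S.mem_baseSet_at x, hx.1⟩, hx.2⟩
  rw [localRep, localRep, ← h, spinAction_apply, spinAction_apply, Matrix.mulVec_mulVec]
  congr 1
  exact map_mul spinRep _ _

theorem localRep_indexAt (ε : S.SpinorField) (x : M) :
    S.localRep (S.indexAt x) ε x = S.fiberEquiv x (ε x) := by
  rw [localRep, S.transition_self _ x (S.mem_baseSet_at x), spinAction_apply]
  simp [spinMat]

theorem localRep_injective {ε ε' : S.SpinorField} {i : ι} {x : M} (hx : x ∈ S.baseSet i)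
    (h : S.localRep i ε x = S.localRep i ε' x) : ε x = ε' x := by
  apply (S.fiberEquiv x).injective
  rw [← S.localRep_indexAt, ← S.localRep_indexAt,
    S.localRep_transition ε ⟨hx, S.mem_baseSet_at x⟩,
    S.localRep_transition ε' ⟨hx, S.mem_baseSet_at x⟩, h]

theorem localRep_add (i : ι) (ε ε' : S.SpinorField) :
    S.localRep i (ε + ε') = S.localRep i ε + S.localRep i ε' := by
  funext x; simp [localRep]

theorem localRep_smul (i : ι) (c : ℝ) (ε : S.SpinorField) :
    S.localRep i (c • ε) = c • S.localRep i ε := by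
  funext x; simp [localRep]

theorem localRep_zero (i : ι) : S.localRep i 0 = 0 := by
  funext x; simp [localRep]

/-- Smoothness of the section at `x` is read in the trivialisation of index `indexAt x`; the smooth
transition functions carry it to any other index. -/
theorem smoothSpinor_iff (ε : S.SpinorField) : S.SmoothSpinor ε ↔
    ∀ i k, SmoothFnOn (fun y => S.localRep i ε y k) (S.baseSet i) := by
  have key (x : M) : ContMDiffAt (𝓡 4) ((𝓡 4).prod 𝓘(ℝ, Spinor)) ∞
      (fun y => TotalSpace.mk' Spinor y (ε y)) x ↔
      ContMDiffAt (𝓡 4) 𝓘(ℝ, Spinor) ∞ (S.localRep (S.indexAt x) ε) x :=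
    contMDiffAt_section (s := ε) x
  constructor
  · intro h i k x hx
    have h1 := (key x).1 (h x)
    have hU : S.baseSet (S.indexAt x) ∩ S.baseSet i ∈ nhds x :=
      ((S.isOpen_baseSet _).inter (S.isOpen_baseSet i)).mem_nhds ⟨S.mem_baseSet_at x, hx⟩
    have h2 := ((S.contMDiffOn_transition (S.indexAt x) i).contMDiffAt hU).clm_apply h1
    have h3 : ContMDiffAt (𝓡 4) 𝓘(ℝ, Spinor) ∞ (S.localRep i ε) x :=
      h2.congr_of_eventuallyEq (Filter.eventuallyEq_of_mem hU fun y hy => by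
        rw [S.localRep_transition ε hy, spinAction_apply])
    have h4 := ((ContinuousLinearMap.proj (R := ℝ) (φ := fun _ : Fin 4 => ℝ) k).contMDiff
      (n := ∞)).contMDiffAt.comp x h3
    exact h4.contMDiffWithinAt
  · intro h x
    refine (key x).2 (contMDiffAt_pi_space.2 fun k => ?_)
    exact (h (S.indexAt x) k).contMDiffAt ((S.isOpen_baseSet _).mem_nhds (S.mem_baseSet_at x))

theorem mvfderiv_localRep {ε : S.SpinorField} (hε : S.SmoothSpinor ε) (x : M)
    (v : TangentSpace (𝓡 4) x) :
    mvfderiv (𝓡 4) (S.localRep (S.indexAt x) ε) x v =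
      fun k => mvfderiv (𝓡 4) (fun y => S.localRep (S.indexAt x) ε y k) x v := by
  funext k
  have h := hε.mdifferentiableAt_localRep x
  have e := mfderiv_comp x (ContinuousLinearMap.proj (R := ℝ)
    (φ := fun _ : Fin 4 => ℝ) k).mdifferentiableAt h
  rw [ContinuousLinearMap.mfderiv_eq] at e
  exact (congrArg (fun L => L v) e).symm

variable {S} {X : VField M} {ε : S.SpinorField}

/-- `nabla` is defined at each point in the frame chosen there. Gauge covariance expresses it in a
single frame `i`, as is needed to discuss its regularity and differentiate it again. -/
theorem localRep_nabla (C : SpinorPairing) (hX : SmoothField X) (hε : S.SmoothSpinor ε) {i : ι}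
    {x : M} (hx : x ∈ S.baseSet i) :
    S.localRep i (S.nabla X ε) x = (fun k => mvfderiv (𝓡 4) (fun y => S.localRep i ε y k) x (X x))
      + spinSigma (fun μ ν => g.nablaPair X (S.frame i ν) (S.frame i μ) x) *ᵥ
        S.localRep i ε x := by
  have hx' : x ∈ (S.overlap (S.indexAt x) i).dom := ⟨S.mem_baseSet_at x, hx⟩
  have h := (S.gauge (S.indexAt x) i).nabla_covariant C (hX.smoothFieldOn _) hx'
    (ψ := S.localRep (S.indexAt x) ε) (ψ' := S.localRep i ε)
    (fun k => ((S.smoothSpinor_iff ε).1 hε (S.indexAt x) k).mono Set.inter_subset_left)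
    (fun y hy => S.localRep_transition ε hy)
  refine Eq.trans ?_ h.symm
  rw [S.localRep_transition _ hx', S.localRep_indexAt, S.localRep_indexAt]
  change _ = spinMat (S.transition _ i x) *ᵥ _
  congr 1
  rw [← S.mvfderiv_localRep hε]
  simp only [nabla, map_add, LinearEquiv.apply_symm_apply]
  rfl

/-- `∇_X e_ν - ∇_{e_ν} X = [X, e_ν]`. -/
theorem nablaPair_torsion (hX : SmoothField X) (E : OrthoFrame g) {x : M} (hx : x ∈ E.dom)
    (μ ν : Fin 4) : g.nablaPair X (E.vec ν) (E.vec μ) x - g.nablaPair (E.vec ν) X (E.vec μ) x =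
      g.inner x (mlieBracket (𝓡 4) X (E.vec ν) x) (E.vec μ x) := by
  have hX' := hX.smoothFieldOn E.dom
  rw [E.nablaPair_eq (E.smooth ν) hX' (E.smooth μ) hx,
    E.nablaPair_eq hX' (E.smooth ν) (E.smooth μ) hx, ← mink_sub_left, ← nablaVec_torsion,
    ← E.comps_mlieBracket hX' (E.smooth ν), ← E.pair_eq_mink _ _ hx]
  rfl

/-- `∇_X e_ν - ∇_{e_ν} X = [X, e_ν]` merges the connection and `A_X` into the bracket matrix. Its
skewness is required in both frames of each comparison, hence the hypothesis for all `j`. -/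
theorem localRep_kosmann (C : SpinorPairing) (hX : SmoothField X) (hε : S.SmoothSpinor ε) {i : ι}
    {x : M} (hx : x ∈ S.baseSet i)
    (hK : ∀ j, x ∈ S.baseSet j → IsSkew fun μ ν =>
      g.inner x (mlieBracket (𝓡 4) X (S.frame j ν) x) (S.frame j μ x)) :
    S.localRep i (S.kosmann X ε) x =
      (fun k => mvfderiv (𝓡 4) (fun y => S.localRep i ε y k) x (X x))
      + spinSigma (fun μ ν => g.inner x (mlieBracket (𝓡 4) X (S.frame i ν) x) (S.frame i μ x)) *ᵥ
        S.localRep i ε x := by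
  have hx' : x ∈ (S.overlap (S.indexAt x) i).dom := ⟨S.mem_baseSet_at x, hx⟩
  have h := (S.gauge (S.indexAt x) i).lie_covariant C (hX.smoothFieldOn _) hx'
    (hK _ (S.mem_baseSet_at x)) (hK i hx)
    (ψ := S.localRep (S.indexAt x) ε) (ψ' := S.localRep i ε)
    (fun k => ((S.smoothSpinor_iff ε).1 hε (S.indexAt x) k).mono Set.inter_subset_left)
    (fun y hy => S.localRep_transition ε hy)
  refine Eq.trans ?_ h.symm
  rw [S.localRep_transition _ hx', S.localRep_indexAt, S.localRep_indexAt]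
  change _ = spinMat (S.transition _ i x) *ᵥ _
  congr 1
  rw [← S.mvfderiv_localRep hε]
  have e : (fun μ ν => g.inner x (mlieBracket (𝓡 4) X (S.frame (S.indexAt x) ν) x)
      (S.frame (S.indexAt x) μ x)) =
      (fun μ ν => g.nablaPair X (S.frame (S.indexAt x) ν) (S.frame (S.indexAt x) μ) x)
      + (fun μ ν => -g.nablaPair (S.frame (S.indexAt x) ν) X (S.frame (S.indexAt x) μ) x) := by
    funext μ ν
    rw [Pi.add_apply, Pi.add_apply, ← sub_eq_add_neg]
    exact (nablaPair_torsion hX (S.orthoFrame (S.indexAt x)) (S.mem_baseSet_at x) μ ν).symm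
  change _ = _ + spinSigma (fun μ ν => g.inner x (mlieBracket (𝓡 4) X
    (S.frame (S.indexAt x) ν) x) (S.frame (S.indexAt x) μ x)) *ᵥ _
  rw [e, spinSigma_add, Matrix.add_mulVec, ← add_assoc]
  simp only [kosmann, nabla, map_add, LinearEquiv.apply_symm_apply]
  rfl

theorem localRep_gravitino (C : SpinorPairing) (a b : M → ℝ) (φ : VField M) (hX : SmoothField X)
    (hε : S.SmoothSpinor ε) {i : ι} {x : M} (hx : x ∈ S.baseSet i) :
    S.localRep i (S.gravitino a b φ X ε) x =
      (fun k => mvfderiv (𝓡 4) (fun y => S.localRep i ε y k) x (X x))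
      + spinSigma (fun μ ν => g.nablaPair X (S.frame i ν) (S.frame i μ) x) *ᵥ S.localRep i ε x
      - killMat (a x) (b x) ((S.orthoFrame i).coords x (φ x)) ((S.orthoFrame i).coords x (X x)) *ᵥ
        S.localRep i ε x := by
  have hx' : x ∈ S.baseSet (S.indexAt x) ∩ S.baseSet i := ⟨S.mem_baseSet_at x, hx⟩
  have e : S.fiberEquiv x (S.gravitino a b φ X ε x) = S.fiberEquiv x (S.nabla X ε x)
      - killMat (a x) (b x) ((S.orthoFrame (S.indexAt x)).coords x (φ x))
        ((S.orthoFrame (S.indexAt x)).coords x (X x)) *ᵥ S.fiberEquiv x (ε x) := by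
    have hm := (S.orthoFrame (S.indexAt x)).inner_eq_mink hx'.1 (φ x) (X x)
    simp only [killMat]
    rw [← hm, Matrix.add_mulVec, Matrix.sub_mulVec, Matrix.smul_mulVec]
    change S.fiberEquiv x (_ - _ + _ - _) = _
    simp only [map_sub, map_add, map_smul]
    rw [sub_add_eq_sub_sub, sub_sub_eq_add_sub, sub_add_eq_add_sub]
    rfl
  rw [← localRep_nabla C hX hε hx, S.localRep_transition _ hx', S.localRep_transition _ hx',
    S.localRep_transition ε hx', S.localRep_indexAt, S.localRep_indexAt, S.localRep_indexAt, e,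
    Matrix.mulVec_sub, Matrix.mulVec_mulVec, Matrix.mulVec_mulVec]
  rw [spinMat_mul_killMat _ (S.transition_slash hx' (φ x)) (S.transition_slash hx' (X x))
    (((S.orthoFrame _).inner_eq_mink hx'.1 _ _).symm.trans
      ((S.orthoFrame i).inner_eq_mink hx _ _))]

variable (S) in
theorem kappa_apply (C : SpinorPairing) (ε₁ ε₂ : S.SpinorField) (x : M) :
    S.kappa C ε₁ ε₂ x = ∑ μ, C.current (S.fiberEquiv x (ε₁ x)) (S.fiberEquiv x (ε₂ x)) μ •
      S.frame (S.indexAt x) μ x := by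
  have h (μ : Fin 4) := congrFun (C.current_comm (S.fiberEquiv x (ε₁ x)) (S.fiberEquiv x (ε₂ x))) μ
  simp only [SpinorPairing.current] at h ⊢
  simp only [kappa, diracCurrent, Pi.smul_apply, Pi.sub_apply, ← Finset.sum_sub_distrib,
    Finset.smul_sum, ← sub_smul, smul_smul, Pi.add_apply, map_add, Matrix.mulVec_add,
    LinearMap.add_apply]
  refine Finset.sum_congr rfl fun μ _ => ?_
  congr 1
  linear_combination (-1 / 2 : ℝ) * h μ

variable (S) in
theorem diracCurrent_eq_kappa (C : SpinorPairing) (ε : S.SpinorField) :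
    S.diracCurrent C ε = S.kappa C ε ε := by
  funext x; rw [kappa_apply]; rfl

variable (S) in
-- Spin invariance of the pairing and the covering of the frame change make the current the same
-- vector in every frame.
theorem coords_kappa (C : SpinorPairing) (ε₁ ε₂ : S.SpinorField) {i : ι} {x : M}
    (hx : x ∈ S.baseSet i) : (S.orthoFrame i).coords x (S.kappa C ε₁ ε₂ x) =
      C.current (S.localRep i ε₁ x) (S.localRep i ε₂ x) := by
  have hx' : x ∈ S.baseSet (S.indexAt x) ∩ S.baseSet i := ⟨S.mem_baseSet_at x, hx⟩
  funext ν
  have hs := S.transition_slash hx' (S.frame i ν x)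
  have e := (S.orthoFrame i).coords_vec hx ν
  change (S.orthoFrame i).coords x (S.frame i ν x) = _ at e
  rw [e, slash_single] at hs
  rw [S.localRep_transition ε₁ hx', S.localRep_transition ε₂ hx', S.localRep_indexAt,
    S.localRep_indexAt, SpinorPairing.current, Matrix.mulVec_mulVec, ← hs,
    ← Matrix.mulVec_mulVec, C.form_spinMat, S.kappa_apply]
  change eta ν * _ = _
  congr 1
  rw [slash_eq_sum]
  simp only [map_sum, map_smul, _root_.sum_apply, _root_.smul_apply,
    Matrix.sum_mulVec, Matrix.smul_mulVec, smul_eq_mul, SpinorPairing.current]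
  refine Finset.sum_congr rfl fun μ _ => ?_
  change _ * g.inner x (S.frame _ μ x) (S.frame i ν x) =
    eta μ * g.inner x (S.frame i ν x) (S.frame _ μ x) * _
  rw [g.symm x (S.frame i ν x)]
  ring

end SpinStructure

end Manifold

/-! ### Passage between global fields and frame components -/

section Manifold

variable {M : Type*} [TopologicalSpace M] [ChartedSpace (EuclideanSpace ℝ (Fin 4)) M]
  [IsManifold (𝓡 4) ∞ M]

open FrameCalculus

variable {g : LorentzianMetric M}

/-- A vector field which is smooth near `x` agrees near `x` with a smooth vector field. -/
theorem exists_smoothField_eventuallyEq [T2Space M] {U : Set M} (hU : IsOpen U) {X : VField M}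
    (hX : SmoothFieldOn X U) {x : M} (hx : x ∈ U) :
    ∃ X' : VField M, SmoothField X' ∧ ∀ᶠ y in nhds x, X' y = X y := by
  obtain ⟨f, -, hf⟩ := (SmoothBumpFunction.nhds_basis_tsupport (I := 𝓡 4) x).mem_iff.1
    (hU.mem_nhds hx)
  refine ⟨(f : M → ℝ) • X, ContMDiffOn.smul_section_of_tsupport f.contMDiff.contMDiffOn hU hf hX,
    ?_⟩
  filter_upwards [f.eventuallyEq_one] with y hy
  rw [Pi.smul_apply', hy, Pi.one_apply, one_smul]

namespace OrthoFrame

variable (E : OrthoFrame g) {X Y Z : VField M}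

theorem evalAt_lie_of_notMem (v : Fin 4 → smoothOn E.dom) {x : M} (hx : x ∉ E.dom) (μ ν : Fin 4) :
    evalAt E.dom x (E.calculus.lie v μ ν) = 0 := by
  rw [lie, map_smul]
  change _ • evalAt E.dom x (E.bracketComps _ _ μ) = 0
  rw [E.evalAt_bracketComps_of_notMem _ _ hx, smul_zero]

theorem evalTuple_along_of_notMem (v s : Fin 4 → smoothOn E.dom) {x : M} (hx : x ∉ E.dom) :
    evalTuple (evalAt E.dom x) (E.calculus.along v s) = 0 :=
  funext fun i => E.evalAt_derivation_of_notMem v (s i) hx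

/-- As `g(e_μ, e_ν)` is locally constant, only the bracket terms of `(L_X g)(e_μ, e_ν)` remain. The
hypothesis speaks of global fields, so the frame vectors are first cut off near `x`. -/
theorem isSkew_inner_bracket [T2Space M] (hX : SmoothField X)
    (hK : ∀ Y Z : VField M, SmoothField Y → SmoothField Z → ∀ x, g.lieDeriv X Y Z x = 0)
    {x : M} (hx : x ∈ E.dom) :
    IsSkew fun μ ν => g.inner x (mlieBracket (𝓡 4) X (E.vec ν) x) (E.vec μ x) := by
  intro μ ν
  obtain ⟨Y, hY, eY⟩ := exists_smoothField_eventuallyEq E.isOpen_dom (E.smooth μ) hx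
  obtain ⟨Z, hZ, eZ⟩ := exists_smoothField_eventuallyEq E.isOpen_dom (E.smooth ν) hx
  have h := hK Y Z hY hZ x
  have ep : mvfderiv (𝓡 4) (g.pair Y Z) x =
      mvfderiv (𝓡 4) (fun _ => if μ = ν then eta μ else 0) x := by
    refine mvfderiv_congr ?_
    filter_upwards [eY, eZ, E.isOpen_dom.mem_nhds hx] with y h1 h2 h3
    rw [LorentzianMetric.pair, h1, h2, E.orthonormal y h3]
  have e1 : mlieBracket (𝓡 4) X Y x = mlieBracket (𝓡 4) X (E.vec μ) x :=
    Filter.EventuallyEq.mlieBracket_vectorField_eq Filter.EventuallyEq.rfl eY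
  have e2 : mlieBracket (𝓡 4) X Z x = mlieBracket (𝓡 4) X (E.vec ν) x :=
    Filter.EventuallyEq.mlieBracket_vectorField_eq Filter.EventuallyEq.rfl eZ
  rw [LorentzianMetric.lieDeriv, ep, mvfderiv_const, LorentzianMetric.pair,
    LorentzianMetric.pair, e1, e2, eY.self_of_nhds, eZ.self_of_nhds,
    g.symm x (E.vec μ x)] at h
  change (0 : ℝ) - _ - _ = 0 at h
  linarith

theorem isKilling_comps [T2Space M] (hX : SmoothField X)
    (hK : ∀ Y Z : VField M, SmoothField Y → SmoothField Z → ∀ x, g.lieDeriv X Y Z x = 0) :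
    E.calculus.IsKilling (E.comps X (hX.smoothFieldOn _)) := by
  intro μ ν
  refine smoothOn_ext fun x => ?_
  rw [map_neg]
  by_cases hx : x ∈ E.dom
  · rw [E.evalAt_lie _ hx, E.evalAt_lie _ hx]
    exact E.isSkew_inner_bracket hX hK hx μ ν
  · rw [E.evalAt_lie_of_notMem _ hx, E.evalAt_lie_of_notMem _ hx, neg_zero]

/-- The derivatives of the components of `Y` and `Z` cancel; the remaining terms contain only the
matrices `conn X` and `lie X`, both skew for the Minkowski product. -/
theorem lieDeriv_eq_zero (hX : SmoothField X) (hY : SmoothField Y) (hZ : SmoothField Z) {x : M}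
    (hx : x ∈ E.dom) (hK : IsSkew fun μ ν =>
      evalAt E.dom x (E.calculus.lie (E.comps X (hX.smoothFieldOn _)) μ ν)) :
    g.lieDeriv X Y Z x = 0 := by
  have hX' := hX.smoothFieldOn E.dom
  have hY' := hY.smoothFieldOn E.dom
  have hZ' := hZ.smoothFieldOn E.dom
  have e : g.pair Y (mlieBracket (𝓡 4) X Z) x = g.pair (mlieBracket (𝓡 4) X Z) Y x := g.symm _ _ _
  rw [LorentzianMetric.lieDeriv, e, E.mvfderiv_pair hY' hX' hZ' hx,
    E.pair_eq_mink (SmoothFieldOn.mlieBracket hX' hY' E.isOpen_dom) hZ' hx,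
    E.pair_eq_mink (SmoothFieldOn.mlieBracket hX' hZ' E.isOpen_dom) hY' hx,
    E.comps_mlieBracket hX' hY', E.comps_mlieBracket hX' hZ', evalTuple_bracket,
    evalTuple_bracket, mink_add_left, mink_add_left, nablaVec_metric, nablaVec, nablaVec,
    mink_add_left, mink_add_left, mink_lowerApply hK,
    mink_lowerApply (E.calculus.eval_isSkew_conn (evalAt E.dom x) (E.comps X hX')),
    mink_comm (evalTuple _ (E.comps Y hY')), mink_comm (evalTuple _ (E.comps Y hY'))]
  ring

/-- A smooth function, restricted to the domain of the frame. -/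
def restrict {f : M → ℝ} (hf : ContMDiff (𝓡 4) 𝓘(ℝ, ℝ) ∞ f) : smoothOn E.dom :=
  ⟨f, hf.contMDiffOn⟩

variable {a b : M → ℝ} {φ : VField M} (ha : ContMDiff (𝓡 4) 𝓘(ℝ, ℝ) ∞ a)
  (hb : ContMDiff (𝓡 4) 𝓘(ℝ, ℝ) ∞ b) (hφ : SmoothField φ)

theorem der_eq_zero (hX : SmoothFieldOn X E.dom) (h : ∀ x, mvfderiv (𝓡 4) a x (X x) = 0) :
    E.calculus.der (E.comps X hX) (E.restrict ha) = 0 := by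
  refine smoothOn_ext fun x => ?_
  rw [map_zero]
  by_cases hx : x ∈ E.dom
  · rw [E.evalAt_der hx]; exact h x
  · exact E.evalAt_derivation_of_notMem _ _ hx

theorem bracket_eq_zero (hX : SmoothFieldOn X E.dom) (hY : SmoothFieldOn Y E.dom)
    (h : ∀ x, mlieBracket (𝓡 4) X Y x = 0) :
    E.calculus.bracket (E.comps X hX) (E.comps Y hY) = 0 := by
  rw [← E.comps_mlieBracket hX hY]
  refine E.comps_ext _ (fun x _ μ => ?_) (fun x _ μ => map_zero _)
  rw [h x]; simp

theorem bracket_eq_zero_iff (hX : SmoothFieldOn X E.dom) (hY : SmoothFieldOn Y E.dom) {x : M}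
    (hx : x ∈ E.dom) : evalTuple (evalAt E.dom x)
      (E.calculus.bracket (E.comps X hX) (E.comps Y hY)) = 0 ↔ mlieBracket (𝓡 4) X Y x = 0 := by
  rw [← E.comps_mlieBracket hX hY, E.evalTuple_comps _ hx]
  constructor
  · intro h
    rw [E.eq_sum hx (mlieBracket (𝓡 4) X Y x)]
    exact Finset.sum_eq_zero fun μ _ => by rw [show eta μ * _ = (0 : ℝ) from congrFun h μ, zero_smul]
  · intro h; rw [h]; funext μ; simp

end OrthoFrame

namespace SpinStructure

variable {ι : Type*} {S : SpinStructure ι g} {X Y : VField M} {ε : S.SpinorField}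

/-- The components of a smooth spinor field. -/
def rep (i : ι) (hε : S.SmoothSpinor ε) : Fin 4 → smoothOn (S.orthoFrame i).dom :=
  fun k => extendZero _ ((S.smoothSpinor_iff ε).1 hε i k)

theorem evalTuple_rep {i : ι} (hε : S.SmoothSpinor ε) {x : M} (hx : x ∈ S.baseSet i) :
    evalTuple (evalAt (S.orthoFrame i).dom x) (rep i hε) = S.localRep i ε x :=
  funext fun k => evalAt_extendZero ((S.smoothSpinor_iff ε).1 hε i k) hx

theorem evalTuple_rep_of_notMem {i : ι} (hε : S.SmoothSpinor ε) {x : M} (hx : x ∉ S.baseSet i) :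
    evalTuple (evalAt (S.orthoFrame i).dom x) (rep i hε) = 0 :=
  funext fun k => evalAt_extendZero_of_notMem ((S.smoothSpinor_iff ε).1 hε i k) hx

theorem evalTuple_along_rep {i : ι} (hX : SmoothFieldOn X (S.orthoFrame i).dom)
    (hε : S.SmoothSpinor ε) {x : M} (hx : x ∈ S.baseSet i) :
    evalTuple (evalAt (S.orthoFrame i).dom x)
      ((S.orthoFrame i).calculus.along ((S.orthoFrame i).comps X hX) (rep i hε)) =
      fun k => mvfderiv (𝓡 4) (fun y => S.localRep i ε y k) x (X x) := by
  funext k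
  rw [evalTuple, along, (S.orthoFrame i).evalAt_der hx]
  exact congrArg (fun L => L (X x)) (mvfderiv_extendZero (S.orthoFrame i).isOpen_dom
    ((S.smoothSpinor_iff ε).1 hε i k) hx)

theorem localRep_kosmann_eq [T2Space M] (C : SpinorPairing) (hX : SmoothField X)
    (hK : ∀ Y Z : VField M, SmoothField Y → SmoothField Z → ∀ x, g.lieDeriv X Y Z x = 0)
    (hε : S.SmoothSpinor ε) {i : ι} {x : M} (hx : x ∈ S.baseSet i) :
    S.localRep i (S.kosmann X ε) x = evalTuple (evalAt (S.orthoFrame i).dom x)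
      ((S.orthoFrame i).calculus.lieSpinor ((S.orthoFrame i).comps X (hX.smoothFieldOn _))
        (rep i hε)) := by
  rw [localRep_kosmann C hX hε hx fun j hj => (S.orthoFrame j).isSkew_inner_bracket hX hK hj,
    eval_lieSpinor, evalTuple_along_rep _ hε hx, evalTuple_rep hε hx]
  congr 3
  funext μ ν
  exact ((S.orthoFrame i).evalAt_lie (hX.smoothFieldOn _) hx μ ν).symm

theorem smoothSpinor_kosmann [T2Space M] (C : SpinorPairing) (hX : SmoothField X)
    (hK : ∀ Y Z : VField M, SmoothField Y → SmoothField Z → ∀ x, g.lieDeriv X Y Z x = 0)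
    (hε : S.SmoothSpinor ε) : S.SmoothSpinor (S.kosmann X ε) := by
  rw [smoothSpinor_iff]
  intro i k
  refine ContMDiffOn.congr ((S.orthoFrame i).calculus.lieSpinor
    ((S.orthoFrame i).comps X (hX.smoothFieldOn _)) (rep i hε) k).2 fun x hx => ?_
  exact congrFun (localRep_kosmann_eq C hX hK hε hx) k

/-- An equality of component tuples in the function algebra, stronger than one at a point: it allows
`L_X ε` itself to be differentiated and Lie derivatives to be iterated. -/
theorem rep_kosmann [T2Space M] (C : SpinorPairing) (hX : SmoothField X)
    (hK : ∀ Y Z : VField M, SmoothField Y → SmoothField Z → ∀ x, g.lieDeriv X Y Z x = 0)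
    (hε : S.SmoothSpinor ε) (i : ι) :
    rep i (smoothSpinor_kosmann C hX hK hε) =
      (S.orthoFrame i).calculus.lieSpinor ((S.orthoFrame i).comps X (hX.smoothFieldOn _))
        (rep i hε) := by
  funext k
  refine smoothOn_ext fun x => ?_
  by_cases hx : x ∈ S.baseSet i
  · exact (congrFun (evalTuple_rep _ hx) k).trans
      (congrFun (localRep_kosmann_eq C hX hK hε hx) k)
  · refine (congrFun (evalTuple_rep_of_notMem _ hx) k).trans ?_
    have h : evalTuple (evalAt (S.orthoFrame i).dom x) ((S.orthoFrame i).calculus.lieSpinor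
        ((S.orthoFrame i).comps X (hX.smoothFieldOn _)) (rep i hε)) = 0 := by
      rw [eval_lieSpinor, evalTuple_rep_of_notMem _ hx,
        (S.orthoFrame i).evalTuple_along_of_notMem _ _ hx, Matrix.mulVec_zero, add_zero]
    exact (congrFun h k).symm

variable {a b : M → ℝ} {φ : VField M} (ha : ContMDiff (𝓡 4) 𝓘(ℝ, ℝ) ∞ a)
  (hb : ContMDiff (𝓡 4) 𝓘(ℝ, ℝ) ∞ b) (hφ : SmoothField φ)

theorem localRep_gravitino_eq (C : SpinorPairing) (hX : SmoothField X)
    (hε : S.SmoothSpinor ε) {i : ι} {x : M} (hx : x ∈ S.baseSet i) :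
    S.localRep i (S.gravitino a b φ X ε) x =
      evalTuple (evalAt (S.orthoFrame i).dom x) ((S.orthoFrame i).calculus.along
        ((S.orthoFrame i).comps X (hX.smoothFieldOn _)) (rep i hε))
      + spinSigma (fun μ ν => evalAt (S.orthoFrame i).dom x ((S.orthoFrame i).calculus.conn
        ((S.orthoFrame i).comps X (hX.smoothFieldOn _)) μ ν)) *ᵥ
        evalTuple (evalAt (S.orthoFrame i).dom x) (rep i hε)
      - killMat (a x) (b x)
        (evalTuple (evalAt (S.orthoFrame i).dom x)
          ((S.orthoFrame i).comps φ (hφ.smoothFieldOn _)))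
        (evalTuple (evalAt (S.orthoFrame i).dom x)
          ((S.orthoFrame i).comps X (hX.smoothFieldOn _))) *ᵥ
        evalTuple (evalAt (S.orthoFrame i).dom x) (rep i hε) := by
  rw [localRep_gravitino C a b φ hX hε hx, evalTuple_along_rep _ hε hx, evalTuple_rep hε hx,
    (S.orthoFrame i).evalTuple_comps _ hx, (S.orthoFrame i).evalTuple_comps _ hx]
  congr 4
  funext μ ν
  exact ((S.orthoFrame i).evalAt_conn (hX.smoothFieldOn _) hx μ ν).symm

/-- Evaluate `D_X ε = 0` on a global field agreeing with `e_μ` near the point. Off the domain both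
sides are zero by the choice of extension. -/
theorem isKillingSpinor_rep [T2Space M] (C : SpinorPairing) (hε : S.SmoothSpinor ε)
    (h : ∀ X : VField M, SmoothField X → S.gravitino a b φ X ε = 0) (i : ι) :
    (S.orthoFrame i).calculus.IsKillingSpinor ((S.orthoFrame i).restrict ha)
      ((S.orthoFrame i).restrict hb) ((S.orthoFrame i).comps φ (hφ.smoothFieldOn _))
      (rep i hε) := by
  intro μ
  funext k
  refine smoothOn_ext fun x => ?_
  refine congrFun (a := k) (?_ : evalTuple (evalAt (S.orthoFrame i).dom x) _ =
    evalTuple (evalAt (S.orthoFrame i).dom x) _)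
  rw [evalTuple_sub, evalTuple_mulVec, evalTuple_mulVec, eval_killMatA, eval_sigmaA]
  by_cases hx : x ∈ S.baseSet i
  · obtain ⟨X, hX, eX⟩ := exists_smoothField_eventuallyEq (S.isOpen_baseSet i)
      (S.contMDiffOn_frame i μ) hx
    have h0 := localRep_gravitino_eq (a := a) (b := b) hφ C hX hε hx
    rw [h X hX, localRep_zero, Pi.zero_apply] at h0
    have ec : evalTuple (evalAt (S.orthoFrame i).dom x)
        ((S.orthoFrame i).comps X (hX.smoothFieldOn _)) = Pi.single μ 1 := by
      rw [(S.orthoFrame i).evalTuple_comps _ hx, eX.self_of_nhds]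
      exact (S.orthoFrame i).coords_vec hx μ
    have ec' (ν : Fin 4) := congrFun ec ν
    simp only [evalTuple] at ec'
    rw [ec, evalTuple_along_eq_sum] at h0
    simp only [conn, map_sum, map_mul, ec', Pi.single_apply, ite_mul, one_mul, zero_mul,
      Finset.sum_ite_eq', Finset.mem_univ, if_true, ite_smul, one_smul, zero_smul] at h0
    rw [eq_sub_iff_add_eq, ← sub_eq_zero]
    exact h0.symm
  · rw [evalTuple_rep_of_notMem hε hx, (S.orthoFrame i).evalTuple_along_of_notMem _ _ hx,
      Matrix.mulVec_zero, Matrix.mulVec_zero, sub_zero]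

theorem gravitino_eq_zero (C : SpinorPairing) (hX : SmoothField X) (hε : S.SmoothSpinor ε)
    (h : ∀ x, ∃ i, x ∈ S.baseSet i ∧ (S.orthoFrame i).calculus.IsKillingSpinorAt
      (evalAt (S.orthoFrame i).dom x) ((S.orthoFrame i).restrict ha)
      ((S.orthoFrame i).restrict hb) ((S.orthoFrame i).comps φ (hφ.smoothFieldOn _))
      (rep i hε)) : S.gravitino a b φ X ε = 0 := by
  funext x
  obtain ⟨i, hx, hi⟩ := h x
  refine S.localRep_injective (ε' := 0) hx ?_
  rw [localRep_gravitino_eq hφ C hX hε hx, hi.along, localRep_zero, Pi.zero_apply, sub_add_cancel]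
  exact sub_self _

theorem coords_kappa_eq_evalAt (C : SpinorPairing) {ε₁ ε₂ : S.SpinorField} (h₁ : S.SmoothSpinor ε₁)
    (h₂ : S.SmoothSpinor ε₂) {i : ι} {x : M} (hx : x ∈ S.baseSet i) (μ : Fin 4) :
    (S.orthoFrame i).coords x (S.kappa C ε₁ ε₂ x) μ =
      evalAt (S.orthoFrame i).dom x (currentA C (rep i h₁) (rep i h₂) μ) := by
  rw [S.coords_kappa C ε₁ ε₂ hx, eval_currentA, evalTuple_rep h₁ hx, evalTuple_rep h₂ hx]

theorem smoothField_kappa (C : SpinorPairing) {ε₁ ε₂ : S.SpinorField} (h₁ : S.SmoothSpinor ε₁)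
    (h₂ : S.SmoothSpinor ε₂) : SmoothField (S.kappa C ε₁ ε₂) := by
  intro x
  have h := (S.orthoFrame (S.indexAt x)).smoothFieldOn_toField
    (currentA C (rep (S.indexAt x) h₁) (rep (S.indexAt x) h₂))
  have hU := (S.isOpen_baseSet (S.indexAt x)).mem_nhds (S.mem_baseSet_at x)
  refine (ContMDiffOn.contMDiffAt h hU).congr_of_eventuallyEq
    (Filter.eventuallyEq_of_mem hU fun y hy => ?_)
  have e : S.kappa C ε₁ ε₂ y = (S.orthoFrame (S.indexAt x)).toField
      (currentA C (rep (S.indexAt x) h₁) (rep (S.indexAt x) h₂)) y := by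
    rw [(S.orthoFrame (S.indexAt x)).eq_sum hy (S.kappa C ε₁ ε₂ y)]
    exact Finset.sum_congr rfl fun μ _ => by
      rw [show eta μ * _ = _ from coords_kappa_eq_evalAt C h₁ h₂ hy μ]; rfl
  simp only [e]

theorem comps_kappa (C : SpinorPairing) {ε₁ ε₂ : S.SpinorField} (h₁ : S.SmoothSpinor ε₁)
    (h₂ : S.SmoothSpinor ε₂) (i : ι) :
    (S.orthoFrame i).comps (S.kappa C ε₁ ε₂) ((smoothField_kappa C h₁ h₂).smoothFieldOn _) =
      currentA C (rep i h₁) (rep i h₂) := by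
  refine (S.orthoFrame i).comps_ext _ (fun x hx μ => coords_kappa_eq_evalAt C h₁ h₂ hx μ)
    (fun x hx μ => ?_)
  rw [eval_currentA, evalTuple_rep_of_notMem h₁ hx, evalTuple_rep_of_notMem h₂ hx]
  simp [SpinorPairing.current]

end SpinStructure

end Manifold

/-! ## Lie superalgebras from their even and odd parts -/

section Super

variable {V₀ V₁ : Type*} [AddCommGroup V₀] [Module ℝ V₀] [AddCommGroup V₁] [Module ℝ V₁]

/-- The bracket on `V₀ × V₁` given by its even-even, odd-odd and even-odd components. -/
def superBilin (l : V₀ →ₗ[ℝ] V₀ →ₗ[ℝ] V₀) (k : V₁ →ₗ[ℝ] V₁ →ₗ[ℝ] V₀)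
    (m : V₀ →ₗ[ℝ] V₁ →ₗ[ℝ] V₁) : (V₀ × V₁) →ₗ[ℝ] (V₀ × V₁) →ₗ[ℝ] (V₀ × V₁) :=
  LinearMap.mk₂ ℝ (fun p q => (l p.1 q.1 + k p.2 q.2, m p.1 q.2 - m q.1 p.2))
    (fun p p' q => by
      ext
      · simp only [Prod.fst_add, Prod.snd_add, map_add, LinearMap.add_apply]; abel
      · simp only [Prod.fst_add, Prod.snd_add, map_add, LinearMap.add_apply]; abel)
    (fun c p q => by ext <;> simp [smul_sub])
    (fun p q q' => by
      ext
      · simp only [Prod.fst_add, Prod.snd_add, map_add, LinearMap.add_apply]; abel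
      · simp only [Prod.fst_add, Prod.snd_add, map_add, LinearMap.add_apply]; abel)
    (fun c p q => by ext <;> simp [smul_sub])

theorem superBilin_apply (l : V₀ →ₗ[ℝ] V₀ →ₗ[ℝ] V₀) (k : V₁ →ₗ[ℝ] V₁ →ₗ[ℝ] V₀)
    (m : V₀ →ₗ[ℝ] V₁ →ₗ[ℝ] V₁) (p q : V₀ × V₁) :
    superBilin l k m p q = (l p.1 q.1 + k p.2 q.2, m p.1 q.2 - m q.1 p.2) := rfl

theorem mem_superGrading_zero {p : V₀ × V₁} : p ∈ superGrading V₀ V₁ 0 ↔ p.2 = 0 := by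
  simp [superGrading]

theorem mem_superGrading_one {p : V₀ × V₁} : p ∈ superGrading V₀ V₁ 1 ↔ p.1 = 0 := by
  simp [superGrading]

theorem zmod_two_cases : ∀ i : ZMod 2, i = 0 ∨ i = 1 := by decide

theorem isInternal_superGrading : DirectSum.IsInternal (superGrading V₀ V₁) := by
  have hu : (Set.univ : Set (ZMod 2)) = {0, 1} := by
    ext i; simpa using zmod_two_cases i
  rw [DirectSum.isInternal_submodule_iff_isCompl (i := 0) (j := 1) _ (by decide) hu]
  constructor
  · rw [Submodule.disjoint_def]
    intro p h h'
    exact Prod.ext (mem_superGrading_one.1 h') (mem_superGrading_zero.1 h)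
  · rw [codisjoint_iff, eq_top_iff]
    intro p _
    rw [Submodule.mem_sup]
    exact ⟨(p.1, 0), mem_superGrading_zero.2 rfl, (0, p.2), mem_superGrading_one.2 rfl, by simp⟩

/-- Inclusion-exclusion on the cubic form at `s + t + u` and its partial sums isolates the trilinear
part, which by symmetry of `k` occurs twice. -/
theorem cubic_polarisation {k : V₁ →ₗ[ℝ] V₁ →ₗ[ℝ] V₀} {m : V₀ →ₗ[ℝ] V₁ →ₗ[ℝ] V₁}
    (hk : ∀ s t, k s t = k t s) (h : ∀ s, m (k s s) s = 0) (s t u : V₁) :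
    m (k s t) u + m (k t u) s + m (k s u) t = 0 := by
  have h1 := h (s + t + u)
  have h2 := h (s + t)
  have h3 := h (s + u)
  have h4 := h (t + u)
  simp only [map_add, LinearMap.add_apply, h, hk t s, hk u s, hk u t, zero_add, add_zero]
    at h1 h2 h3 h4
  have e : (2 : ℝ) • (m (k s t) u + m (k t u) s + m (k s u) t) = 0 := by
    rw [two_smul]
    have h5 := congrArg₂ (· - ·) (congrArg₂ (· - ·) (congrArg₂ (· - ·) h1 h2) h3) h4
    simp only [sub_zero] at h5
    rw [← h5]
    abel
  exact (smul_eq_zero.1 e).resolve_left two_ne_zero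

/-- The super Jacobi identity splits by parity: `hj` for three even elements, `hm` for one odd, `hd`
for two odd, and the polarisation of `hc` for three odd. -/
theorem isLieSuperalgebra_superBilin {l : V₀ →ₗ[ℝ] V₀ →ₗ[ℝ] V₀} {k : V₁ →ₗ[ℝ] V₁ →ₗ[ℝ] V₀}
    {m : V₀ →ₗ[ℝ] V₁ →ₗ[ℝ] V₁} (hl : ∀ x y, l x y = -l y x)
    (hj : ∀ x y z, l x (l y z) = l (l x y) z + l y (l x z)) (hk : ∀ s t, k s t = k t s)
    (hm : ∀ x y s, m (l x y) s = m x (m y s) - m y (m x s))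
    (hd : ∀ x s t, l x (k s t) = k (m x s) t + k s (m x t)) (hc : ∀ s, m (k s s) s = 0) :
    IsLieSuperalgebra (superGrading V₀ V₁) (superBilin l k m) where
  isInternal := isInternal_superGrading
  bracket_mem i j p q hp hq := by
    obtain rfl | rfl := zmod_two_cases i <;> obtain rfl | rfl := zmod_two_cases j
    · have h1 := mem_superGrading_zero.1 hp
      have h2 := mem_superGrading_zero.1 hq
      refine mem_superGrading_zero.2 ?_
      simp [superBilin_apply, h1, h2]
    · have h1 := mem_superGrading_zero.1 hp
      have h2 := mem_superGrading_one.1 hq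
      refine mem_superGrading_one.2 ?_
      simp [superBilin_apply, h1, h2]
    · have h1 := mem_superGrading_one.1 hp
      have h2 := mem_superGrading_zero.1 hq
      refine mem_superGrading_one.2 ?_
      simp [superBilin_apply, h1, h2]
    · have h1 := mem_superGrading_one.1 hp
      have h2 := mem_superGrading_one.1 hq
      refine mem_superGrading_zero.2 ?_
      simp [superBilin_apply, h1, h2]
  skew i j p q hp hq := by
    obtain ⟨x, s⟩ := p
    obtain ⟨y, t⟩ := q
    obtain rfl | rfl := zmod_two_cases i <;> obtain rfl | rfl := zmod_two_cases j
    · obtain rfl : s = 0 := mem_superGrading_zero.1 hp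
      obtain rfl : t = 0 := mem_superGrading_zero.1 hq
      simp [superBilin_apply, hl x y]
    · obtain rfl : s = 0 := mem_superGrading_zero.1 hp
      obtain rfl : y = 0 := mem_superGrading_one.1 hq
      simp [superBilin_apply]
    · obtain rfl : x = 0 := mem_superGrading_one.1 hp
      obtain rfl : t = 0 := mem_superGrading_zero.1 hq
      simp [superBilin_apply]
    · obtain rfl : x = 0 := mem_superGrading_one.1 hp
      obtain rfl : y = 0 := mem_superGrading_one.1 hq
      simp [superBilin_apply, hk s t, ZMod.val_one]
  jacobi i j p q r hp hq := by
    obtain ⟨x, s⟩ := p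
    obtain ⟨y, t⟩ := q
    obtain ⟨z, u⟩ := r
    obtain rfl | rfl := zmod_two_cases i <;> obtain rfl | rfl := zmod_two_cases j
    · obtain rfl : s = 0 := mem_superGrading_zero.1 hp
      obtain rfl : t = 0 := mem_superGrading_zero.1 hq
      ext
      · simp [superBilin_apply, hj x y z]
      · simp [superBilin_apply, hm x y u]
    · obtain rfl : s = 0 := mem_superGrading_zero.1 hp
      obtain rfl : y = 0 := mem_superGrading_one.1 hq
      ext
      · simp [superBilin_apply, hd x t u]
      · simp [superBilin_apply, hm x z t]
        abel
    · obtain rfl : x = 0 := mem_superGrading_one.1 hp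
      obtain rfl : t = 0 := mem_superGrading_zero.1 hq
      ext
      · simp [superBilin_apply, hd y s u]
      · simp [superBilin_apply, hm y z s, sub_eq_add_neg]
    · obtain rfl : x = 0 := mem_superGrading_one.1 hp
      obtain rfl : y = 0 := mem_superGrading_one.1 hq
      ext
      · simp [superBilin_apply, ZMod.val_one, hl (k s t) z, hd z s t, hk t]
      · have h := cubic_polarisation hk hc s t u
        simp only [superBilin_apply, map_zero, LinearMap.zero_apply, zero_add, zero_sub, map_neg,
          ZMod.val_one, mul_one, pow_one, neg_smul, one_smul, Prod.snd_add, Prod.snd_neg,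
          sub_zero, neg_neg]
        rw [eq_comm, ← sub_eq_zero]
        refine Eq.trans ?_ h
        abel

end Super

/-! ## The Killing superalgebra of a spin manifold -/

theorem FrameCalculus.bracket_zero {A : Type*} [CommRing A] [Algebra ℝ A] (F : FrameCalculus A)
    (X : Fin 4 → A) : F.bracket X 0 = 0 := by
  simpa using F.bracket_add X 0 0

theorem FrameCalculus.bracket_bracket_eq_zero {A : Type*} [CommRing A] [Algebra ℝ A]
    (F : FrameCalculus A) {X Y Z : Fin 4 → A} (hX : F.bracket X Z = 0) (hY : F.bracket Y Z = 0) :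
    F.bracket (F.bracket X Y) Z = 0 := by
  have h := F.jacobi X Y Z
  rwa [hX, hY, F.bracket_zero, F.bracket_zero, add_zero, eq_comm] at h

theorem FrameCalculus.IsKilling.bracket {A : Type*} [CommRing A] [Algebra ℝ A]
    {F : FrameCalculus A} {X Y : Fin 4 → A} (hX : F.IsKilling X) (hY : F.IsKilling Y)
    (ev : A →ₐ[ℝ] ℝ) : IsSkew fun μ ν => ev (F.lie (F.bracket X Y) μ ν) := by
  intro μ ν
  have h := (hX.eval ev).lowerMul_sub (hY.eval ev) μ ν
  simp only [F.lie_bracket]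
  rw [hX μ ν, hY μ ν, map_neg, map_neg, map_neg, map_neg, h]
  ring

section Manifold

variable {M : Type*} [TopologicalSpace M] [ChartedSpace (EuclideanSpace ℝ (Fin 4)) M]
  [IsManifold (𝓡 4) ∞ M] {g : LorentzianMetric M}

open FrameCalculus

/-- Each symmetry condition is an assertion at a point, so it may be tested in any one orthonormal
frame around that point. -/
theorem mem_symmetries_of_frames {a b : M → ℝ} {φ : VField M}
    (ha : ContMDiff (𝓡 4) 𝓘(ℝ, ℝ) ∞ a) (hb : ContMDiff (𝓡 4) 𝓘(ℝ, ℝ) ∞ b) (hφ : SmoothField φ)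
    {X : VField M} (hX : SmoothField X)
    (h : ∀ x, ∃ E : OrthoFrame g, x ∈ E.dom ∧
      (IsSkew fun μ ν => evalAt E.dom x (E.calculus.lie (E.comps X (hX.smoothFieldOn _)) μ ν)) ∧
      evalAt E.dom x (E.calculus.der (E.comps X (hX.smoothFieldOn _)) (E.restrict ha)) = 0 ∧
      evalAt E.dom x (E.calculus.der (E.comps X (hX.smoothFieldOn _)) (E.restrict hb)) = 0 ∧
      evalTuple (evalAt E.dom x) (E.calculus.bracket (E.comps X (hX.smoothFieldOn _))
        (E.comps φ (hφ.smoothFieldOn _))) = 0) : X ∈ symmetries g a b φ := by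
  refine ⟨hX, fun Y Z hY hZ x => ?_, fun x => ?_, fun x => ?_, fun x => ?_⟩ <;>
    obtain ⟨E, hx, h1, h2, h3, h4⟩ := h x
  · exact E.lieDeriv_eq_zero hX hY hZ hx h1
  · rwa [E.evalAt_der hx] at h2
  · rwa [E.evalAt_der hx] at h3
  · exact (E.bracket_eq_zero_iff _ _ hx).1 h4

namespace SpinStructure

variable {ι : Type*} {S : SpinStructure ι g} {a b : M → ℝ} {φ : VField M}

section Closure

variable [T2Space M]

theorem mlieBracket_mem_symmetries (S : SpinStructure ι g) (ha : ContMDiff (𝓡 4) 𝓘(ℝ, ℝ) ∞ a)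
    (hb : ContMDiff (𝓡 4) 𝓘(ℝ, ℝ) ∞ b) (hφ : SmoothField φ) {X Y : VField M}
    (hX : X ∈ symmetries g a b φ) (hY : Y ∈ symmetries g a b φ) :
    mlieBracket (𝓡 4) X Y ∈ symmetries g a b φ := by
  obtain ⟨x0, x1, x2, x3, x4⟩ := hX
  obtain ⟨y0, y1, y2, y3, y4⟩ := hY
  have h0 : SmoothField (mlieBracket (𝓡 4) X Y) := contMDiffOn_univ.1
    (SmoothFieldOn.mlieBracket (x0.smoothFieldOn _) (y0.smoothFieldOn _) isOpen_univ)
  refine mem_symmetries_of_frames ha hb hφ h0 fun x =>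
    ⟨S.orthoFrame (S.indexAt x), S.mem_baseSet_at x, ?_⟩
  obtain ⟨E, hE⟩ : ∃ E, E = S.orthoFrame (S.indexAt x) := ⟨_, rfl⟩
  rw [← hE, E.comps_mlieBracket (x0.smoothFieldOn _) (y0.smoothFieldOn _)]
  refine ⟨(E.isKilling_comps x0 x1).bracket (E.isKilling_comps y0 y1) _, ?_, ?_, ?_⟩
  · rw [E.calculus.der_bracket, E.der_eq_zero ha _ x2, E.der_eq_zero ha _ y2, map_zero, map_zero,
      sub_zero, map_zero]
  · rw [E.calculus.der_bracket, E.der_eq_zero hb _ x3, E.der_eq_zero hb _ y3, map_zero, map_zero,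
      sub_zero, map_zero]
  · rw [E.calculus.bracket_bracket_eq_zero (E.bracket_eq_zero _ _ x4) (E.bracket_eq_zero _ _ y4)]
    funext μ; exact map_zero _

theorem diracCurrent_mem_symmetries (ha : ContMDiff (𝓡 4) 𝓘(ℝ, ℝ) ∞ a)
    (hb : ContMDiff (𝓡 4) 𝓘(ℝ, ℝ) ∞ b) (hφ : SmoothField φ) (C : SpinorPairing) {ε : S.SpinorField}
    (hε : ε ∈ S.killingSpinors a b φ) : S.diracCurrent C ε ∈ symmetries g a b φ := by
  rw [diracCurrent_eq_kappa]
  refine mem_symmetries_of_frames ha hb hφ (smoothField_kappa C hε.1 hε.1) fun x =>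
    ⟨S.orthoFrame (S.indexAt x), S.mem_baseSet_at x, ?_⟩
  rw [comps_kappa C hε.1 hε.1]
  have h := isKillingSpinor_rep ha hb hφ C hε.1 hε.2 (S.indexAt x)
  exact ⟨h.eval_isKilling_current C _, h.current_symmetry C _⟩

/-- Both spaces are linear, so the quadratic statement for the Dirac current polarises. -/
theorem kappa_mem_symmetries (ha : ContMDiff (𝓡 4) 𝓘(ℝ, ℝ) ∞ a)
    (hb : ContMDiff (𝓡 4) 𝓘(ℝ, ℝ) ∞ b) (hφ : SmoothField φ) (C : SpinorPairing) {ε₁ ε₂ : S.SpinorField}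
    (h₁ : ε₁ ∈ S.killingSpinors a b φ) (h₂ : ε₂ ∈ S.killingSpinors a b φ) :
    S.kappa C ε₁ ε₂ ∈ symmetries g a b φ :=
  Submodule.smul_mem _ _ (Submodule.sub_mem _ (Submodule.sub_mem _
    (diracCurrent_mem_symmetries ha hb hφ C (Submodule.add_mem _ h₁ h₂))
    (diracCurrent_mem_symmetries ha hb hφ C h₁)) (diracCurrent_mem_symmetries ha hb hφ C h₂))

theorem kosmann_mem_killingSpinors (ha : ContMDiff (𝓡 4) 𝓘(ℝ, ℝ) ∞ a)
    (hb : ContMDiff (𝓡 4) 𝓘(ℝ, ℝ) ∞ b) (hφ : SmoothField φ) (C : SpinorPairing) {X : VField M} {ε : S.SpinorField}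
    (hX : X ∈ symmetries g a b φ) (hε : ε ∈ S.killingSpinors a b φ) :
    S.kosmann X ε ∈ S.killingSpinors a b φ := by
  obtain ⟨x0, x1, x2, x3, x4⟩ := hX
  refine ⟨smoothSpinor_kosmann C x0 x1 hε.1, fun Y hY => ?_⟩
  refine gravitino_eq_zero ha hb hφ C hY (smoothSpinor_kosmann C x0 x1 hε.1) fun x =>
    ⟨S.indexAt x, S.mem_baseSet_at x, ?_⟩
  rw [rep_kosmann C x0 x1 hε.1]
  exact (isKillingSpinor_rep ha hb hφ C hε.1 hε.2 (S.indexAt x)).lieSpinor _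
    ((S.orthoFrame _).isKilling_comps x0 x1) ((S.orthoFrame _).der_eq_zero ha _ x2)
    ((S.orthoFrame _).der_eq_zero hb _ x3) ((S.orthoFrame _).bracket_eq_zero _ _ x4)

/-- The odd-odd-odd Jacobi identity on the diagonal, read off in one frame from `lieSpinor_current`.
-/
theorem kosmann_kappa_self (ha : ContMDiff (𝓡 4) 𝓘(ℝ, ℝ) ∞ a)
    (hb : ContMDiff (𝓡 4) 𝓘(ℝ, ℝ) ∞ b) (hφ : SmoothField φ) (C : SpinorPairing) {ε : S.SpinorField}
    (hε : ε ∈ S.killingSpinors a b φ) : S.kosmann (S.kappa C ε ε) ε = 0 := by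
  funext x
  refine S.localRep_injective (ε' := 0) (S.mem_baseSet_at x) ?_
  rw [localRep_kosmann_eq C (smoothField_kappa C hε.1 hε.1)
    (kappa_mem_symmetries ha hb hφ C hε hε).2.1 hε.1 (S.mem_baseSet_at x),
    comps_kappa C hε.1 hε.1, localRep_zero]
  exact (isKillingSpinor_rep ha hb hφ C hε.1 hε.2 (S.indexAt x)).lieSpinor_current C _

theorem mlieBracket_kappa (C : SpinorPairing) {X : VField M} {ε₁ ε₂ : S.SpinorField}
    (hX : X ∈ symmetries g a b φ) (h₁ : S.SmoothSpinor ε₁) (h₂ : S.SmoothSpinor ε₂) :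
    mlieBracket (𝓡 4) X (S.kappa C ε₁ ε₂) =
      S.kappa C (S.kosmann X ε₁) ε₂ + S.kappa C ε₁ (S.kosmann X ε₂) := by
  funext x
  have hx := S.mem_baseSet_at x
  have hX' := hX.1.smoothFieldOn (S.orthoFrame (S.indexAt x)).dom
  have hk := (smoothField_kappa C h₁ h₂).smoothFieldOn (S.orthoFrame (S.indexAt x)).dom
  refine (S.orthoFrame (S.indexAt x)).ext_inner hx fun μ => ?_
  have key : (S.orthoFrame (S.indexAt x)).coords x (mlieBracket (𝓡 4) X (S.kappa C ε₁ ε₂) x) μ =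
      (S.orthoFrame (S.indexAt x)).coords x (S.kappa C (S.kosmann X ε₁) ε₂ x) μ
        + (S.orthoFrame (S.indexAt x)).coords x (S.kappa C ε₁ (S.kosmann X ε₂) x) μ := by
    rw [S.coords_kappa C _ _ hx, S.coords_kappa C _ _ hx,
      localRep_kosmann_eq C hX.1 hX.2.1 h₁ hx, localRep_kosmann_eq C hX.1 hX.2.1 h₂ hx,
      ← evalTuple_rep h₁ hx, ← evalTuple_rep h₂ hx,
      ← bracket_currentA _ C _ ((S.orthoFrame _).isKilling_comps hX.1 hX.2.1),
      ← comps_kappa C h₁ h₂, ← (S.orthoFrame _).comps_mlieBracket hX' hk,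
      (S.orthoFrame _).evalAt_comps _ hx]
  rw [Pi.add_apply, map_add, _root_.add_apply]
  have h2 := congrArg (eta μ * ·) key
  simp only [OrthoFrame.coords, mul_add, ← mul_assoc, eta_mul_eta, one_mul] at h2
  exact h2

theorem kosmann_mlieBracket (C : SpinorPairing) (ha : ContMDiff (𝓡 4) 𝓘(ℝ, ℝ) ∞ a)
    (hb : ContMDiff (𝓡 4) 𝓘(ℝ, ℝ) ∞ b) (hφ : SmoothField φ) {X Y : VField M} {ε : S.SpinorField}
    (hX : X ∈ symmetries g a b φ) (hY : Y ∈ symmetries g a b φ) (hε : S.SmoothSpinor ε) :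
    S.kosmann (mlieBracket (𝓡 4) X Y) ε =
      S.kosmann X (S.kosmann Y ε) - S.kosmann Y (S.kosmann X ε) := by
  funext x
  have hx := S.mem_baseSet_at x
  have hb' := mlieBracket_mem_symmetries S ha hb hφ hX hY
  refine S.localRep_injective hx ?_
  rw [sub_eq_add_neg, ← neg_one_smul ℝ, localRep_add, localRep_smul, Pi.add_apply, Pi.smul_apply,
    neg_one_smul, ← sub_eq_add_neg,
    localRep_kosmann_eq C hX.1 hX.2.1 (smoothSpinor_kosmann C hY.1 hY.2.1 hε) hx,
    localRep_kosmann_eq C hY.1 hY.2.1 (smoothSpinor_kosmann C hX.1 hX.2.1 hε) hx,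
    rep_kosmann C hX.1 hX.2.1 hε, rep_kosmann C hY.1 hY.2.1 hε,
    ← lieSpinor_bracket _ _ ((S.orthoFrame _).isKilling_comps hX.1 hX.2.1)
      ((S.orthoFrame _).isKilling_comps hY.1 hY.2.1),
    ← (S.orthoFrame _).comps_mlieBracket]
  exact localRep_kosmann_eq C hb'.1 hb'.2.1 hε hx

/-- The Koszul expressions in `kosmann` obscure linearity in `X`; for Killing fields
`localRep_kosmann` replaces them by the Lie bracket, where it is evident. -/
theorem kosmann_add_left (C : SpinorPairing) {X Y : VField M} {ε : S.SpinorField}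
    (hX : X ∈ symmetries g a b φ) (hY : Y ∈ symmetries g a b φ) (hε : S.SmoothSpinor ε) :
    S.kosmann (X + Y) ε = S.kosmann X ε + S.kosmann Y ε := by
  funext x
  have hx := S.mem_baseSet_at x
  have h := Submodule.add_mem _ hX hY
  have hs {Z : VField M} (hZ : Z ∈ symmetries g a b φ) (j : ι) (hj : x ∈ S.baseSet j) :=
    (S.orthoFrame j).isSkew_inner_bracket hZ.1 hZ.2.1 hj
  refine S.localRep_injective hx ?_
  rw [localRep_add, Pi.add_apply, localRep_kosmann C h.1 hε hx (hs h),
    localRep_kosmann C hX.1 hε hx (hs hX), localRep_kosmann C hY.1 hε hx (hs hY),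
    add_add_add_comm, ← Matrix.add_mulVec, ← spinSigma_add]
  congr 3
  · funext k; exact map_add _ _ _
  · funext μ ν
    rw [mlieBracket_add_left (hX.1.mdifferentiableAt x) (hY.1.mdifferentiableAt x), map_add]
    rfl

theorem kosmann_smul_left (C : SpinorPairing) (c : ℝ) {X : VField M} {ε : S.SpinorField}
    (hX : X ∈ symmetries g a b φ) (hε : S.SmoothSpinor ε) :
    S.kosmann (c • X) ε = c • S.kosmann X ε := by
  funext x
  have hx := S.mem_baseSet_at x
  have h := Submodule.smul_mem _ c hX
  have hs {Z : VField M} (hZ : Z ∈ symmetries g a b φ) (j : ι) (hj : x ∈ S.baseSet j) :=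
    (S.orthoFrame j).isSkew_inner_bracket hZ.1 hZ.2.1 hj
  refine S.localRep_injective hx ?_
  rw [localRep_smul, Pi.smul_apply, localRep_kosmann C h.1 hε hx (hs h),
    localRep_kosmann C hX.1 hε hx (hs hX), smul_add, ← Matrix.smul_mulVec, ← spinSigma_smul]
  congr 3
  · funext k; exact map_smul (mvfderiv (𝓡 4) (fun y => S.localRep _ ε y k) x) c (X x)
  · funext μ ν
    rw [mlieBracket_const_smul_left (hX.1.mdifferentiableAt x), map_smul]
    rfl

end Closure

theorem kosmann_add_right (X : VField M) {ε ε' : S.SpinorField} (h : S.SmoothSpinor ε)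
    (h' : S.SmoothSpinor ε') : S.kosmann X (ε + ε') = S.kosmann X ε + S.kosmann X ε' := by
  funext x
  simp only [kosmann, S.nabla_add h h', Pi.add_apply, map_add]
  abel

theorem kosmann_smul_right (c : ℝ) (X : VField M) {ε : S.SpinorField} (h : S.SmoothSpinor ε) :
    S.kosmann X (c • ε) = c • S.kosmann X ε := by
  funext x
  simp only [kosmann, S.nabla_smul c h, Pi.smul_apply, map_smul, smul_add]

variable (S) in
theorem kappa_comm (C : SpinorPairing) (ε₁ ε₂ : S.SpinorField) :
    S.kappa C ε₁ ε₂ = S.kappa C ε₂ ε₁ := by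
  funext x
  rw [kappa_apply, kappa_apply, C.current_comm]

variable (S) in
theorem kappa_add_left (C : SpinorPairing) (ε₁ ε₂ ε₃ : S.SpinorField) :
    S.kappa C (ε₁ + ε₂) ε₃ = S.kappa C ε₁ ε₃ + S.kappa C ε₂ ε₃ := by
  funext x
  simp only [Pi.add_apply, kappa_apply, SpinorPairing.current, map_add, LinearMap.add_apply,
    mul_add, add_smul, Finset.sum_add_distrib]

variable (S) in
theorem kappa_smul_left (C : SpinorPairing) (c : ℝ) (ε₁ ε₂ : S.SpinorField) :
    S.kappa C (c • ε₁) ε₂ = c • S.kappa C ε₁ ε₂ := by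
  funext x
  simp only [Pi.smul_apply, kappa_apply, SpinorPairing.current, map_smul, LinearMap.smul_apply,
    smul_eq_mul, Finset.smul_sum, smul_smul, mul_left_comm c]

section Superalgebra

variable [T2Space M]

/-- The commutator of symmetries. -/
def lieBilin (S : SpinStructure ι g) (ha : ContMDiff (𝓡 4) 𝓘(ℝ, ℝ) ∞ a)
    (hb : ContMDiff (𝓡 4) 𝓘(ℝ, ℝ) ∞ b) (hφ : SmoothField φ) :
    symmetries g a b φ →ₗ[ℝ] symmetries g a b φ →ₗ[ℝ] symmetries g a b φ :=
  LinearMap.mk₂ ℝ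
    (fun X Y => ⟨mlieBracket (𝓡 4) X.1 Y.1, mlieBracket_mem_symmetries S ha hb hφ X.2 Y.2⟩)
    (fun X X' Y => Subtype.ext (funext fun x =>
      mlieBracket_add_left (X.2.1.mdifferentiableAt x) (X'.2.1.mdifferentiableAt x)))
    (fun c X Y => Subtype.ext (funext fun x =>
      mlieBracket_const_smul_left (X.2.1.mdifferentiableAt x)))
    (fun X Y Y' => Subtype.ext (funext fun x =>
      mlieBracket_add_right (Y.2.1.mdifferentiableAt x) (Y'.2.1.mdifferentiableAt x)))
    (fun c X Y => Subtype.ext (funext fun x =>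
      mlieBracket_const_smul_right (Y.2.1.mdifferentiableAt x)))

/-- The Dirac current of Killing spinors. -/
def kappaBilin (S : SpinStructure ι g) (C : SpinorPairing) (ha : ContMDiff (𝓡 4) 𝓘(ℝ, ℝ) ∞ a)
    (hb : ContMDiff (𝓡 4) 𝓘(ℝ, ℝ) ∞ b) (hφ : SmoothField φ) :
    S.killingSpinors a b φ →ₗ[ℝ] S.killingSpinors a b φ →ₗ[ℝ] symmetries g a b φ :=
  LinearMap.mk₂ ℝ (fun s t => ⟨S.kappa C s.1 t.1, kappa_mem_symmetries ha hb hφ C s.2 t.2⟩)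
    (fun s s' t => Subtype.ext (S.kappa_add_left C s.1 s'.1 t.1))
    (fun c s t => Subtype.ext (S.kappa_smul_left C c s.1 t.1))
    (fun s t t' => Subtype.ext (by
      change S.kappa C s.1 (t.1 + t'.1) = S.kappa C s.1 t.1 + S.kappa C s.1 t'.1
      rw [S.kappa_comm, S.kappa_add_left, S.kappa_comm C t.1, S.kappa_comm C t'.1]))
    (fun c s t => Subtype.ext (by
      change S.kappa C s.1 (c • t.1) = c • S.kappa C s.1 t.1
      rw [S.kappa_comm, S.kappa_smul_left, S.kappa_comm C t.1]))

/-- The spinorial Lie derivative of Killing spinors along symmetries. -/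
def kosmannBilin (S : SpinStructure ι g) (C : SpinorPairing) (ha : ContMDiff (𝓡 4) 𝓘(ℝ, ℝ) ∞ a)
    (hb : ContMDiff (𝓡 4) 𝓘(ℝ, ℝ) ∞ b) (hφ : SmoothField φ) :
    symmetries g a b φ →ₗ[ℝ] S.killingSpinors a b φ →ₗ[ℝ] S.killingSpinors a b φ :=
  LinearMap.mk₂ ℝ
    (fun X s => ⟨S.kosmann X.1 s.1, kosmann_mem_killingSpinors ha hb hφ C X.2 s.2⟩)
    (fun X X' s => Subtype.ext (kosmann_add_left C X.2 X'.2 s.2.1))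
    (fun c X s => Subtype.ext (kosmann_smul_left C c X.2 s.2.1))
    (fun X s s' => Subtype.ext (kosmann_add_right X.1 s.2.1 s'.2.1))
    (fun c X s => Subtype.ext (kosmann_smul_right c X.1 s.2.1))

theorem isLieSuperalgebra (ha : ContMDiff (𝓡 4) 𝓘(ℝ, ℝ) ∞ a)
    (hb : ContMDiff (𝓡 4) 𝓘(ℝ, ℝ) ∞ b) (hφ : SmoothField φ) (C : SpinorPairing) :
    IsLieSuperalgebra (superGrading (symmetries g a b φ) (S.killingSpinors a b φ))
      (superBilin (S.lieBilin ha hb hφ) (S.kappaBilin C ha hb hφ)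
        (S.kosmannBilin C ha hb hφ)) :=
  isLieSuperalgebra_superBilin
    (fun X Y => Subtype.ext (funext fun _ => mlieBracket_swap_apply))
    (fun X Y Z => Subtype.ext (funext fun x => jacobi_mlieBracket (X.2.1.smoothFieldOn _)
      (Y.2.1.smoothFieldOn _) (Z.2.1.smoothFieldOn _) isOpen_univ (Set.mem_univ x)))
    (fun s t => Subtype.ext (S.kappa_comm C s.1 t.1))
    (fun X Y s => Subtype.ext (kosmann_mlieBracket C ha hb hφ X.2 Y.2 s.2.1))
    (fun X s t => Subtype.ext (mlieBracket_kappa C X.2 s.2.1 t.2.1))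
    (fun s => Subtype.ext (kosmann_kappa_self ha hb hφ C s.2))

end Superalgebra

end SpinStructure

end Manifold

end KillingSuper

end

open KillingSuper in
theorem theorem3p4 {M : Type*} [TopologicalSpace M] [T2Space M]
    [ChartedSpace (EuclideanSpace ℝ (Fin 4)) M] [IsManifold (𝓡 4) ∞ M]
    (g : LorentzianMetric M) {ι : Type*} (S : SpinStructure ι g) (C : SpinorPairing)
    (a b : M → ℝ) (φ : VField M)
    (ha : ContMDiff (𝓡 4) 𝓘(ℝ, ℝ) ∞ a) (hb : ContMDiff (𝓡 4) 𝓘(ℝ, ℝ) ∞ b)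
    (hφ : SmoothField φ) :
    (∀ X ∈ symmetries g a b φ, ∀ Y ∈ symmetries g a b φ,
      mlieBracket (𝓡 4) X Y ∈ symmetries g a b φ) ∧
    (∀ ε ∈ S.killingSpinors a b φ, S.diracCurrent C ε ∈ symmetries g a b φ) ∧
    (∀ X ∈ symmetries g a b φ, ∀ ε ∈ S.killingSpinors a b φ,
      S.kosmann X ε ∈ S.killingSpinors a b φ) ∧
    ∃ B : (symmetries g a b φ × S.killingSpinors a b φ) →ₗ[ℝ]
        (symmetries g a b φ × S.killingSpinors a b φ) →ₗ[ℝ]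
          (symmetries g a b φ × S.killingSpinors a b φ),
      (∀ p q, (((B p q).1 : VField M), ((B p q).2 : S.SpinorField)) =
        S.superBracket C (p.1, p.2) (q.1, q.2)) ∧
      IsLieSuperalgebra (superGrading (symmetries g a b φ) (S.killingSpinors a b φ)) B :=
  ⟨fun _ hX _ hY => S.mlieBracket_mem_symmetries ha hb hφ hX hY,
    fun _ hε => SpinStructure.diracCurrent_mem_symmetries ha hb hφ C hε,
    fun _ hX _ hε => SpinStructure.kosmann_mem_killingSpinors ha hb hφ C hX hε,
    superBilin (S.lieBilin ha hb hφ) (S.kappaBilin C ha hb hφ) (S.kosmannBilin C ha hb hφ),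
    fun _ _ => rfl, SpinStructure.isLieSuperalgebra ha hb hφ C⟩
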